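/- Let $\mathrm D\subset\mathbb R^2$ be open, bounded and connected, with $0\in \mathrm D$, and suppose that $\partial \mathrm D$ is a union of disjoint rectifiable curves of positive diameter. For real $n>0$ let $$\mathrm D_n:=\{x\in\mathbb Z^2:\ \mathrm d(x/e^n,\mathrm D^c)>1/e^n\},$$ let $\widehat{\mathrm D}_n$ be the graph obtained from $\mathrm D_n$ together with its outer lattice boundary by contracting the outer boundary to a single vertex $\partial$, and let $X=(X_u)_{u\ge0}$ be the continuous time simple random walk on $\widehat{\mathrm D}_n$ started at $\partial$ with transition rate $1/(2\pi)$ along each edge. Let $\mathbf L_u(x):=\int_0^u 1_{\{X_r=x\}}\,dr$, $\mathbf L_t^{-1}(\partial):=\inf\{u\ge 0:\mathbf L_u(\partial)>t\}$ and $L_t(x):=\mathbf L_{\mathbf L_t^{-1}(\partial)}(x)$; let $\mathrm F_{n,t}(0):=\{x\in \mathrm D_n: L_t(x)=0\}$ be the set of sites not visited by $\partial$-time $t$. Put $t_n^B:=\frac12 n\log n$, fix $\eta_0\in(0,1/2)$, and let $r_n:=n^{1/2-\eta_0}$. For $k\in\mathbb N_0$ let $\mathrm B(x;k):=\{y\in\mathbb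 Z^2:\|x-y\|<e^k\}$ and $\mathbb X_k:=\lfloor e^k\rfloor\mathbb Z^2$. For bounded $\mathrm U\subset\mathbb Z^2$ let $\rho(\mathrm U):=\min\{k\in\mathbb N_0:\exists y\in\mathbb X_k,\ \mathrm U\subseteq \mathrm B(y;k)\}$. A set $\mathrm A\subseteq \mathrm D_n$ is $(r_n,n-r_n)$-clustered if $\rho\big(\mathrm B(z;\lfloor n-r_n\rfloor)\cap \mathrm A\big)\le r_n$ for all $z\in\mathbb X_{\lfloor n-r_n\rfloor}$. Its clustering number $\chi_n(\mathrm A)$ is the minimal $k\ge1$ for which there are $z_1,\dots,z_k\in\mathbb X_{\lfloor n-r_n\rfloor}$ with $\mathrm A\subseteq\bigcup_{i=1}^k \mathrm B(z_i;\lfloor n-r_n\rfloor)$. The bulk of $\mathrm D_n$ is $\mathrm D_n^\circ:=\{x\in\mathbb Z^2:\ \mathrm d(x,\mathbb Z^2\setminus \mathrm D_n)>e^{\,n-2\log n}\}$. Theorem (Phase B). For all $s\in\mathbb R$, $$\lim_{n\to\infty}\ \sup_{\mathrm A}\ \bigg|\,\mathbb P\Big(\mathrm A\cap \mathrm F_{n,t_n^B+sn}(0)=\emptyset\Big)-\exp\Big(-\frac{e^{-s}\chi_n(\mathrm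 A)}{\sqrt n}\Big)\bigg|=0,$$ where the supremum is over all $(r_n,n-r_n)$-clustered sets $\mathrm A\subseteq \mathrm D_n^\circ$. Moreover, for every fixed $s\in\mathbb R$, if $n$ is large enough then for all $\mathrm E\subseteq \mathrm D_n$ (not necessarily clustered), $$\mathbb P\Big(\mathrm E\cap \mathrm F_{n,t_n^B+sn}(0)\neq\emptyset\Big)\le 2e^{-s}\,\frac{|\mathrm E|}{\sqrt n}.$$ -/

import Mathlib

open Set Filter Topology MeasureTheory

noncomputable section

namespace WiredWalk

/-! ### Lattice geometry -/

/-- The Euclidean plane. -/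
abbrev Plane : Type := EuclideanSpace ℝ (Fin 2)

/-- The vertices of the square lattice. -/
abbrev Site : Type := ℤ × ℤ

/-- The inclusion of the square lattice in the plane. -/
def toPlane (x : Site) : Plane := !₂[(x.1 : ℝ), (x.2 : ℝ)]

/-- Nearest-neighbour adjacency in the square lattice. -/
def LatticeAdj (x y : Site) : Prop := |x.1 - y.1| + |x.2 - y.2| = 1

/-- `C` is (the image of) a rectifiable curve: a continuous curve of finite length. -/
def IsRectifiableCurve (C : Set Plane) : Prop :=
  ∃ γ : ℝ → Plane, ContinuousOn γ (Icc 0 1) ∧ BoundedVariationOn γ (Icc 0 1) ∧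
    γ '' Icc 0 1 = C

/-- The standing assumptions on the planar domain: open, bounded, connected, containing the
origin, with a boundary that is a union of disjoint rectifiable curves of positive diameter. -/
structure IsNice (D : Set Plane) : Prop where
  isOpen : IsOpen D
  isBounded : Bornology.IsBounded D
  isConnected : IsConnected D
  zero_mem : (0 : Plane) ∈ D
  boundary : ∃ 𝒞 : Set (Set Plane), frontier D = ⋃₀ 𝒞 ∧ 𝒞.PairwiseDisjoint id ∧
    ∀ C ∈ 𝒞, IsRectifiableCurve C ∧ 0 < Metric.diam C

/-- The lattice version `D_n` of `D` at scale `N = e ^ n`: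
all lattice points `x` such that `x / N` is at distance more than `1 / N` from `Dᶜ`. -/
def latticeDomain (D : Set Plane) (n : ℝ) : Set Site :=
  {x | 1 / Real.exp n < Metric.infDist ((Real.exp n)⁻¹ • toPlane x) Dᶜ}

/-- The `r`-bulk of a set of sites: the sites at distance more than `e ^ r` from the
complement (in the lattice) of the set. -/
def rBulk (U : Set Site) (r : ℝ) : Set Site :=
  {x | Real.exp r < Metric.infDist (toPlane x) (toPlane '' Uᶜ)}

/-- The bulk `D_n°` of `D_n`. -/
def domainBulk (D : Set Plane) (n : ℝ) : Set Site :=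
  rBulk (latticeDomain D n) (n - 2 * Real.log n)

/-- The open lattice ball `B(x; k)` of exponential radius `k`. -/
def latticeBall (x : Site) (k : ℕ) : Set Site :=
  {y | dist (toPlane x) (toPlane y) < Real.exp k}

/-- The scaled lattice `𝕏_k = ⌊e ^ k⌋ ℤ²`. -/
def scaledLattice (k : ℕ) : Set Site :=
  Set.range fun w : Site => (⌊Real.exp k⌋ * w.1, ⌊Real.exp k⌋ * w.2)

/-- The log-scale of a (bounded) set of sites: the least `k` such that the set lies in a ball
`B(y; k)` with centre `y ∈ 𝕏_k`. -/
def logScale (U : Set Site) : ℕ :=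
  sInf {k : ℕ | ∃ y ∈ scaledLattice k, U ⊆ latticeBall y k}

/-- `A` is `(a, b)`-clustered: inside every ball of exponential radius `⌊b⌋` centred in
`𝕏_⌊b⌋`, the set `A` has log-scale at most `a`. -/
def IsClustered (a b : ℝ) (A : Set Site) : Prop :=
  ∀ z ∈ scaledLattice ⌊b⌋₊, (logScale (latticeBall z ⌊b⌋₊ ∩ A) : ℝ) ≤ a

/-- The clustering number of a (finite) set `A` at scale `b`: the least `k ≥ 1` such that `k`
balls of exponential radius `⌊b⌋` centred in `𝕏_⌊b⌋` cover `A`. -/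
def clusteringNumber (b : ℝ) (A : Set Site) : ℕ :=
  sInf {k : ℕ | 1 ≤ k ∧ ∃ z : Fin k → Site, (∀ i, z i ∈ scaledLattice ⌊b⌋₊) ∧
    A ⊆ ⋃ i, latticeBall (z i) ⌊b⌋₊}

/-! ### The wired graph and its random walk -/

/-- The vertices of the graph obtained from `U ∪ ∂U` by contracting `∂U` into one vertex:
`some x` is the site `x ∈ U` and `none` is the boundary vertex `∂`. -/
abbrev WiredVertex (U : Set Site) : Type := Option U

open Classical in
/-- The number of edges between two vertices of the wired graph. The edges between `x ∈ U` and
`∂` are the lattice edges from `x` to sites outside `U`. Loops at `∂` are dropped: they have no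
effect on a continuous time walk. -/
def edgeCount (U : Set Site) : WiredVertex U → WiredVertex U → ℕ
  | some x, some y => if LatticeAdj x y then 1 else 0
  | some x, none => {y : Site | LatticeAdj x y ∧ y ∉ U}.ncard
  | none, some x => {y : Site | LatticeAdj x y ∧ y ∉ U}.ncard
  | none, none => 0

/-- The degree of a vertex of the wired graph (meant for finite `U`). -/
def wiredDegree (U : Set Site) (v : WiredVertex U) : ℕ := ∑ᶠ w, edgeCount U v w

/-- The probability that the walk, when it leaves `v`, jumps to `w`. -/
def jumpProb (U : Set Site) (v w : WiredVertex U) : ℝ :=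
  (edgeCount U v w : ℝ) / (wiredDegree U v : ℝ)

open Classical in
/-- Under `P`, the process `X = (X_u : u ≥ 0)` is the continuous time simple random walk on the
wired graph of the finite nonempty set `U`, started at `∂`, with transition rate `lam` along
each edge. That is, there are a sequence `Y` of visited vertices and a sequence `H` of holding
times such that `Y` is the Markov chain started at `∂` with transition probabilities `jumpProb`,
given `Y` the `H k` are independent exponential variables of rates `lam * deg (Y k)`, and almost
surely `X` sits at `Y k` from time `H 0 + ⋯ + H (k - 1)` (included) until time
`H 0 + ⋯ + H k` (excluded). -/
def IsWiredWalk (U : Set Site) (lam : ℝ) {Ω : Type*} [MeasurableSpace Ω] (P : Measure Ω)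
    (X : ℝ → Ω → WiredVertex U) : Prop :=
  ∃ (Y : ℕ → Ω → WiredVertex U) (H : ℕ → Ω → ℝ),
    (∀ k v, MeasurableSet {ω | Y k ω = v}) ∧
    (∀ k, Measurable (H k)) ∧
    (∀ (m : ℕ) (v : ℕ → WiredVertex U) (t : ℕ → ℝ), (∀ k, 0 ≤ t k) →
      P.real {ω | ∀ k ≤ m, Y k ω = v k ∧ t k < H k ω} =
        (if v 0 = none then 1 else 0) *
          (∏ k ∈ Finset.range m, jumpProb U (v k) (v (k + 1))) *
          ∏ k ∈ Finset.range (m + 1), Real.exp (-(lam * wiredDegree U (v k) * t k))) ∧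
    (∀ᵐ ω ∂P, ∀ (k : ℕ) (u : ℝ), ∑ i ∈ Finset.range k, H i ω ≤ u →
      u < ∑ i ∈ Finset.range (k + 1), H i ω → X u ω = Y k ω)

/-! ### Local times and unvisited sites -/

section LocalTime

variable {U : Set Site}

open Classical in
/-- The local time at `v` by real time `u` of a trajectory `x`. -/
def localTime (x : ℝ → WiredVertex U) (u : ℝ) (v : WiredVertex U) : ℝ :=
  ∫ r in (0 : ℝ)..u, if x r = v then (1 : ℝ) else 0

/-- The generalized inverse of the local time at `∂`: the real time by which the local time at
`∂` is `t`. -/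
def inverseLocalTime (x : ℝ → WiredVertex U) (t : ℝ) : ℝ :=
  sInf {u : ℝ | 0 ≤ u ∧ t < localTime x u none}

/-- The local time at `v` by `∂`-time `t`. -/
def boundaryLocalTime (x : ℝ → WiredVertex U) (t : ℝ) (v : WiredVertex U) : ℝ :=
  localTime x (inverseLocalTime x t) v

/-- The set of sites of `U` whose local time by `∂`-time `t` is at most `a`. For `a = 0` these
are the sites not visited by `∂`-time `t`. -/
def lowSites (x : ℝ → WiredVertex U) (t a : ℝ) : Set Site :=
  {y | ∃ h : y ∈ U, boundaryLocalTime x t (some ⟨y, h⟩) ≤ a}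

end LocalTime

/-! ### The scales -/

/-- The cluster scale `r_n = n ^ (1/2 - η₀)`. -/
def clusterScale (η₀ n : ℝ) : ℝ := n ^ (1 / 2 - η₀)

/-- The `∂`-time `t_n^B + s n`, where `t_n^B = (1/2) n log n`. -/
def phaseBTime (s n : ℝ) : ℝ := 1 / 2 * n * Real.log n + s * n

end WiredWalk

end

/-!
The expected local time at `x` of the wired walk, per unit of local time at `∂`, is one, and by
Kac's formula the law of the local times by a fixed `∂`-time is governed by the Green function
`green F` of the walk killed at `∂`. For one site `x` the probability to be unvisited by `∂`-time
`t` is `exp (-t / G(x, x))`, and for a set `S` it is `exp (-t cap S)`. In the bulk of `D_n` the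
Green function is `G(x, y) = n - log |x - y| + O(log n)`, so at `t = n log n / 2 + s n` the
probability for one site is `p = e ^ (-s) / √n` up to a factor `1 + o(1)`, as `log n` and `√n`
are negligible compared to `n / log n`. Everything is derived from this.

*Green function.* `le_green` and `green_le` compare `green F` with `logKernel`, a smoothed
logarithm whose Laplacian is nonnegative, of total mass `2π` (`hasSum_lap_logKernel`) and with a
finite first moment. The Green potential of that Laplacian is within a constant of the Green
function, because the Green function is Lipschitz (`abs_green_sub_le`), and the sum of kernel and
potential is harmonic, so that the maximum principle applies.

*Local times.* The walk stopped at the inverse local time of `∂` is treated by an exponential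
martingale along the jump chain (`lintegral_pathWeight_le`, `le_lintegral_pathWeight`): a
nonnegative supersolution `f` for the walk with killing or with a potential gives an upper bound
`exp (-t * escapeRate F f)` for the expected weight, a subsolution gives a lower bound. These
bounds are collected in `IsOccupationField`. Choosing `f` as a combination of Green functions
yields upper and lower bounds for the probability that a set is unvisited (`prob_unvisited_le`,
`le_prob_unvisited`), a bound for the probability of a small local time (`prob_le_of_small`), and
a bound for the probability that a site is unvisited although a close one has large local time
(`prob_large_and_unvisited_le`).

*Clusters.* An optimal cover of a clustered set splits it into `χ` clusters with representatives
at mutual distance `e ^ (n - o(n / log n))` (`IsClustered.exists_decomposition`). The Green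
function between distinct representatives is negligible compared to `n`, so the events that
representatives are unvisited are nearly independent. A cluster is hardly more likely than its
representative to contain an unvisited site: the representative, if visited, typically has local
time far above the variation of the Green function inside the cluster, and then the whole cluster
is visited, by a union bound over its at most `36 e ^ (2 r_n)` sites (`prob_exists_unvisited_le`).
The Bonferroni inequalities turn this into the Poisson limit `exp (-χ p)`, uniformly in `χ`; when
`χ p` is large, a subfamily suffices (`abs_prob_none_sub_exp_le`). The second claim is the union
bound for single sites.
-/

noncomputable section

namespace WiredWalk

/-! ### The lattice Laplacian and the Green function of a finite set -/

/-- The four nearest neighbours of a site. -/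
def nbrs (x : Site) : Finset Site :=
  {(x.1 + 1, x.2), (x.1 - 1, x.2), (x.1, x.2 + 1), (x.1, x.2 - 1)}

theorem mem_nbrs {x y : Site} : y ∈ nbrs x ↔ LatticeAdj x y := by
  obtain ⟨a, b⟩ := x
  obtain ⟨c, d⟩ := y
  simp only [nbrs, Finset.mem_insert, Finset.mem_singleton, Prod.mk.injEq, LatticeAdj]
  constructor
  · rintro (⟨rfl, rfl⟩ | ⟨rfl, rfl⟩ | ⟨rfl, rfl⟩ | ⟨rfl, rfl⟩) <;> simp
  · intro h
    rcases abs_cases (a - c) with h1 | h1 <;> rcases abs_cases (b - d) with h2 | h2 <;> omega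

theorem mem_nbrs_comm {x y : Site} : y ∈ nbrs x ↔ x ∈ nbrs y := by
  rw [mem_nbrs, mem_nbrs, LatticeAdj, LatticeAdj, abs_sub_comm, abs_sub_comm x.2]

theorem sum_nbrs (f : Site → ℝ) (x : Site) :
    ∑ y ∈ nbrs x, f y =
      f (x.1 + 1, x.2) + f (x.1 - 1, x.2) + f (x.1, x.2 + 1) + f (x.1, x.2 - 1) := by
  have h1 : (x.1 + 1, x.2) ∉ ({(x.1 - 1, x.2), (x.1, x.2 + 1), (x.1, x.2 - 1)} : Finset Site) := by
    simp only [Finset.mem_insert, Finset.mem_singleton, Prod.mk.injEq]; omega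
  have h2 : (x.1 - 1, x.2) ∉ ({(x.1, x.2 + 1), (x.1, x.2 - 1)} : Finset Site) := by
    simp only [Finset.mem_insert, Finset.mem_singleton, Prod.mk.injEq]; omega
  have h3 : (x.1, x.2 + 1) ∉ ({(x.1, x.2 - 1)} : Finset Site) := by
    simp only [Finset.mem_singleton, Prod.mk.injEq]; omega
  rw [nbrs, Finset.sum_insert h1, Finset.sum_insert h2, Finset.sum_insert h3,
    Finset.sum_singleton]
  ring

theorem card_nbrs (x : Site) : (nbrs x).card = 4 := by
  have h := sum_nbrs (fun _ => 1) x
  simp only [Finset.sum_const, nsmul_eq_mul, mul_one] at h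
  norm_num at h
  exact_mod_cast h

/-- The (unnormalised) lattice Laplacian. -/
def lap (f : Site → ℝ) (x : Site) : ℝ := ∑ y ∈ nbrs x, (f y - f x)

theorem lap_eq (f : Site → ℝ) (x : Site) : lap f x = ∑ y ∈ nbrs x, f y - 4 * f x := by
  rw [lap, Finset.sum_sub_distrib, Finset.sum_const, card_nbrs, nsmul_eq_mul]
  norm_num

theorem lap_add (f g : Site → ℝ) (x : Site) :
    lap (fun y => f y + g y) x = lap f x + lap g x := by
  simp only [lap, ← Finset.sum_add_distrib]
  exact Finset.sum_congr rfl fun y _ => by ring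

theorem lap_const_mul (a : ℝ) (f : Site → ℝ) (x : Site) :
    lap (fun y => a * f y) x = a * lap f x := by
  simp only [lap, Finset.mul_sum]
  exact Finset.sum_congr rfl fun y _ => by ring

theorem lap_const (a : ℝ) (x : Site) : lap (fun _ => a) x = 0 := by
  simp [lap]

theorem lap_sum {ι : Type*} (s : Finset ι) (f : ι → Site → ℝ) (x : Site) :
    lap (fun y => ∑ i ∈ s, f i y) x = ∑ i ∈ s, lap (f i) x := by
  simp only [lap, ← Finset.sum_sub_distrib]
  exact Finset.sum_comm

/-- The minimum principle: a function that is superharmonic on a finite set and nonnegative off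
it is nonnegative. -/
theorem nonneg_of_lap_nonpos {W : Finset Site} {f : Site → ℝ} (hout : ∀ x ∉ W, 0 ≤ f x)
    (hlap : ∀ x ∈ W, lap f x ≤ 0) (x : Site) : 0 ≤ f x := by
  by_contra hx
  push Not at hx
  have hxW : x ∈ W := by
    by_contra h
    exact absurd (hout x h) (not_le.2 hx)
  obtain ⟨m, hmW, hm⟩ := W.exists_min_image f ⟨x, hxW⟩
  have hm0 : f m < 0 := (hm x hxW).trans_lt hx
  -- among the minimisers, the one furthest to the right has no right neighbour
  obtain ⟨z, hz, hzmax⟩ := (W.filter fun z => f z = f m).exists_max_image (fun z => z.1)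
    ⟨m, by simp [hmW]⟩
  rw [Finset.mem_filter] at hz
  have hmin : ∀ y, f z ≤ f y := by
    intro y
    rw [hz.2]
    by_cases hy : y ∈ W
    · exact hm y hy
    · exact hm0.le.trans (hout y hy)
  have hzero : ∑ y ∈ nbrs z, (f y - f z) = 0 :=
    le_antisymm (hlap z hz.1) (Finset.sum_nonneg fun y _ => sub_nonneg.2 (hmin y))
  rw [Finset.sum_eq_zero_iff_of_nonneg fun y _ => sub_nonneg.2 (hmin y)] at hzero
  have hr := hzero (z.1 + 1, z.2) (by simp [nbrs])
  have hrm : f (z.1 + 1, z.2) = f m := by linarith [hz.2]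
  have hrW : (z.1 + 1, z.2) ∈ W := by
    by_contra h
    have := hout _ h
    linarith
  have := hzmax (z.1 + 1, z.2) (by simp [hrW, hrm])
  simp at this

/-- An antisymmetric function of directed edges sums to zero over the edges inside a set. -/
theorem sum_edges_antisymm (S : Finset Site) (φ : Site → Site → ℝ) (hφ : ∀ x y, φ x y = -φ y x) :
    ∑ x ∈ S, ∑ y ∈ (nbrs x).filter (· ∈ S), φ x y = 0 := by
  have h1 : ∀ x, ∑ y ∈ (nbrs x).filter (· ∈ S), φ x y =
      ∑ y ∈ S, if y ∈ nbrs x then φ x y else 0 := by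
    intro x
    rw [← Finset.sum_filter]
    refine Finset.sum_congr ?_ fun _ _ => rfl
    ext y
    simp [and_comm]
  simp only [h1]
  have h2 : ∑ x ∈ S, ∑ y ∈ S, (if y ∈ nbrs x then φ x y else 0) =
      -∑ x ∈ S, ∑ y ∈ S, (if y ∈ nbrs x then φ x y else 0) := by
    conv_lhs => rw [Finset.sum_comm]
    rw [← Finset.sum_neg_distrib]
    refine Finset.sum_congr rfl fun x _ => ?_
    rw [← Finset.sum_neg_distrib]
    refine Finset.sum_congr rfl fun y _ => ?_
    by_cases h : y ∈ nbrs x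
    · rw [if_pos h, if_pos (mem_nbrs_comm.1 h), hφ]
    · rw [if_neg h, if_neg (mt mem_nbrs_comm.1 h), neg_zero]
  linarith

/-- The discrete divergence theorem. -/
theorem sum_lap_eq_flux (S : Finset Site) (f : Site → ℝ) :
    ∑ x ∈ S, lap f x = ∑ x ∈ S, ∑ y ∈ (nbrs x).filter (· ∉ S), (f y - f x) := by
  have h := sum_edges_antisymm S (fun x y => f y - f x) fun x y => by ring
  have h2 : ∀ x, lap f x = ∑ y ∈ (nbrs x).filter (· ∈ S), (f y - f x) +
      ∑ y ∈ (nbrs x).filter (· ∉ S), (f y - f x) := fun x =>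
    (Finset.sum_filter_add_sum_filter_not _ _ _).symm
  simp only [h2, Finset.sum_add_distrib]
  rw [h, zero_add]

/-- The Laplacian is symmetric on functions that vanish off a finite set. -/
theorem sum_mul_lap_comm (U : Finset Site) (f g : Site → ℝ) (hf : ∀ x ∉ U, f x = 0)
    (hg : ∀ x ∉ U, g x = 0) :
    ∑ x ∈ U, f x * lap g x = ∑ x ∈ U, g x * lap f x := by
  have h := sum_edges_antisymm U (fun x y => f x * g y - g x * f y) fun x y => by ring
  rw [← sub_eq_zero, ← Finset.sum_sub_distrib, ← h]
  refine Finset.sum_congr rfl fun x _ => ?_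
  have h0 : ∑ y ∈ (nbrs x).filter (· ∉ U), (f x * g y - g x * f y) = 0 :=
    Finset.sum_eq_zero fun y hy => by
      rw [Finset.mem_filter] at hy
      rw [hf y hy.2, hg y hy.2]; ring
  rw [lap_eq, lap_eq, ← add_zero (∑ y ∈ (nbrs x).filter (· ∈ U), _), ← h0,
    Finset.sum_filter_add_sum_filter_not, Finset.sum_sub_distrib, ← Finset.mul_sum,
    ← Finset.mul_sum]
  ring

theorem exists_green (U : Finset Site) : ∃ G : Site → Site → ℝ,
    (∀ x y, x ∉ U → G x y = 0) ∧ (∀ x y, y ∉ U → G x y = 0) ∧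
    ∀ x ∈ U, ∀ y ∈ U, lap (fun z => G z y) x = if x = y then -(2 * Real.pi) else 0 := by
  let ext : (U → ℝ) →ₗ[ℝ] (Site → ℝ) :=
    { toFun := fun f y => if h : y ∈ U then f ⟨y, h⟩ else 0
      map_add' := fun f g => by
        ext y; by_cases h : y ∈ U <;> simp [h]
      map_smul' := fun a f => by
        ext y; by_cases h : y ∈ U <;> simp [h] }
  let T : (U → ℝ) →ₗ[ℝ] (U → ℝ) :=
    { toFun := fun f x => lap (ext f) x
      map_add' := fun f g => by
        ext x; simp only [map_add]; exact lap_add _ _ _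
      map_smul' := fun a f => by
        ext x; simp only [map_smul]; exact lap_const_mul _ _ _ }
  have hext : ∀ f : U → ℝ, ∀ x ∉ U, ext f x = 0 := fun f x hx => by simp [ext, hx]
  have hinj : Function.Injective T := by
    rw [injective_iff_map_eq_zero]
    intro f hf
    have hlap : ∀ x ∈ U, lap (ext f) x = 0 := fun x hx => congrFun hf ⟨x, hx⟩
    have h1 := nonneg_of_lap_nonpos (W := U) (f := ext f) (fun x hx => (hext f x hx).ge)
      fun x hx => (hlap x hx).le
    have h2 := nonneg_of_lap_nonpos (W := U) (f := fun x => (-1) * ext f x)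
      (fun x hx => by rw [hext f x hx]; simp)
      fun x hx => by rw [lap_const_mul, hlap x hx]; simp
    ext x
    have h3 : ext f x = 0 := le_antisymm (by linarith [h2 x]) (h1 x)
    simpa [ext] using h3
  have hsurj := LinearMap.injective_iff_surjective.1 hinj
  choose g hg using fun y : U => hsurj fun x => if x = y then -(2 * Real.pi) else 0
  refine ⟨fun x y => if h : y ∈ U then ext (g ⟨y, h⟩) x else 0, ?_, ?_, ?_⟩
  · intro x y hx
    by_cases hy : y ∈ U
    · simp only [hy, dif_pos]; exact hext _ _ hx
    · simp [hy]
  · intro x y hy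
    simp [hy]
  · intro x hx y hy
    have := congrFun (hg ⟨y, hy⟩) ⟨x, hx⟩
    simp only [hy, dif_pos]
    simpa [T] using this

/-- The Green function of a finite set `U` of sites, for the walk with rate `1 / (2π)` along each
edge, killed off `U`. It vanishes as soon as one argument is outside `U`. -/
def green (U : Finset Site) : Site → Site → ℝ := (exists_green U).choose

section Green

variable {U : Finset Site}

theorem green_left {x : Site} (hx : x ∉ U) (y : Site) : green U x y = 0 :=
  (exists_green U).choose_spec.1 x y hx

theorem green_right {y : Site} (hy : y ∉ U) (x : Site) : green U x y = 0 :=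
  (exists_green U).choose_spec.2.1 x y hy

theorem lap_green {x y : Site} (hx : x ∈ U) (hy : y ∈ U) :
    lap (fun z => green U z y) x = if x = y then -(2 * Real.pi) else 0 :=
  (exists_green U).choose_spec.2.2 x hx y hy

theorem lap_green_self {y : Site} (hy : y ∈ U) :
    lap (fun z => green U z y) y = -(2 * Real.pi) := by
  rw [lap_green hy hy, if_pos rfl]

theorem lap_green_of_ne {x y : Site} (hx : x ∈ U) (hxy : x ≠ y) :
    lap (fun z => green U z y) x = 0 := by
  by_cases hy : y ∈ U
  · rw [lap_green hx hy, if_neg hxy]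
  · simp only [green_right hy, lap_const]

theorem green_nonneg (x y : Site) : 0 ≤ green U x y := by
  refine nonneg_of_lap_nonpos (W := U) (f := fun z => green U z y)
    (fun z hz => (green_left hz y).ge) (fun z hz => ?_) x
  by_cases h : z = y
  · subst h
    rw [lap_green_self hz]
    linarith [Real.pi_pos]
  · rw [lap_green_of_ne hz h]

theorem green_comm (x y : Site) : green U x y = green U y x := by
  by_cases hx : x ∈ U
  · by_cases hy : y ∈ U
    · have h := sum_mul_lap_comm U (fun z => green U z x) (fun z => green U z y)
        (fun z hz => green_left hz x) (fun z hz => green_left hz y)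
      have h1 : ∀ a ∈ U, ∀ b, ∑ z ∈ U, green U z b * lap (fun w => green U w a) z =
          -(2 * Real.pi) * green U a b := by
        intro a ha b
        rw [Finset.sum_eq_single_of_mem a ha, lap_green_self ha]
        · ring
        · intro z hz hza
          rw [lap_green_of_ne hz hza, mul_zero]
      rw [h1 y hy x, h1 x hx y] at h
      have := Real.pi_pos
      exact (mul_left_cancel₀ (by linarith) h).symm
    · rw [green_right hy, green_left hy]
  · rw [green_left hx, green_right hx]

theorem green_le_diag (x y : Site) : green U x y ≤ green U y y := by
  have h := nonneg_of_lap_nonpos (W := U.erase y)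
    (f := fun z => green U y y + (-1) * green U z y) (fun z hz => ?_) (fun z hz => ?_) x
  · linarith
  · by_cases hzy : z = y
    · subst hzy; simp
    · rw [green_left (fun hzU => hz (Finset.mem_erase.2 ⟨hzy, hzU⟩))]
      simpa using green_nonneg y y
  · rw [Finset.mem_erase] at hz
    rw [lap_add, lap_const, lap_const_mul, lap_green_of_ne hz.2 hz.1]
    simp

/-- Divided by `2π`, this says that the expected local time at `y` per unit of local time at the
boundary vertex is one. -/
theorem sum_boundary_green {y : Site} (hy : y ∈ U) :
    ∑ x ∈ U, (((nbrs x).filter (· ∉ U)).card : ℝ) * green U x y = 2 * Real.pi := by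
  have h := sum_lap_eq_flux U (fun z => green U z y)
  rw [Finset.sum_eq_single_of_mem y hy fun x hx hxy => lap_green_of_ne hx hxy,
    lap_green_self hy] at h
  rw [← neg_inj, h, ← Finset.sum_neg_distrib]
  refine Finset.sum_congr rfl fun x _ => ?_
  rw [Finset.sum_congr rfl fun z hz => by
    rw [green_left (Finset.mem_filter.1 hz).2 y], Finset.sum_const, nsmul_eq_mul]
  ring

/-- The current through an edge is at most the strength of the source: the edges that leave a
superlevel set of the Green function all carry current out of the set, and the total is at most
`2π`. -/
theorem green_sub_le_of_nbr {x z : Site} (hz : z ∈ nbrs x) (y : Site) :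
    green U x y - green U z y ≤ 2 * Real.pi := by
  have hpi := Real.pi_pos
  rcases le_or_gt (green U x y) (green U z y) with hle | hlt
  · linarith
  have hx0 : 0 < green U x y := (green_nonneg z y).trans_lt hlt
  set S := U.filter fun w => green U x y ≤ green U w y with hS
  have hmem : ∀ w, w ∈ S ↔ green U x y ≤ green U w y := by
    intro w
    rw [hS, Finset.mem_filter, and_iff_right_iff_imp]
    intro hw
    by_contra hwU
    rw [green_left hwU] at hw
    linarith
  have hflux := sum_lap_eq_flux S (fun w => green U w y)
  have hlow : -(2 * Real.pi) ≤ ∑ w ∈ S, lap (fun w => green U w y) w := by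
    by_cases hyS : y ∈ S
    · rw [Finset.sum_eq_single_of_mem y hyS fun w hw hwy =>
        lap_green_of_ne (Finset.mem_filter.1 hw).1 hwy,
        lap_green_self (Finset.mem_filter.1 hyS).1]
    · rw [Finset.sum_eq_zero fun w hw =>
        lap_green_of_ne (Finset.mem_filter.1 hw).1 (fun h => hyS (by rw [← h]; exact hw))]
      linarith
  have hterm : ∀ w ∈ S, ∀ v ∈ (nbrs w).filter (· ∉ S), green U v y - green U w y ≤ 0 := by
    intro w hw v hv
    have h1 := (hmem w).1 hw
    have h2 := mt (hmem v).2 (Finset.mem_filter.1 hv).2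
    linarith
  have hxS : x ∈ S := (hmem x).2 le_rfl
  have hzS : z ∈ (nbrs x).filter (· ∉ S) := by
    rw [Finset.mem_filter, hmem]
    exact ⟨hz, by linarith⟩
  have hup : ∑ w ∈ S, ∑ v ∈ (nbrs w).filter (· ∉ S), (green U v y - green U w y) ≤
      green U z y - green U x y := by
    have h1 := Finset.sum_le_sum_of_subset_of_nonneg (f := fun w =>
        -∑ v ∈ (nbrs w).filter (· ∉ S), (green U v y - green U w y))
      (Finset.singleton_subset_iff.2 hxS)
      (fun w hw _ => neg_nonneg.2 (Finset.sum_nonpos (hterm w hw)))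
    have h2 := Finset.sum_le_sum_of_subset_of_nonneg (f := fun v =>
        -(green U v y - green U x y))
      (Finset.singleton_subset_iff.2 hzS)
      (fun v hv _ => neg_nonneg.2 (hterm x hxS v hv))
    simp only [Finset.sum_singleton, Finset.sum_neg_distrib] at h1 h2
    linarith
  linarith

/-- The Green function is Lipschitz for the graph distance. -/
theorem abs_green_sub_le (x z y : Site) :
    |green U x y - green U z y| ≤ 2 * Real.pi * (|(x.1 - z.1 : ℝ)| + |(x.2 - z.2 : ℝ)|) := by
  have habs : ∀ a b : Site, b ∈ nbrs a → |green U a y - green U b y| ≤ 2 * Real.pi :=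
    fun a b hb => abs_sub_le_iff.2
      ⟨green_sub_le_of_nbr hb y, green_sub_le_of_nbr (mem_nbrs_comm.1 hb) y⟩
  have hline : ∀ (e : Site), (∀ a : Site, a + e ∈ nbrs a) → ∀ (n : ℕ) (a : Site),
      |green U (a + n • e) y - green U a y| ≤ 2 * Real.pi * n := by
    intro e he n a
    induction n with
    | zero => simp
    | succ n ih =>
      have h1 := habs _ _ (he (a + n • e))
      rw [succ_nsmul, ← add_assoc]
      rw [abs_sub_comm] at h1
      have h2 := abs_sub_le (green U (a + n • e + e) y) (green U (a + n • e) y) (green U a y)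
      push_cast
      linarith
  have hint : ∀ (e : Site), (∀ a : Site, a + e ∈ nbrs a) → ∀ (k : ℤ) (a : Site),
      |green U (a + k • e) y - green U a y| ≤ 2 * Real.pi * |(k : ℝ)| := by
    intro e he k a
    obtain ⟨n, rfl | rfl⟩ := k.eq_nat_or_neg
    · simpa using hline e he n a
    · have h := hline e he n (a + (-(n : ℤ)) • e)
      rw [show a + (-(n : ℤ)) • e + n • e = a by simp] at h
      rw [abs_sub_comm]
      simpa using h
  have h1 := hint (1, 0) (fun a => by simp [nbrs, Prod.ext_iff]) (x.1 - z.1) (z.1, z.2)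
  have h2 := hint (0, 1) (fun a => by simp [nbrs, Prod.ext_iff]) (x.2 - z.2) (x.1, z.2)
  simp only [Prod.smul_mk, smul_eq_mul, mul_one, mul_zero, Prod.mk_add_mk, add_zero,
    add_sub_cancel] at h1 h2
  push_cast at h1 h2
  have h3 := abs_sub_le (green U x y) (green U (x.1, z.2) y) (green U z y)
  linarith

end Green

/-! ### The logarithmic kernel -/

/-- A smoothed logarithm on the lattice, `log (|x|² + 1) / 2`. Its Laplacian is nonnegative,
decays like `|x|⁻⁴` and has total mass `2π`. -/
def logKernel (x : Site) : ℝ := 1 / 2 * Real.log ((x.1 : ℝ) ^ 2 + (x.2 : ℝ) ^ 2 + 1)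

theorem logKernel_nonneg (x : Site) : 0 ≤ logKernel x := by
  unfold logKernel
  have := Real.log_nonneg (show (1 : ℝ) ≤ (x.1 : ℝ) ^ 2 + (x.2 : ℝ) ^ 2 + 1 by nlinarith)
  linarith

theorem lap_logKernel (x : Site) :
    lap logKernel x = 1 / 2 * Real.log (1 +
      (2 * ((x.1 : ℝ) ^ 2 + (x.2 : ℝ) ^ 2 + 1) ^ 2 + 8 * ((x.1 : ℝ) ^ 2 + (x.2 : ℝ) ^ 2 + 1) + 5 +
        16 * (x.1 : ℝ) ^ 2 * (x.2 : ℝ) ^ 2) / ((x.1 : ℝ) ^ 2 + (x.2 : ℝ) ^ 2 + 1) ^ 4) := by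
  rw [lap_eq, sum_nbrs]
  simp only [logKernel]
  push_cast
  generalize (x.1 : ℝ) = a
  generalize (x.2 : ℝ) = b
  have hQ : 0 < a ^ 2 + b ^ 2 + 1 := by positivity
  have h1 : 0 < (a + 1) ^ 2 + b ^ 2 + 1 := by positivity
  have h2 : 0 < (a - 1) ^ 2 + b ^ 2 + 1 := by positivity
  have h3 : 0 < a ^ 2 + (b + 1) ^ 2 + 1 := by positivity
  have h4 : 0 < a ^ 2 + (b - 1) ^ 2 + 1 := by positivity
  have key : 1 + (2 * (a ^ 2 + b ^ 2 + 1) ^ 2 + 8 * (a ^ 2 + b ^ 2 + 1) + 5 +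
        16 * a ^ 2 * b ^ 2) / (a ^ 2 + b ^ 2 + 1) ^ 4 =
      ((a + 1) ^ 2 + b ^ 2 + 1) * ((a - 1) ^ 2 + b ^ 2 + 1) * (a ^ 2 + (b + 1) ^ 2 + 1) *
        (a ^ 2 + (b - 1) ^ 2 + 1) / (a ^ 2 + b ^ 2 + 1) ^ 4 := by
    rw [eq_div_iff (by positivity), add_mul, div_mul_cancel₀ _ (by positivity)]
    ring
  rw [key, Real.log_div (by positivity) (by positivity), Real.log_mul (by positivity) h4.ne',
    Real.log_mul (by positivity) h3.ne', Real.log_mul h1.ne' h2.ne', Real.log_pow]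
  push_cast
  ring

theorem lap_logKernel_nonneg (x : Site) : 0 ≤ lap logKernel x := by
  rw [lap_logKernel]
  refine mul_nonneg (by norm_num) (Real.log_nonneg ?_)
  rw [le_add_iff_nonneg_right]
  positivity

theorem lap_logKernel_le (x : Site) :
    lap logKernel x ≤ 10 / ((x.1 : ℝ) ^ 2 + (x.2 : ℝ) ^ 2 + 1) ^ 2 := by
  rw [lap_logKernel]
  generalize (x.1 : ℝ) = a
  generalize (x.2 : ℝ) = b
  have hQ : 1 ≤ a ^ 2 + b ^ 2 + 1 := by nlinarith [sq_nonneg a, sq_nonneg b]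
  have hab : 16 * a ^ 2 * b ^ 2 ≤ 4 * (a ^ 2 + b ^ 2 + 1) ^ 2 := by
    nlinarith [sq_nonneg (a ^ 2 - b ^ 2), sq_nonneg a, sq_nonneg b]
  generalize a ^ 2 + b ^ 2 + 1 = Q at hQ hab ⊢
  set ρ := (2 * Q ^ 2 + 8 * Q + 5 + 16 * a ^ 2 * b ^ 2) / Q ^ 4 with hρ
  have hρ0 : 0 ≤ ρ := by positivity
  have hlog : Real.log (1 + ρ) ≤ ρ := by
    have := Real.log_le_sub_one_of_pos (show 0 < 1 + ρ by linarith)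
    linarith
  have hρ1 : ρ ≤ 20 / Q ^ 2 := by
    rw [hρ, div_le_div_iff₀ (by positivity) (by positivity)]
    have : 2 * Q ^ 2 + 8 * Q + 5 + 16 * a ^ 2 * b ^ 2 ≤ 20 * Q ^ 2 := by nlinarith
    nlinarith [sq_nonneg Q]
  have : 10 / Q ^ 2 = 1 / 2 * (20 / Q ^ 2) := by ring
  rw [this]
  linarith

theorem lap_comp_sub (f : Site → ℝ) (y x : Site) :
    lap (fun z => f (z - y)) x = lap f (x - y) := by
  rw [lap_eq, lap_eq, sum_nbrs, sum_nbrs]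
  have h : ∀ a b c d : ℤ, ((a, b) : Site) - (c, d) = (a - c, b - d) := fun _ _ _ _ => rfl
  obtain ⟨a, b⟩ := x
  obtain ⟨c, d⟩ := y
  simp only [h]
  rw [show a + 1 - c = a - c + 1 by ring, show a - 1 - c = a - c - 1 by ring,
    show b + 1 - d = b - d + 1 by ring, show b - 1 - d = b - d - 1 by ring]

theorem summable_one_add_sq_rpow : Summable fun k : ℤ => (1 + (k : ℝ) ^ 2) ^ (-(3 / 4) : ℝ) := by
  refine Summable.of_norm_bounded_eventually
    (Real.summable_abs_int_rpow (show (1 : ℝ) < 3 / 2 by norm_num)) ?_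
  rw [Filter.eventually_cofinite]
  refine (Set.finite_singleton (0 : ℤ)).subset fun k hk => ?_
  by_contra hk0
  refine hk ?_
  have hk1 : 0 < |(k : ℝ)| := abs_pos.2 (by exact_mod_cast hk0)
  rw [Real.norm_of_nonneg (by positivity), show (-(3 / 2) : ℝ) = 2 * (-(3 / 4)) by norm_num,
    Real.rpow_mul hk1.le]
  refine Real.rpow_le_rpow_of_nonpos (by positivity) ?_ (by norm_num)
  rw [Real.rpow_two, sq_abs]
  linarith

theorem summable_lap_logKernel_mul :
    Summable fun x : Site => lap logKernel x * (1 + |(x.1 : ℝ)| + |(x.2 : ℝ)|) := by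
  have h := (summable_one_add_sq_rpow.mul_of_nonneg summable_one_add_sq_rpow
    (fun _ => by positivity) (fun _ => by positivity)).mul_left 30
  refine Summable.of_nonneg_of_le (fun x => mul_nonneg (lap_logKernel_nonneg x) (by positivity))
    (fun x => ?_) h
  have h1 := lap_logKernel_le x
  generalize lap logKernel x = m at h1
  generalize (x.1 : ℝ) = a at h1 ⊢
  generalize (x.2 : ℝ) = b at h1 ⊢
  set Q := a ^ 2 + b ^ 2 + 1 with hQ
  have hQ1 : 1 ≤ Q := by nlinarith [sq_nonneg a, sq_nonneg b]
  have h2 : 1 + |a| + |b| ≤ 3 * Q ^ (1 / 2 : ℝ) := by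
    rw [← Real.sqrt_eq_rpow]
    have ha : |a| ≤ √Q := Real.abs_le_sqrt (by nlinarith [sq_nonneg b])
    have hb : |b| ≤ √Q := Real.abs_le_sqrt (by nlinarith [sq_nonneg a])
    have h1 : 1 ≤ √Q := Real.one_le_sqrt.2 hQ1
    linarith
  have h3 : (1 + a ^ 2) * (1 + b ^ 2) ≤ Q ^ 2 := by
    nlinarith [sq_nonneg a, sq_nonneg b, mul_nonneg (sq_nonneg a) (sq_nonneg b),
      sq_nonneg (a ^ 2), sq_nonneg (b ^ 2)]
  calc m * (1 + |a| + |b|) ≤ 10 / Q ^ 2 * (3 * Q ^ (1 / 2 : ℝ)) := by gcongr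
    _ = 30 * (Q ^ 2) ^ (-(3 / 4) : ℝ) := by
      rw [← Real.rpow_two, ← Real.rpow_mul (by linarith), div_mul_eq_mul_div, div_eq_mul_inv,
        ← Real.rpow_neg (by linarith), show (2 * (-(3 / 4)) : ℝ) = 1 / 2 + (-2) by norm_num,
        Real.rpow_add (by linarith)]
      ring
    _ ≤ 30 * ((1 + a ^ 2) * (1 + b ^ 2)) ^ (-(3 / 4) : ℝ) := by
      gcongr 30 * ?_
      exact Real.rpow_le_rpow_of_nonpos (by positivity) h3 (by norm_num)
    _ = 30 * ((1 + a ^ 2) ^ (-(3 / 4) : ℝ) * (1 + b ^ 2) ^ (-(3 / 4) : ℝ)) := by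
      rw [Real.mul_rpow (by positivity) (by positivity)]

theorem summable_lap_logKernel : Summable (lap logKernel) := by
  refine Summable.of_nonneg_of_le lap_logKernel_nonneg (fun x => ?_) summable_lap_logKernel_mul
  have : 0 ≤ |(x.1 : ℝ)| + |(x.2 : ℝ)| := by positivity
  nlinarith [lap_logKernel_nonneg x]

theorem sum_Icc_neg_succ (f : ℤ → ℝ) (R : ℕ) :
    ∑ a ∈ Finset.Icc (-((R + 1 : ℕ) : ℤ)) ((R + 1 : ℕ) : ℤ), f a =
      ∑ a ∈ Finset.Icc (-(R : ℤ)) R, f a + f (R + 1) + f (-R - 1) := by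
  have h : Finset.Icc (-((R + 1 : ℕ) : ℤ)) ((R + 1 : ℕ) : ℤ) =
      insert (-(R : ℤ) - 1) (insert ((R : ℤ) + 1) (Finset.Icc (-(R : ℤ)) R)) := by
    ext a
    simp only [Finset.mem_Icc, Finset.mem_insert]
    push_cast
    omega
  rw [h, Finset.sum_insert, Finset.sum_insert]
  · ring
  · simp
  · simp only [Finset.mem_insert, Finset.mem_Icc]
    omega

theorem sum_Icc_even (f : ℤ → ℝ) (hf : ∀ a, f (-a) = f a) (R : ℕ) :
    ∑ a ∈ Finset.Icc (-(R : ℤ)) R, f a = f 0 + 2 * ∑ j ∈ Finset.range R, f (j + 1) := by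
  induction R with
  | zero => simp
  | succ R ih =>
    rw [sum_Icc_neg_succ, ih, Finset.sum_range_succ, show (-(R : ℤ) - 1) = -(R + 1) by ring, hf]
    ring

theorem sum_Icc_second_difference (f : ℤ → ℝ) (hf : ∀ a, f (-a) = f a) (R : ℕ) :
    ∑ a ∈ Finset.Icc (-(R : ℤ)) R, (f (a + 1) + f (a - 1) - 2 * f a) =
      2 * (f (R + 1) - f R) := by
  induction R with
  | zero =>
    simp only [Nat.cast_zero, neg_zero, Finset.Icc_self, Finset.sum_singleton, zero_add, zero_sub]
    rw [hf 1]; ring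
  | succ R ih =>
    rw [sum_Icc_neg_succ, ih, show (-(R : ℤ) - 1 - 1) = -(R + 1 + 1) by ring,
      show (-(R : ℤ) - 1 + 1) = -R by ring, show (-(R : ℤ) - 1) = -(R + 1) by ring, hf, hf, hf]
    push_cast
    rw [add_sub_cancel_right]
    ring

/-- By the symmetries of the kernel the flux through the four sides of a box is the same. -/
theorem sum_box_lap_logKernel (R : ℕ) :
    ∑ x ∈ Finset.Icc (-(R : ℤ)) R ×ˢ Finset.Icc (-(R : ℤ)) R, lap logKernel x =
      4 * ∑ b ∈ Finset.Icc (-(R : ℤ)) R, (logKernel (R + 1, b) - logKernel (R, b)) := by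
  have hsymm : ∀ a b : ℤ, logKernel (a, b) = logKernel (b, a) := fun a b => by
    simp only [logKernel]; ring_nf
  have heven : ∀ a b : ℤ, logKernel (-a, b) = logKernel (a, b) := fun a b => by
    simp [logKernel]
  have h1 : ∀ x : Site, lap logKernel x =
      (logKernel (x.1 + 1, x.2) + logKernel (x.1 - 1, x.2) - 2 * logKernel (x.1, x.2)) +
      (logKernel (x.2 + 1, x.1) + logKernel (x.2 - 1, x.1) - 2 * logKernel (x.2, x.1)) := by
    intro x
    rw [lap_eq, sum_nbrs, hsymm (x.2 + 1), hsymm (x.2 - 1), hsymm x.2]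
    ring
  simp only [h1, Finset.sum_add_distrib]
  have h2 : ∀ b : ℤ, ∑ a ∈ Finset.Icc (-(R : ℤ)) R,
      (logKernel (a + 1, b) + logKernel (a - 1, b) - 2 * logKernel (a, b)) =
        2 * (logKernel (R + 1, b) - logKernel (R, b)) := fun b =>
    sum_Icc_second_difference (fun a => logKernel (a, b)) (fun a => heven a b) R
  rw [Finset.sum_product_right, Finset.sum_product]
  simp only [h2, ← Finset.mul_sum]
  ring

theorem integral_arctan_kernel {r : ℝ} (hr : 0 < r) (a b : ℝ) :
    ∫ x in a..b, r / (r ^ 2 + x ^ 2) = Real.arctan (b / r) - Real.arctan (a / r) := by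
  have h : ∀ x ∈ uIcc a b, HasDerivAt (fun x => Real.arctan (x / r)) (r / (r ^ 2 + x ^ 2)) x := by
    intro x _
    have h1 := ((hasDerivAt_id x).div_const r).arctan
    convert h1 using 1
    simp only [id_eq]
    field_simp
    simp
  rw [intervalIntegral.integral_eq_sub_of_hasDerivAt h]
  refine ContinuousOn.intervalIntegrable fun x _ => ContinuousAt.continuousWithinAt ?_
  exact continuousAt_const.div (by fun_prop) (by positivity)

theorem antitoneOn_arctan_kernel {r : ℝ} (hr : 0 < r) (b : ℝ) :
    ∀ a, 0 ≤ a → AntitoneOn (fun x : ℝ => r / (r ^ 2 + x ^ 2)) (Icc a b) := by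
  intro a ha x hx y hy hxy
  have : 0 ≤ x := ha.trans hx.1
  dsimp only
  gcongr

/-- The flux of the logarithmic kernel through one side of a box tends to a quarter of `2π`. -/
theorem tendsto_side_flux : Tendsto (fun R : ℕ =>
    ∑ b ∈ Finset.Icc (-(R : ℤ)) R, (logKernel (R + 1, b) - logKernel (R, b)))
      atTop (𝓝 (Real.pi / 2)) := by
  -- compare the sum over one side of the box with the integral of `r / (r ^ 2 + x ^ 2)`
  have hφ : ∀ (R : ℕ) (b : ℤ), logKernel (R + 1, b) - logKernel (R, b) =
      1 / 2 * Real.log (1 + (2 * R + 1) / ((R : ℝ) ^ 2 + b ^ 2 + 1)) := by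
    intro R b
    have h : (0 : ℝ) < (R : ℝ) ^ 2 + b ^ 2 + 1 := by positivity
    simp only [logKernel]
    push_cast
    rw [← mul_sub, ← Real.log_div (by positivity) h.ne']
    congr 2
    field_simp
    ring
  have hup : ∀ (R : ℕ), 0 < R → ∀ b : ℤ, logKernel (R + 1, b) - logKernel (R, b) ≤
      (1 + 1 / (2 * R)) * (R / ((R : ℝ) ^ 2 + b ^ 2)) := by
    intro R hR b
    have hR' : (0 : ℝ) < R := by exact_mod_cast hR
    have hlog := Real.log_le_sub_one_of_pos
      (show (0 : ℝ) < 1 + (2 * R + 1) / ((R : ℝ) ^ 2 + b ^ 2 + 1) by positivity)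
    have h2 : (2 * R + 1) / ((R : ℝ) ^ 2 + b ^ 2 + 1) ≤ (2 * R + 1) / ((R : ℝ) ^ 2 + b ^ 2) := by
      exact div_le_div_of_nonneg_left (by positivity) (by positivity) (by linarith)
    have h3 : (1 + 1 / (2 * R)) * (R / ((R : ℝ) ^ 2 + b ^ 2)) =
        1 / 2 * ((2 * R + 1) / ((R : ℝ) ^ 2 + b ^ 2)) := by
      field_simp
    rw [hφ, h3]
    linarith
  have hlow : ∀ (R : ℕ) (b : ℤ), (R + 1 / 2) / (R + 2) * ((R + 2) / ((R + 2 : ℝ) ^ 2 + b ^ 2)) ≤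
      logKernel (R + 1, b) - logKernel (R, b) := by
    intro R b
    have hQ : (0 : ℝ) < (R : ℝ) ^ 2 + b ^ 2 + 1 := by positivity
    set q := (2 * R + 1) / ((R : ℝ) ^ 2 + b ^ 2 + 1) with hq
    have hq0 : 0 ≤ q := by positivity
    have hlog := Real.one_sub_inv_le_log_of_pos (show 0 < 1 + q by linarith)
    have h1 : 1 - (1 + q)⁻¹ = (2 * R + 1) / ((R : ℝ) ^ 2 + b ^ 2 + 1 + (2 * R + 1)) := by
      rw [hq]
      have : (0 : ℝ) < (R : ℝ) ^ 2 + b ^ 2 + 1 + (2 * R + 1) := by positivity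
      field_simp
      ring
    have h2 : (R + 1 / 2) / (R + 2) * ((R + 2) / ((R + 2 : ℝ) ^ 2 + b ^ 2)) =
        1 / 2 * ((2 * R + 1) / ((R + 2 : ℝ) ^ 2 + b ^ 2)) := by
      field_simp
    have h3 : (2 * R + 1) / ((R + 2 : ℝ) ^ 2 + b ^ 2) ≤
        (2 * R + 1) / ((R : ℝ) ^ 2 + b ^ 2 + 1 + (2 * R + 1)) := by
      exact div_le_div_of_nonneg_left (by positivity) (by positivity) (by nlinarith)
    rw [hφ, h2]
    rw [h1] at hlog
    linarith
  have heven : ∀ (R : ℕ), ∑ b ∈ Finset.Icc (-(R : ℤ)) R,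
      (logKernel (R + 1, b) - logKernel (R, b)) =
      (logKernel (R + 1, 0) - logKernel (R, 0)) + 2 * ∑ j ∈ Finset.range R,
        (logKernel (R + 1, (j : ℤ) + 1) - logKernel (R, (j : ℤ) + 1)) := fun R =>
    sum_Icc_even _ (fun a => by simp [logKernel]) R
  have hcast : Tendsto (fun R : ℕ => (R : ℝ)) atTop atTop := tendsto_natCast_atTop_atTop
  have hinv : Tendsto (fun R : ℕ => 1 / (R : ℝ)) atTop (𝓝 0) :=
    tendsto_const_nhds.div_atTop hcast
  have hinv2 : Tendsto (fun R : ℕ => 1 / ((R : ℝ) + 2)) atTop (𝓝 0) :=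
    tendsto_const_nhds.div_atTop (tendsto_atTop_add_const_right _ _ hcast)
  refine tendsto_of_tendsto_of_tendsto_of_le_of_le'
    (g := fun R : ℕ => 2 * ((1 - 3 / 2 * (1 / ((R : ℝ) + 2))) *
      (Real.arctan (1 - 1 / ((R : ℝ) + 2)) - Real.arctan (1 / ((R : ℝ) + 2)))))
    (h := fun R : ℕ => (1 + 1 / 2 * (1 / (R : ℝ))) * (1 / (R : ℝ)) +
      2 * ((1 + 1 / 2 * (1 / (R : ℝ))) * (Real.pi / 4))) ?_ ?_ ?_ ?_
  · have h1 := (Real.continuous_arctan.tendsto _).comp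
      ((tendsto_const_nhds (x := (1 : ℝ))).sub hinv2)
    have h2 := (Real.continuous_arctan.tendsto _).comp hinv2
    have h3 := ((tendsto_const_nhds (x := (1 : ℝ))).sub (hinv2.const_mul (3 / 2))).mul (h1.sub h2)
    have h4 := h3.const_mul 2
    simp only [sub_zero, Real.arctan_zero, Real.arctan_one, mul_zero, one_mul] at h4
    rw [show 2 * (Real.pi / 4) = Real.pi / 2 by ring] at h4
    exact h4
  · have h1 := ((tendsto_const_nhds (x := (1 : ℝ))).add (hinv.const_mul (1 / 2)))
    have h2 := (h1.mul hinv).add ((h1.mul_const (Real.pi / 4)).const_mul 2)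
    convert h2 using 2
    ring
  · filter_upwards with R
    rw [heven]
    have h0 := (show (0 : ℝ) ≤ _ by positivity).trans (hlow R 0)
    have h1 : ∑ j ∈ Finset.range R, (R + 1 / 2 : ℝ) / (R + 2) *
        ((R + 2) / ((R + 2 : ℝ) ^ 2 + ((j : ℝ) + 1) ^ 2)) ≤ ∑ j ∈ Finset.range R,
        (logKernel (R + 1, (j : ℤ) + 1) - logKernel (R, (j : ℤ) + 1)) :=
      Finset.sum_le_sum fun j _ => by
        have := hlow R (j + 1)
        push_cast at this
        exact this
    have h2 := AntitoneOn.integral_le_sum (x₀ := 1) (a := R)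
      (antitoneOn_arctan_kernel (r := R + 2) (by positivity) (1 + R) 1 zero_le_one)
    rw [integral_arctan_kernel (by positivity)] at h2
    rw [← Finset.mul_sum] at h1
    have h3 : (1 + R : ℝ) / (R + 2) = 1 - 1 / (R + 2) := by field_simp; ring
    have h4 : (R + 1 / 2 : ℝ) / (R + 2) = 1 - 3 / 2 * (1 / (R + 2)) := by field_simp; ring
    rw [h3] at h2
    rw [h4] at h1
    have h5 : (0 : ℝ) ≤ 1 - 3 / 2 * (1 / (R + 2)) := by rw [← h4]; positivity
    have h6 := mul_le_mul_of_nonneg_left h2 h5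
    have h7 : ∀ j : ℕ, (1 + (j : ℝ)) = j + 1 := fun j => add_comm _ _
    simp only [h7] at h6
    linarith
  · filter_upwards [eventually_gt_atTop 0] with R hR
    have hR' : (0 : ℝ) < R := by exact_mod_cast hR
    rw [heven]
    have h0 := hup R hR 0
    have h1 : ∑ j ∈ Finset.range R,
        (logKernel (R + 1, (j : ℤ) + 1) - logKernel (R, (j : ℤ) + 1)) ≤
        ∑ j ∈ Finset.range R, (1 + 1 / (2 * R)) * (R / ((R : ℝ) ^ 2 + ((j : ℝ) + 1) ^ 2)) :=
      Finset.sum_le_sum fun j _ => by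
        have := hup R hR (j + 1)
        push_cast at this
        exact this
    have h2 := AntitoneOn.sum_le_integral (x₀ := 0) (a := R)
      (antitoneOn_arctan_kernel hR' (0 + R) 0 le_rfl)
    rw [integral_arctan_kernel hR', zero_add, zero_div, Real.arctan_zero, sub_zero,
      div_self hR'.ne', Real.arctan_one] at h2
    rw [← Finset.mul_sum] at h1
    have h4 : (1 + 1 / (2 * R) : ℝ) = 1 + 1 / 2 * (1 / R) := by field_simp
    have h5 : (R : ℝ) / ((R : ℝ) ^ 2 + ((0 : ℤ) : ℝ) ^ 2) = 1 / R := by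
      push_cast
      field_simp
      ring
    rw [h4] at h1 h0
    rw [h5] at h0
    have h6 := mul_le_mul_of_nonneg_left h2 (show (0 : ℝ) ≤ 1 + 1 / 2 * (1 / R) by positivity)
    simp only [zero_add] at h6
    push_cast at h6 h1
    linarith

/-- The total mass of the Laplacian of the logarithmic kernel is its flux at infinity. -/
theorem hasSum_lap_logKernel : HasSum (lap logKernel) (2 * Real.pi) := by
  have h1 := summable_lap_logKernel.hasSum
  have hbox : Tendsto (fun R : ℕ => Finset.Icc (-(R : ℤ)) R ×ˢ Finset.Icc (-(R : ℤ)) R)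
      atTop atTop := by
    refine tendsto_atTop_finset_of_monotone (fun R R' hR => ?_) fun x => ?_
    · have : (R : ℤ) ≤ R' := by exact_mod_cast hR
      exact Finset.product_subset_product (Finset.Icc_subset_Icc (by omega) this)
        (Finset.Icc_subset_Icc (by omega) this)
    · refine ⟨x.1.natAbs + x.2.natAbs, ?_⟩
      simp only [Finset.mem_product, Finset.mem_Icc]
      omega
  have h2 := h1.comp hbox
  have h3 := tendsto_side_flux.const_mul 4
  simp only [Function.comp_def, sum_box_lap_logKernel] at h2
  rw [tendsto_nhds_unique h3 h2 |>.symm.trans (by ring : 4 * (Real.pi / 2) = 2 * Real.pi)] at h1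
  exact h1

/-! ### Estimates for the Green function -/

/-- The minimum principle, with boundary values on the outer lattice boundary only. -/
theorem nonneg_of_lap_nonpos_of_nbrs {W : Finset Site} {f : Site → ℝ}
    (hout : ∀ w ∈ W, ∀ x ∈ nbrs w, x ∉ W → 0 ≤ f x) (hlap : ∀ x ∈ W, lap f x ≤ 0) {x : Site}
    (hx : x ∈ W) : 0 ≤ f x := by
  have h := nonneg_of_lap_nonpos (W := W) (f := fun x => if x ∈ W then f x else max (f x) 0)
    (fun x hx => by simp [hx]) (fun x hx => ?_) x
  · simpa [hx] using h
  · refine le_trans (le_of_eq ?_) (hlap x hx)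
    refine Finset.sum_congr rfl fun y hy => ?_
    simp only [if_pos hx]
    by_cases hyW : y ∈ W
    · rw [if_pos hyW]
    · rw [if_neg hyW, max_eq_left (hout x hx y hy hyW)]

/-- The error in the comparison of the Green function with the logarithmic kernel: the first moment
of the Laplacian of the kernel. -/
def greenError : ℝ := ∑' x : Site, lap logKernel x * (1 + |(x.1 : ℝ)| + |(x.2 : ℝ)|)

theorem greenError_nonneg : 0 ≤ greenError :=
  tsum_nonneg fun x => mul_nonneg (lap_logKernel_nonneg x) (by positivity)

/-- Averaging the Green function against the Laplacian of the logarithmic kernel changes it by a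
bounded amount only, as it is Lipschitz and the Laplacian has a finite first moment. -/
theorem abs_green_sub_average_le (U : Finset Site) (x y : Site) :
    |green U x y - (2 * Real.pi)⁻¹ * ∑ z ∈ U, green U x z * lap logKernel (z - y)| ≤
      greenError := by
  have hpi := Real.pi_pos
  have hs : HasSum (fun z : Site => lap logKernel (z - y)) (2 * Real.pi) :=
    ((Equiv.subRight y).hasSum_iff (f := lap logKernel)).2 hasSum_lap_logKernel
  have h1 : HasSum (fun z : Site => green U x z * lap logKernel (z - y))
      (∑ z ∈ U, green U x z * lap logKernel (z - y)) :=
    hasSum_sum_of_ne_finset_zero fun z hz => by rw [green_right hz, zero_mul]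
  have h2 := ((hs.mul_left (green U x y)).sub h1).mul_left (2 * Real.pi)⁻¹
  have h3 : HasSum (fun z : Site =>
      lap logKernel (z - y) * (1 + |((z - y).1 : ℝ)| + |((z - y).2 : ℝ)|)) greenError :=
    ((Equiv.subRight y).hasSum_iff
      (f := fun x : Site => lap logKernel x * (1 + |(x.1 : ℝ)| + |(x.2 : ℝ)|))).2
      summable_lap_logKernel_mul.hasSum
  have h4 : ∀ z : Site, ‖(2 * Real.pi)⁻¹ * (green U x y * lap logKernel (z - y) -
      green U x z * lap logKernel (z - y))‖ ≤
      lap logKernel (z - y) * (1 + |((z - y).1 : ℝ)| + |((z - y).2 : ℝ)|) := by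
    intro z
    have hl := abs_green_sub_le (U := U) z y x
    rw [green_comm z x, green_comm y x, abs_sub_comm] at hl
    have hm := lap_logKernel_nonneg (z - y)
    generalize lap logKernel (z - y) = m at hm
    rw [Real.norm_eq_abs, ← sub_mul, abs_mul, abs_mul, abs_of_nonneg hm,
      abs_of_pos (by positivity : 0 < (2 * Real.pi)⁻¹), mul_comm _ m, mul_left_comm]
    refine mul_le_mul_of_nonneg_left ?_ hm
    rw [inv_mul_le_iff₀ (by positivity)]
    refine hl.trans (mul_le_mul_of_nonneg_left ?_ (by positivity))
    rw [Prod.fst_sub, Prod.snd_sub, Int.cast_sub, Int.cast_sub]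
    linarith
  have h5 := tsum_of_norm_bounded h3 h4
  rw [h2.tsum_eq, mul_sub, mul_comm (green U x y), inv_mul_cancel_left₀ (by positivity)] at h5
  exact h5

/-- The sum of the logarithmic kernel and its Green potential is harmonic. -/
theorem lap_harmonic_part {U : Finset Site} {x : Site} (hx : x ∈ U) (y : Site) :
    lap (fun w => logKernel (w - y) +
      (2 * Real.pi)⁻¹ * ∑ z ∈ U, green U w z * lap logKernel (z - y)) x = 0 := by
  have hpi := Real.pi_pos
  rw [lap_add, lap_comp_sub, lap_const_mul,
    lap_sum U (fun z w => green U w z * lap logKernel (z - y))]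
  have h : ∀ z ∈ U, lap (fun w => green U w z * lap logKernel (z - y)) x =
      if x = z then -(2 * Real.pi) * lap logKernel (x - y) else 0 := by
    intro z hz
    simp only [mul_comm _ (lap logKernel (z - y))]
    rw [lap_const_mul, lap_green hx hz]
    by_cases hxz : x = z
    · subst hxz; simp; ring
    · simp [hxz]
  rw [Finset.sum_congr rfl h, Finset.sum_ite_eq, if_pos hx]
  field_simp
  ring

/-- A lower bound `b` for the logarithmic kernel around `y` on the outer boundary gives a lower
bound for the Green function. -/
theorem le_green {U : Finset Site} {y : Site} {b : ℝ}
    (hb : ∀ w ∈ U, ∀ z ∈ nbrs w, z ∉ U → b ≤ logKernel (z - y)) {x : Site} (hx : x ∈ U) :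
    b - logKernel (x - y) - greenError ≤ green U x y := by
  have h1 := abs_le.1 (abs_green_sub_average_le U x y)
  have h2 := nonneg_of_lap_nonpos_of_nbrs (W := U) (f := fun w => (logKernel (w - y) +
      (2 * Real.pi)⁻¹ * ∑ z ∈ U, green U w z * lap logKernel (z - y)) + (-b))
    (fun w hw z hz hzU => by
      have := hb w hw z hz hzU
      rw [Finset.sum_eq_zero fun v _ => by rw [green_left hzU, zero_mul]]
      linarith)
    (fun w hw => by rw [lap_add, lap_const, lap_harmonic_part hw, add_zero]) hx
  linarith [h1.1]

theorem green_le {U : Finset Site} {y : Site} {b : ℝ}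
    (hb : ∀ w ∈ U, ∀ z ∈ nbrs w, z ∉ U → logKernel (z - y) ≤ b) {x : Site} (hx : x ∈ U) :
    green U x y ≤ b - logKernel (x - y) + greenError := by
  have h1 := abs_le.1 (abs_green_sub_average_le U x y)
  have h2 := nonneg_of_lap_nonpos_of_nbrs (W := U) (f := fun w => (-1) * (logKernel (w - y) +
      (2 * Real.pi)⁻¹ * ∑ z ∈ U, green U w z * lap logKernel (z - y)) + b)
    (fun w hw z hz hzU => by
      have := hb w hw z hz hzU
      rw [Finset.sum_eq_zero fun v _ => by rw [green_left hzU, zero_mul]]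
      linarith)
    (fun w hw => by rw [lap_add, lap_const, lap_const_mul, lap_harmonic_part hw]; simp) hx
  linarith [h1.2]

/-! ### Exponential variables -/

section Exponential

open ProbabilityTheory

theorem lintegral_expMeasure (q : ℝ) {f : ℝ → ENNReal} (hf : Measurable f) :
    ∫⁻ x, f x ∂(expMeasure q) =
      ∫⁻ x in Ici 0, ENNReal.ofReal (q * Real.exp (-(q * x))) * f x := by
  have h : expMeasure q = volume.withDensity (exponentialPDF q) := rfl
  have hm : Measurable (exponentialPDF q) := (measurable_exponentialPDFReal q).ennreal_ofReal
  rw [h, lintegral_withDensity_eq_lintegral_mul _ hm hf, ← lintegral_indicator measurableSet_Ici]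
  refine lintegral_congr fun x => ?_
  by_cases hx : 0 ≤ x
  · simp [hx, exponentialPDF_of_nonneg hx]
  · rw [Set.indicator_of_notMem (by simpa using hx), Pi.mul_apply,
      exponentialPDF_of_neg (not_le.1 hx), zero_mul]

theorem expMeasure_Ioi {q : ℝ} (hq : 0 < q) (r : ℝ) :
    expMeasure q (Ioi r) = ENNReal.ofReal (Real.exp (-(q * max r 0))) := by
  have := isProbabilityMeasure_expMeasure hq
  have h := cdf_expMeasure_eq hq r
  rw [cdf_eq_real] at h
  rw [← compl_Iic, ← ofReal_measureReal, probReal_compl_eq_one_sub measurableSet_Iic, h]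
  split_ifs with hr
  · rw [max_eq_left hr]; ring_nf
  · rw [max_eq_right (not_le.1 hr).le]; simp

theorem ae_expMeasure_nonneg {q : ℝ} : ∀ᵐ x ∂(expMeasure q), 0 ≤ x := by
  rw [ae_iff]
  have hms : MeasurableSet {x : ℝ | ¬ 0 ≤ x} :=
    (measurableSet_le measurable_const measurable_id).compl
  have h := lintegral_expMeasure q (f := indicator {x | ¬ 0 ≤ x} 1) (measurable_one.indicator hms)
  rw [lintegral_indicator_one hms] at h
  rw [h, setLIntegral_congr_fun (g := fun _ => 0) measurableSet_Ici, lintegral_zero]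
  intro x hx
  simp only
  rw [indicator_of_notMem (by simpa using hx), mul_zero]

theorem lintegral_exp_neg_mul {q a : ℝ} (hq : 0 < q) (ha : 0 < q + a) :
    ∫⁻ x, ENNReal.ofReal (Real.exp (-(a * x))) ∂(expMeasure q) = ENNReal.ofReal (q / (q + a)) := by
  rw [lintegral_expMeasure q (by fun_prop)]
  have h1 : ∀ x, ENNReal.ofReal (q * Real.exp (-(q * x))) * ENNReal.ofReal (Real.exp (-(a * x))) =
      ENNReal.ofReal (q * Real.exp (-(q + a) * x)) := by
    intro x
    rw [← ENNReal.ofReal_mul (by positivity), mul_assoc, ← Real.exp_add]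
    ring_nf
  simp only [h1]
  rw [setLIntegral_congr Ioi_ae_eq_Ici.symm, ← ofReal_integral_eq_lintegral_ofReal
    ((integrableOn_exp_mul_Ioi (by linarith) 0).const_mul q)
    (Eventually.of_forall fun x => by positivity), integral_const_mul,
    integral_exp_mul_Ioi (by linarith) 0]
  congr 1
  have h2 : -(q + a) ≠ 0 := by linarith
  rw [mul_zero, Real.exp_zero, neg_div_neg_eq, ← div_eq_mul_one_div]

/-- The exponential martingale of an exponential clock of rate `q`, stopped at time `s`. -/
theorem lintegral_exp_stopped {q c s : ℝ} (hq : 0 < q) (hc : c ≤ q) (hs : 0 ≤ s) :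
    ENNReal.ofReal (1 - c / q) * (∫⁻ x, indicator (Iic s)
        (fun x => ENNReal.ofReal (Real.exp (c * x))) x ∂(expMeasure q)) +
      ENNReal.ofReal (Real.exp (c * s)) * expMeasure q (Ioi s) = 1 := by
  have hc1 : 0 ≤ 1 - c / q := by
    rw [sub_nonneg, div_le_one hq]; exact hc
  rw [lintegral_expMeasure q ((by fun_prop : Measurable fun x : ℝ =>
      ENNReal.ofReal (Real.exp (c * x))).indicator measurableSet_Iic),
    ← lintegral_const_mul' _ _ ENNReal.ofReal_ne_top]
  have h1 : ∫⁻ x in Ici 0, ENNReal.ofReal (1 - c / q) * (ENNReal.ofReal (q * Real.exp (-(q * x))) *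
      indicator (Iic s) (fun x => ENNReal.ofReal (Real.exp (c * x))) x) =
      ∫⁻ x in Icc 0 s, ENNReal.ofReal ((q - c) * Real.exp ((c - q) * x)) := by
    rw [← lintegral_indicator measurableSet_Ici, ← lintegral_indicator measurableSet_Icc]
    refine lintegral_congr fun x => ?_
    by_cases hx : 0 ≤ x
    · by_cases hxs : x ≤ s
      · rw [indicator_of_mem (show x ∈ Ici 0 from hx),
          indicator_of_mem (show x ∈ Iic s from hxs), indicator_of_mem (show x ∈ Icc 0 s from
          ⟨hx, hxs⟩), ← ENNReal.ofReal_mul (by positivity), ← ENNReal.ofReal_mul hc1]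
        congr 1
        rw [mul_assoc q, ← Real.exp_add]
        field_simp
        ring_nf
      · rw [indicator_of_mem (show x ∈ Ici 0 from hx), indicator_of_notMem (by simpa using hxs),
          indicator_of_notMem (fun h => hxs h.2), mul_zero, mul_zero]
    · rw [indicator_of_notMem (by simpa using hx), indicator_of_notMem (fun h => hx h.1)]
  have h2 : ∫ x in Icc 0 s, (q - c) * Real.exp ((c - q) * x) = 1 - Real.exp ((c - q) * s) := by
    rw [integral_Icc_eq_integral_Ioc, ← intervalIntegral.integral_of_le hs,
      intervalIntegral.integral_eq_sub_of_hasDerivAt (f := fun x => -Real.exp ((c - q) * x))]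
    · simp; ring
    · intro x _
      have h := (((hasDerivAt_id x).const_mul (c - q)).exp).neg
      have h3 : (q - c) * Real.exp ((c - q) * x) =
          -(Real.exp ((c - q) * id x) * ((c - q) * 1)) := by simp only [id]; ring
      rw [h3]
      exact h
    · exact (by fun_prop : Continuous fun x : ℝ =>
        (q - c) * Real.exp ((c - q) * x)).intervalIntegrable _ _
  have hle : Real.exp ((c - q) * s) ≤ 1 :=
    Real.exp_le_one_iff.2 (mul_nonpos_of_nonpos_of_nonneg (by linarith) hs)
  rw [h1, ← ofReal_integral_eq_lintegral_ofReal, h2, expMeasure_Ioi hq, max_eq_left hs,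
    ← ENNReal.ofReal_mul (by positivity), ← Real.exp_add, ← ENNReal.ofReal_add (by linarith)
    (by positivity), ← ENNReal.ofReal_one]
  · congr 1
    ring_nf
  · exact (by fun_prop : Continuous fun x : ℝ =>
      (q - c) * Real.exp ((c - q) * x)).continuousOn.integrableOn_Icc
  · exact Eventually.of_forall fun x => mul_nonneg (by linarith) (by positivity)

end Exponential

/-! ### Markov jump processes -/

open Classical in
/-- `Y` is a Markov chain on a finite set, started at `v₀`, with transition probabilities `p`,
and given `Y` the holding times `H k` are independent exponentials of rates `q (Y k)`. -/
structure IsJumpChain {V Ω : Type*} [Fintype V] [MeasurableSpace V] [MeasurableSpace Ω]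
    (P : Measure Ω) (v₀ : V) (p : V → V → ℝ) (q : V → ℝ) (Y : ℕ → Ω → V) (H : ℕ → Ω → ℝ) :
    Prop where
  measurable_chain : ∀ k, Measurable (Y k)
  measurable_time : ∀ k, Measurable (H k)
  rate_pos : ∀ v, 0 < q v
  prob_nonneg : ∀ v w, 0 ≤ p v w
  prob_sum : ∀ v, ∑ w, p v w = 1
  law : ∀ (m : ℕ) (v : ℕ → V) (t : ℕ → ℝ), (∀ k, 0 ≤ t k) →
    P.real {ω | ∀ k ≤ m, Y k ω = v k ∧ t k < H k ω} =
      (if v 0 = v₀ then 1 else 0) * (∏ k ∈ Finset.range m, p (v k) (v (k + 1))) *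
        ∏ k ∈ Finset.range (m + 1), Real.exp (-(q (v k) * t k))

theorem lintegral_eq_sum_fiber {ι Ω : Type*} [Fintype ι] [MeasurableSpace Ω]
    {P : Measure Ω} {Z : Ω → ι}
    (hZ : ∀ i, MeasurableSet {ω | Z ω = i}) (f : Ω → ENNReal) :
    ∫⁻ ω, f ω ∂P = ∑ i, ∫⁻ ω in {ω | Z ω = i}, f ω ∂P := by
  have h := lintegral_iUnion (μ := P) hZ (fun i j hij => Set.disjoint_left.2 fun ω h1 h2 =>
    hij (h1.symm.trans h2)) f
  rw [tsum_fintype] at h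
  rw [← h, show (⋃ i, {ω | Z ω = i}) = univ from Set.eq_univ_of_forall fun ω =>
    Set.mem_iUnion.2 ⟨Z ω, rfl⟩, Measure.restrict_univ]

namespace IsJumpChain

open ProbabilityTheory

variable {V Ω : Type*} [Fintype V] [MeasurableSpace V] [DiscreteMeasurableSpace V]
  [MeasurableSpace Ω] {P : Measure Ω} {v₀ : V} {p : V → V → ℝ}
  {q : V → ℝ} {Y : ℕ → Ω → V} {H : ℕ → Ω → ℝ}

theorem measurableSet_cylinder (hJ : IsJumpChain P v₀ p q Y H) (m : ℕ) (v : ℕ → V) (t : ℕ → ℝ) :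
    MeasurableSet {ω | ∀ k ≤ m, Y k ω = v k ∧ t k < H k ω} := by
  have : {ω | ∀ k ≤ m, Y k ω = v k ∧ t k < H k ω} =
      ⋂ k, ⋂ (_ : k ≤ m), (Y k ⁻¹' {v k} ∩ {ω | t k < H k ω}) := by
    ext ω; simp
  rw [this]
  exact MeasurableSet.iInter fun k => MeasurableSet.iInter fun _ =>
    (hJ.measurable_chain k (MeasurableSet.of_discrete)).inter
      (measurableSet_lt measurable_const (hJ.measurable_time k))

theorem measurableSet_path (hJ : IsJumpChain P v₀ p q Y H) (m : ℕ) (v : ℕ → V) :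
    MeasurableSet {ω | ∀ k ≤ m, Y k ω = v k} := by
  have : {ω | ∀ k ≤ m, Y k ω = v k} = ⋂ k, ⋂ (_ : k ≤ m), Y k ⁻¹' {v k} := by
    ext ω; simp
  rw [this]
  exact MeasurableSet.iInter fun k => MeasurableSet.iInter fun _ =>
    hJ.measurable_chain k (MeasurableSet.of_discrete)

variable [IsProbabilityMeasure P]

/-- Holding times are not assumed to be nonnegative: this follows, as the law of the path and the
positive holding times already has total mass one. -/
theorem ae_time_pos_of_le (hJ : IsJumpChain P v₀ p q Y H) (m : ℕ) :
    ∀ᵐ ω ∂P, ∀ k ≤ m, 0 < H k ω := by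
  classical
  induction m with
  | zero =>
    have hm : ∀ v : V, MeasurableSet {ω | ∀ k ≤ 0, Y k ω = v ∧ 0 < H k ω} := fun v =>
      hJ.measurableSet_cylinder 0 (fun _ => v) (fun _ => 0)
    have h1 : P.real (⋃ v ∈ (Finset.univ : Finset V), {ω | ∀ k ≤ 0, Y k ω = v ∧ 0 < H k ω}) = 1 := by
      rw [measureReal_biUnion_finset]
      · have h2 : ∀ v : V, P.real {ω | ∀ k ≤ 0, Y k ω = v ∧ 0 < H k ω} =
            if v = v₀ then 1 else 0 := fun v => by
          have := hJ.law 0 (fun _ => v) (fun _ => 0) fun _ => le_rfl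
          simpa using this
        rw [Finset.sum_congr rfl fun v _ => h2 v]
        simp
      · intro v _ w _ hvw
        refine Set.disjoint_left.2 fun ω h3 h4 => hvw ?_
        rw [← (h3 0 le_rfl).1, ← (h4 0 le_rfl).1]
      · exact fun v _ => hm v
    have h2 : P (⋃ v ∈ (Finset.univ : Finset V), {ω | ∀ k ≤ 0, Y k ω = v ∧ 0 < H k ω}) = 1 := by
      rw [← ofReal_measureReal (measure_ne_top _ _), h1, ENNReal.ofReal_one]
    have h3 := (mem_ae_iff_prob_eq_one (μ := P)
      (Finset.measurableSet_biUnion _ fun v _ => hm v)).2 h2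
    filter_upwards [h3] with ω hω
    simp only [Set.mem_iUnion] at hω
    obtain ⟨v, _, hv⟩ := hω
    exact fun k hk => (hv k hk).2
  | succ m ih =>
    -- given any path, the next holding time is positive since the transition probabilities
    -- sum to one
    have key : ∀ v : ℕ → V,
        P ({ω | ∀ k ≤ m, Y k ω = v k ∧ 0 < H k ω} \ {ω | 0 < H (m + 1) ω}) = 0 := by
      intro v
      have hpos : MeasurableSet {ω | 0 < H (m + 1) ω} :=
        measurableSet_lt measurable_const (hJ.measurable_time _)
      have hcyl := hJ.measurableSet_cylinder m v fun _ => 0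
      have hu : {ω | ∀ k ≤ m, Y k ω = v k ∧ 0 < H k ω} ∩ {ω | 0 < H (m + 1) ω} =
          ⋃ w ∈ (Finset.univ : Finset V),
            {ω | ∀ k ≤ m + 1, Y k ω = Function.update v (m + 1) w k ∧ 0 < H k ω} := by
        ext ω
        simp only [Set.mem_inter_iff, Set.mem_ofPred_eq, Set.mem_iUnion, Finset.mem_univ,
          exists_true_left]
        constructor
        · rintro ⟨h1, h2⟩
          refine ⟨Y (m + 1) ω, fun k hk => ?_⟩
          rcases Nat.le_succ_iff.1 hk with hk | rfl
          · rw [Function.update_of_ne (by omega)]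
            exact h1 k hk
          · simpa using h2
        · rintro ⟨w, h⟩
          refine ⟨fun k hk => ?_, (h (m + 1) le_rfl).2⟩
          have := h k (by omega)
          rwa [Function.update_of_ne (by omega)] at this
      have hreal : P.real ({ω | ∀ k ≤ m, Y k ω = v k ∧ 0 < H k ω} ∩ {ω | 0 < H (m + 1) ω}) =
          P.real {ω | ∀ k ≤ m, Y k ω = v k ∧ 0 < H k ω} := by
        rw [hu, measureReal_biUnion_finset]
        · have h2 : ∀ w : V, P.real {ω | ∀ k ≤ m + 1, Y k ω =
              Function.update v (m + 1) w k ∧ 0 < H k ω} =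
              (if v 0 = v₀ then 1 else 0) * (∏ k ∈ Finset.range m, p (v k) (v (k + 1))) *
                p (v m) w := by
            intro w
            rw [hJ.law (m + 1) _ (fun _ => 0) fun _ => le_rfl, Finset.prod_range_succ]
            have h3 : ∏ k ∈ Finset.range m, p (Function.update v (m + 1) w k)
                (Function.update v (m + 1) w (k + 1)) =
                ∏ k ∈ Finset.range m, p (v k) (v (k + 1)) :=
              Finset.prod_congr rfl fun k hk => by
                have := Finset.mem_range.1 hk
                rw [Function.update_of_ne (by omega), Function.update_of_ne (by omega)]
            rw [h3, Function.update_of_ne (show 0 ≠ m + 1 by omega),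
              Function.update_of_ne (show m ≠ m + 1 by omega), Function.update_self]
            simp
          simp only [h2]
          rw [← Finset.mul_sum, hJ.prob_sum, hJ.law m v (fun _ => 0) fun _ => le_rfl]
          simp
        · intro w _ w' _ hww
          refine Set.disjoint_left.2 fun ω h3 h4 => hww ?_
          have h5 := (h3 (m + 1) le_rfl).1
          have h6 := (h4 (m + 1) le_rfl).1
          rw [Function.update_self] at h5 h6
          rw [← h5, ← h6]
        · exact fun w _ => hJ.measurableSet_cylinder (m + 1) _ _
      have h3 := measureReal_inter_add_sdiff (μ := P)
        (s := {ω | ∀ k ≤ m, Y k ω = v k ∧ 0 < H k ω}) hpos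
      rw [← measureReal_eq_zero_iff]
      linarith
    have hnull : P (⋃ v : Fin (m + 1) → V, ({ω | ∀ k ≤ m, Y k ω =
        (fun j => if h : j < m + 1 then v ⟨j, h⟩ else v₀) k ∧ 0 < H k ω} \
          {ω | 0 < H (m + 1) ω})) = 0 := measure_iUnion_null fun v => key _
    filter_upwards [ih, measure_eq_zero_iff_ae_notMem.1 hnull] with ω h1 h2 k hk
    rcases Nat.le_succ_iff.1 hk with hk | rfl
    · exact h1 k hk
    · by_contra hneg
      refine h2 (Set.mem_iUnion.2 ⟨fun i => Y i ω, fun j hj => ⟨?_, h1 j hj⟩, hneg⟩)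
      simp [Nat.lt_succ_of_le hj]

theorem ae_time_pos (hJ : IsJumpChain P v₀ p q Y H) : ∀ᵐ ω ∂P, ∀ k, 0 < H k ω := by
  filter_upwards [ae_all_iff.2 hJ.ae_time_pos_of_le] with ω h k
  exact h k k le_rfl

theorem ae_chain_zero (hJ : IsJumpChain P v₀ p q Y H) : ∀ᵐ ω ∂P, Y 0 ω = v₀ := by
  classical
  have h := hJ.law 0 (fun _ => v₀) (fun _ => 0) fun _ => le_rfl
  simp only [nonpos_iff_eq_zero, forall_eq, if_true, Finset.range_zero, Finset.prod_empty,
    mul_zero, neg_zero, Real.exp_zero, Finset.prod_const_one, mul_one] at h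
  have h2 : P {ω | Y 0 ω = v₀ ∧ 0 < H 0 ω} = 1 := by
    rw [← ofReal_measureReal, h, ENNReal.ofReal_one]
  have hms : MeasurableSet {ω | Y 0 ω = v₀ ∧ 0 < H 0 ω} :=
    (hJ.measurable_chain 0 (MeasurableSet.of_discrete (s := {v₀}))).inter
      (measurableSet_lt measurable_const (hJ.measurable_time 0))
  filter_upwards [(mem_ae_iff_prob_eq_one hms).2 h2] with ω hω
  exact hω.1

open Classical in
/-- The law of the path and the holding times, for thresholds of any sign. -/
theorem law_max (hJ : IsJumpChain P v₀ p q Y H) (m : ℕ) (v : ℕ → V) (t : ℕ → ℝ) :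
    P {ω | ∀ k ≤ m, Y k ω = v k ∧ t k < H k ω} = ENNReal.ofReal
      ((if v 0 = v₀ then 1 else 0) * (∏ k ∈ Finset.range m, p (v k) (v (k + 1))) *
        ∏ k ∈ Finset.range (m + 1), Real.exp (-(q (v k) * max (t k) 0))) := by
  rw [← hJ.law m v (fun k => max (t k) 0) fun k => le_max_right _ _, ofReal_measureReal]
  refine measure_congr ?_
  filter_upwards [hJ.ae_time_pos] with ω hω
  refine propext (forall₂_congr fun k _ => and_congr_right fun _ => ?_)
  simp [hω k]

/-- The Markov property in its basic form: on a given path, the current holding time is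
independent of the previous ones and of the next step. -/
theorem map_restrict_path (hJ : IsJumpChain P v₀ p q Y H) (m : ℕ) (v : ℕ → V) :
    (P.restrict {ω | ∀ k ≤ m + 1, Y k ω = v k}).map
        (fun ω => ((fun i : Fin m => H i ω), H m ω)) =
      ((P.restrict {ω | ∀ k ≤ m, Y k ω = v k}).map (fun ω => fun i : Fin m => H i ω)).prod
        (ENNReal.ofReal (p (v m) (v (m + 1))) • expMeasure (q (v m))) := by
  classical
  have := isProbabilityMeasure_expMeasure (hJ.rate_pos (v m))
  have hmh : Measurable fun ω => fun i : Fin m => H i ω :=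
    measurable_pi_lambda _ fun i => hJ.measurable_time i
  have hspanR : ∀ n : ℕ, Ioi (-(n : ℝ)) ∈ range (Ioi : ℝ → Set ℝ) := fun n => ⟨_, rfl⟩
  have hunR : ⋃ n : ℕ, Ioi (-(n : ℝ)) = univ := by
    refine Set.eq_univ_of_forall fun x => Set.mem_iUnion.2 ?_
    obtain ⟨n, hn⟩ := exists_nat_gt (-x)
    exact ⟨n, by simp; linarith⟩
  have hunV : ⋃ n : ℕ, (univ.pi fun _ : Fin m => Ioi (-(n : ℝ))) = univ := by
    refine Set.eq_univ_of_forall fun x => Set.mem_iUnion.2 ?_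
    obtain ⟨n, hn⟩ := exists_nat_gt (∑ i, |x i|)
    refine ⟨n, fun i _ => ?_⟩
    have h1 := Finset.single_le_sum (f := fun i => |x i|) (fun i _ => abs_nonneg _)
      (Finset.mem_univ i)
    have h2 := neg_abs_le (x i)
    simp only [mem_Ioi]
    linarith
  have hgen : MeasurableSpace.generateFrom (range (Ioi : ℝ → Set ℝ)) = Real.measurableSpace := by
    rw [← borel_eq_generateFrom_Ioi]; exact (BorelSpace.measurable_eq (α := ℝ)).symm
  symm
  refine Measure.prod_eq_generateFrom
    (C := Set.pi univ '' Set.pi univ fun _ : Fin m => range (Ioi : ℝ → Set ℝ))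
    (D := range (Ioi : ℝ → Set ℝ)) ?_ hgen (IsPiSystem.pi fun _ => isPiSystem_Ioi) isPiSystem_Ioi
    { set := fun n => univ.pi fun _ => Ioi (-(n : ℝ))
      set_mem := fun n => ⟨fun _ => Ioi (-(n : ℝ)), fun _ _ => hspanR n, rfl⟩
      finite := fun n => measure_lt_top _ _
      spanning := hunV }
    { set := fun n => Ioi (-(n : ℝ))
      set_mem := hspanR
      finite := fun n => by
        rw [Measure.smul_apply, smul_eq_mul]
        exact ENNReal.mul_lt_top ENNReal.ofReal_lt_top (measure_lt_top _ _)
      spanning := hunR } ?_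
  · exact generateFrom_eq_pi (fun _ => hgen) fun _ => ⟨fun n => Ioi (-(n : ℝ)), hspanR, hunR⟩
  · rintro _ ⟨s, hs, rfl⟩ _ ⟨r, rfl⟩
    choose t ht using fun i => hs i (mem_univ i)
    obtain rfl : (fun i => Ioi (t i)) = s := funext ht
    have hms : MeasurableSet (univ.pi fun i : Fin m => Ioi (t i)) :=
      MeasurableSet.univ_pi fun i => measurableSet_Ioi
    rw [Measure.map_apply (hmh.prodMk (hJ.measurable_time m)) (hms.prod measurableSet_Ioi),
      Measure.map_apply hmh hms, Measure.restrict_apply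
        ((hmh.prodMk (hJ.measurable_time m)) (hms.prod measurableSet_Ioi)),
      Measure.restrict_apply (hmh hms), Measure.smul_apply, smul_eq_mul,
      expMeasure_Ioi (hJ.rate_pos _)]
    -- thresholds `-1` impose no condition
    set τ : ℕ → ℝ := fun k => if h : k < m then t ⟨k, h⟩ else -1 with hτ
    set τ' : ℕ → ℝ := fun k => if k = m then r else τ k with hτ'
    have e1 : P ((fun ω => ((fun i : Fin m => H i ω), H m ω)) ⁻¹'
        ((univ.pi fun i : Fin m => Ioi (t i)) ×ˢ Ioi r) ∩ {ω | ∀ k ≤ m + 1, Y k ω = v k}) =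
        P {ω | ∀ k ≤ m + 1, Y k ω = v k ∧ τ' k < H k ω} := by
      refine measure_congr ?_
      filter_upwards [hJ.ae_time_pos] with ω hω
      refine propext ?_
      change ((_ ∈ _ ∧ _ ∈ _) ∧ _) ↔ _
      simp only [Set.mem_pi, Set.mem_univ, true_imp_iff, mem_Ioi, Set.mem_ofPred_eq]
      constructor
      · rintro ⟨⟨h1, h2⟩, h3⟩ k hk
        refine ⟨h3 k hk, ?_⟩
        by_cases hkm : k = m
        · subst hkm; simpa [hτ'] using h2
        · by_cases hlt : k < m
          · simpa [hτ', hτ, hkm, hlt] using h1 ⟨k, hlt⟩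
          · simp only [hτ', hτ, hkm, hlt, if_false, dif_neg, not_false_eq_true]
            linarith [hω k]
      · intro h
        refine ⟨⟨fun i => ?_, ?_⟩, fun k hk => (h k hk).1⟩
        · have := (h i (by omega)).2
          simpa [hτ', hτ, i.2.ne, i.2] using this
        · simpa [hτ'] using (h m (by omega)).2
    have e2 : P ((fun ω => fun i : Fin m => H i ω) ⁻¹' (univ.pi fun i : Fin m => Ioi (t i)) ∩
        {ω | ∀ k ≤ m, Y k ω = v k}) = P {ω | ∀ k ≤ m, Y k ω = v k ∧ τ k < H k ω} := by
      refine measure_congr ?_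
      filter_upwards [hJ.ae_time_pos] with ω hω
      refine propext ?_
      change (_ ∈ _ ∧ _) ↔ _
      simp only [Set.mem_ofPred_eq]
      constructor
      · rintro ⟨h1, h3⟩ k hk
        refine ⟨h3 k hk, ?_⟩
        by_cases hlt : k < m
        · simpa [hτ, hlt] using h1 ⟨k, hlt⟩
        · simp only [hτ, hlt, dif_neg, not_false_eq_true]
          linarith [hω k]
      · intro h
        refine ⟨fun i => ?_, fun k hk => (h k hk).1⟩
        have := (h i (by omega)).2
        simpa [hτ, i.2] using this
    rw [e1, e2, hJ.law_max, hJ.law_max, ← ENNReal.ofReal_mul (hJ.prob_nonneg _ _),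
      ← ENNReal.ofReal_mul]
    · congr 1
      rw [Finset.prod_range_succ (fun k => p (v k) (v (k + 1))),
        Finset.prod_range_succ (n := m + 1), Finset.prod_range_succ (n := m),
        Finset.prod_range_succ (n := m)]
      have h1 : ∏ k ∈ Finset.range m, Real.exp (-(q (v k) * max (τ' k) 0)) =
          ∏ k ∈ Finset.range m, Real.exp (-(q (v k) * max (τ k) 0)) :=
        Finset.prod_congr rfl fun k hk => by
          simp [hτ', (Finset.mem_range.1 hk).ne]
      have h2 : max (τ' (m + 1)) 0 = 0 := by simp [hτ', hτ]
      have h3 : max (τ m) 0 = 0 := by simp [hτ]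
      have h4 : τ' m = r := by simp [hτ']
      rw [h1, h2, h3, h4]
      simp only [mul_zero, neg_zero, Real.exp_zero, mul_one]
      ring
    · refine mul_nonneg (mul_nonneg (by split_ifs <;> norm_num)
        (Finset.prod_nonneg fun _ _ => hJ.prob_nonneg _ _))
        (Finset.prod_nonneg fun _ _ => (Real.exp_pos _).le)

theorem setLIntegral_path (hJ : IsJumpChain P v₀ p q Y H) (m : ℕ) (v : ℕ → V)
    {F : (Fin m → ℝ) × ℝ → ENNReal} (hF : Measurable F) :
    ∫⁻ ω in {ω | ∀ k ≤ m + 1, Y k ω = v k}, F (fun i => H i ω, H m ω) ∂P =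
      ∫⁻ ω in {ω | ∀ k ≤ m, Y k ω = v k}, ENNReal.ofReal (p (v m) (v (m + 1))) *
        ∫⁻ x, F (fun i => H i ω, x) ∂(expMeasure (q (v m))) ∂P := by
  have := isProbabilityMeasure_expMeasure (hJ.rate_pos (v m))
  have hmh : Measurable fun ω => fun i : Fin m => H i ω :=
    measurable_pi_lambda _ fun i => hJ.measurable_time i
  have h1 := lintegral_map (μ := P.restrict {ω | ∀ k ≤ m + 1, Y k ω = v k}) hF
    (hmh.prodMk (hJ.measurable_time m))
  rw [← h1, hJ.map_restrict_path, lintegral_prod _ hF.aemeasurable, lintegral_map]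
  · refine lintegral_congr fun ω => ?_
    rw [lintegral_smul_measure, smul_eq_mul]
  · exact hF.lintegral_prod_right'
  · exact hmh

/-- The one-step Markov property: `R` is any function of the chain up to step `m` and of the
holding times before step `m`. -/
theorem lintegral_step (hJ : IsJumpChain P v₀ p q Y H) (m : ℕ) {β : Type*} [MeasurableSpace β]
    {R : Ω → β} {ρ : (Fin (m + 1) → V) → (Fin m → ℝ) → β} (hρ : ∀ v, Measurable (ρ v))
    (hR : ∀ ω, R ω = ρ (fun i => Y i ω) (fun i => H i ω))
    {G : V → V → β × ℝ → ENNReal} (hG : ∀ v w, Measurable (G v w)) :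
    ∫⁻ ω, G (Y m ω) (Y (m + 1) ω) (R ω, H m ω) ∂P =
      ∫⁻ ω, ∑ w, ENNReal.ofReal (p (Y m ω) w) *
        ∫⁻ x, G (Y m ω) w (R ω, x) ∂(expMeasure (q (Y m ω))) ∂P := by
  classical
  set ext : (Fin (m + 1) → V) → V → ℕ → V :=
    fun v w k => if h : k < m + 1 then v ⟨k, h⟩ else w with hext
  have hfib : ∀ v w, {ω | (fun i : Fin (m + 1) => Y i ω) = v} = {ω | ∀ k ≤ m, Y k ω = ext v w k} := by
    intro v w
    ext ω
    simp only [Set.mem_ofPred_eq, funext_iff]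
    constructor
    · intro h k hk
      simpa [hext, hk] using h ⟨k, Nat.lt_succ_of_le hk⟩
    · intro h i
      simpa [hext, Nat.le_of_lt_succ i.2] using h i (Nat.le_of_lt_succ i.2)
  have hfib2 : ∀ v w, {ω | ((fun i : Fin (m + 1) => Y i ω), Y (m + 1) ω) = (v, w)} =
      {ω | ∀ k ≤ m + 1, Y k ω = ext v w k} := by
    intro v w
    ext ω
    simp only [Set.mem_ofPred_eq, Prod.mk.injEq]
    have h1 := Set.ext_iff.1 (hfib v w) ω
    simp only [Set.mem_ofPred_eq] at h1
    rw [h1]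
    constructor
    · rintro ⟨h2, h3⟩ k hk
      rcases Nat.le_succ_iff.1 hk with hk | rfl
      · exact h2 k hk
      · simpa [hext] using h3
    · intro h
      exact ⟨fun k hk => h k (by omega), by simpa [hext] using h (m + 1) le_rfl⟩
  have hm1 : ∀ v, MeasurableSet {ω | (fun i : Fin (m + 1) => Y i ω) = v} := fun v => by
    rw [hfib v v₀]; exact hJ.measurableSet_path m _
  have hm2 : ∀ z : (Fin (m + 1) → V) × V,
      MeasurableSet {ω | ((fun i : Fin (m + 1) => Y i ω), Y (m + 1) ω) = z} := fun z => by
    rw [hfib2 z.1 z.2]; exact hJ.measurableSet_path _ _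
  rw [lintegral_eq_sum_fiber hm2, lintegral_eq_sum_fiber hm1, Fintype.sum_prod_type]
  refine Finset.sum_congr rfl fun v _ => ?_
  have hGm : ∀ w, Measurable fun z : (Fin m → ℝ) × ℝ => G (v (Fin.last m)) w (ρ v z.1, z.2) :=
    fun w => (hG _ _).comp (((hρ v).comp measurable_fst).prodMk measurable_snd)
  have hlast : ∀ w, ext v w m = v (Fin.last m) := fun w => by simp [hext, Fin.last]
  have hnext : ∀ w, ext v w (m + 1) = w := fun w => by simp [hext]
  have hstep : ∀ w, ∫⁻ ω in {ω | ((fun i : Fin (m + 1) => Y i ω), Y (m + 1) ω) = (v, w)},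
      G (Y m ω) (Y (m + 1) ω) (R ω, H m ω) ∂P =
      ∫⁻ ω in {ω | (fun i : Fin (m + 1) => Y i ω) = v}, ENNReal.ofReal (p (v (Fin.last m)) w) *
        ∫⁻ x, G (v (Fin.last m)) w (ρ v (fun i => H i ω), x)
          ∂(expMeasure (q (v (Fin.last m)))) ∂P := by
    intro w
    have h1 : ∫⁻ ω in {ω | ((fun i : Fin (m + 1) => Y i ω), Y (m + 1) ω) = (v, w)},
        G (Y m ω) (Y (m + 1) ω) (R ω, H m ω) ∂P =
        ∫⁻ ω in {ω | ((fun i : Fin (m + 1) => Y i ω), Y (m + 1) ω) = (v, w)},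
        (fun z : (Fin m → ℝ) × ℝ => G (v (Fin.last m)) w (ρ v z.1, z.2))
          (fun i => H i ω, H m ω) ∂P := by
      refine setLIntegral_congr_fun (hm2 _) fun ω hω => ?_
      simp only [Set.mem_ofPred_eq, Prod.mk.injEq] at hω
      have h2 : Y m ω = v (Fin.last m) := congrFun hω.1 (Fin.last m)
      simp only
      rw [hR, hω.1, hω.2, h2]
    rw [h1, hfib2, hJ.setLIntegral_path m _ (hGm w), hlast, hnext, hfib v w]
  rw [Finset.sum_congr rfl fun w _ => hstep w, ← lintegral_finsetSum]
  · refine setLIntegral_congr_fun (hm1 v) fun ω hω => ?_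
    have h2 : Y m ω = v (Fin.last m) := congrFun hω (Fin.last m)
    rw [hR, show (fun i : Fin (m + 1) => Y i ω) = v from hω, h2]
  · intro w _
    have := isProbabilityMeasure_expMeasure (hJ.rate_pos (v (Fin.last m)))
    exact ((hGm w).lintegral_prod_right'.comp
      (measurable_pi_lambda _ fun i => hJ.measurable_time i)).const_mul _

end IsJumpChain

/-! ### Recurrence and the Feynman–Kac formula at the inverse local time -/

section Functionals

variable {V Ω : Type*}

open Classical in
/-- The time spent at `v₀` during the first `m` steps. -/
def clock (v₀ : V) (Y : ℕ → Ω → V) (H : ℕ → Ω → ℝ) (m : ℕ) (ω : Ω) : ℝ :=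
  ∑ i ∈ Finset.range m, if Y i ω = v₀ then H i ω else 0

open Classical in
/-- The multiplicative weight of a stay of length `x` at `v`: killing on `S`, and a potential `a`
elsewhere. -/
def stayWeight (S : Set V) (a : V → ℝ) (v : V) (x : ℝ) : ENNReal :=
  if v ∈ S then 0 else ENNReal.ofReal (Real.exp (-(a v * x)))

/-- The weight of the first `m` steps. -/
def pathWeight (S : Set V) (a : V → ℝ) (Y : ℕ → Ω → V) (H : ℕ → Ω → ℝ) (m : ℕ) (ω : Ω) :
    ENNReal :=
  ∏ i ∈ Finset.range m, stayWeight S a (Y i ω) (H i ω)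

/-- The index of the step during which the clock at `v₀` passes `t`. -/
def crossIndex (v₀ : V) (Y : ℕ → Ω → V) (H : ℕ → Ω → ℝ) (t : ℝ) (ω : Ω) : ℕ :=
  sInf {j | t < clock v₀ Y H (j + 1) ω}

theorem measurable_stayWeight (S : Set V) (a : V → ℝ) (v : V) :
    Measurable (stayWeight S a v) := by
  unfold stayWeight
  split_ifs
  · exact measurable_const
  · fun_prop

variable {v₀ : V} {Y : ℕ → Ω → V} {H : ℕ → Ω → ℝ}

open Classical in
theorem clock_succ (m : ℕ) (ω : Ω) : clock v₀ Y H (m + 1) ω =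
    clock v₀ Y H m ω + if Y m ω = v₀ then H m ω else 0 :=
  Finset.sum_range_succ _ _

theorem clock_mono {ω : Ω} (hH : ∀ k, 0 < H k ω) : Monotone fun m => clock v₀ Y H m ω := by
  refine monotone_nat_of_le_succ fun m => ?_
  rw [clock_succ]
  split_ifs
  · linarith [hH m]
  · simp

theorem crossIndex_spec {ω : Ω} {t : ℝ} (ht : 0 ≤ t) (hH : ∀ k, 0 < H k ω)
    (hrec : ∃ m, t < clock v₀ Y H m ω) :
    clock v₀ Y H (crossIndex v₀ Y H t ω) ω ≤ t ∧
      t < clock v₀ Y H (crossIndex v₀ Y H t ω + 1) ω := by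
  have hne : {j | t < clock v₀ Y H (j + 1) ω}.Nonempty := by
    obtain ⟨m, hm⟩ := hrec
    exact ⟨m, hm.trans_le (clock_mono hH m.le_succ)⟩
  refine ⟨?_, Nat.sInf_mem hne⟩
  rcases Nat.eq_zero_or_pos (crossIndex v₀ Y H t ω) with h | h
  · rw [h]; simpa [clock] using ht
  · obtain ⟨k, hk⟩ := Nat.exists_eq_succ_of_ne_zero h.ne'
    have := Nat.notMem_of_lt_sInf (s := {j | t < clock v₀ Y H (j + 1) ω}) (m := k)
      (by change k < crossIndex v₀ Y H t ω; omega)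
    rw [hk]
    exact not_lt.1 this

theorem eq_crossIndex {ω : Ω} {t : ℝ} (hH : ∀ k, 0 < H k ω) {m : ℕ}
    (h1 : clock v₀ Y H m ω ≤ t) (h2 : t < clock v₀ Y H (m + 1) ω) :
    crossIndex v₀ Y H t ω = m := by
  refine le_antisymm (Nat.sInf_le h2) (le_csInf ⟨m, h2⟩ fun j hj => ?_)
  by_contra hlt
  have := clock_mono (v₀ := v₀) (Y := Y) hH (show j + 1 ≤ m by omega)
  simp only at this
  have hj' : t < clock v₀ Y H (j + 1) ω := hj
  linarith

theorem ae_exists_lt_clock [MeasurableSpace Ω] {P : Measure Ω}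
    (hrec : ∀ t : ℝ, Tendsto (fun m => P {ω | clock v₀ Y H m ω ≤ t}) atTop (𝓝 0)) :
    ∀ᵐ ω ∂P, ∀ t : ℝ, ∃ m, t < clock v₀ Y H m ω := by
  have h : ∀ n : ℕ, ∀ᵐ ω ∂P, ∃ m, (n : ℝ) < clock v₀ Y H m ω := by
    intro n
    rw [ae_iff]
    refine le_antisymm (ge_of_tendsto' (hrec n) fun m => measure_mono fun ω hω => ?_) bot_le
    have hω' : ¬ ∃ m, (n : ℝ) < clock v₀ Y H m ω := hω
    push Not at hω'
    exact hω' m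
  filter_upwards [ae_all_iff.2 h] with ω hω t
  obtain ⟨n, hn⟩ := exists_nat_gt t
  obtain ⟨m, hm⟩ := hω n
  exact ⟨m, hn.trans hm⟩

end Functionals

namespace IsJumpChain

set_option linter.unusedSectionVars false

open ProbabilityTheory

variable {V Ω : Type*} [Fintype V] [MeasurableSpace V] [DiscreteMeasurableSpace V]
  [MeasurableSpace Ω] {P : Measure Ω} {v₀ : V} {p : V → V → ℝ}
  {q : V → ℝ} {Y : ℕ → Ω → V} {H : ℕ → Ω → ℝ}

theorem measurable_clock (hJ : IsJumpChain P v₀ p q Y H) (m : ℕ) :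
    Measurable (clock v₀ Y H m) := by
  classical
  refine Finset.measurable_fun_sum _ fun i _ => Measurable.ite ?_ (hJ.measurable_time i)
    measurable_const
  exact hJ.measurable_chain i (MeasurableSet.of_discrete (s := {v₀}))

theorem measurable_pathWeight (hJ : IsJumpChain P v₀ p q Y H) (S : Set V) (a : V → ℝ) (m : ℕ) :
    Measurable (pathWeight S a Y H m) := by
  refine Finset.measurable_fun_prod _ fun i _ => ?_
  have h : Measurable fun z : V × ℝ => stayWeight S a z.1 z.2 :=
    measurable_from_prod_countable_right fun v => measurable_stayWeight S a v
  exact h.comp ((hJ.measurable_chain i).prodMk (hJ.measurable_time i))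

variable [IsProbabilityMeasure P]

open Classical in
/-- The expectation of `exp (-clock) * u` contracts in each step, for a Lyapunov function `u`. -/
theorem lintegral_exp_clock_step (hJ : IsJumpChain P v₀ p q Y H) {u : V → ℝ} (hu1 : ∀ v, 1 ≤ u v)
    {r : ℝ} (hr : 0 ≤ r) (hu : ∀ v, (if v = v₀ then q v / (q v + 1) else 1) * ∑ w, p v w * u w ≤
      r * u v) (m : ℕ) :
    ∫⁻ ω, ENNReal.ofReal (Real.exp (-clock v₀ Y H (m + 1) ω) * u (Y (m + 1) ω)) ∂P ≤
      ENNReal.ofReal r *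
        ∫⁻ ω, ENNReal.ofReal (Real.exp (-clock v₀ Y H m ω) * u (Y m ω)) ∂P := by
  have hu0 : ∀ v, 0 ≤ u v := fun v => zero_le_one.trans (hu1 v)
  have hstep := hJ.lintegral_step m (β := ℝ) (R := clock v₀ Y H m)
    (ρ := fun v h => ∑ i : Fin m, if v i.castSucc = v₀ then h i else 0)
    (fun v => Finset.measurable_fun_sum _ fun i _ => by split_ifs <;> fun_prop)
    (fun ω => by simp [clock, Finset.sum_range])
    (G := fun v w z => ENNReal.ofReal (Real.exp (-(z.1 + if v = v₀ then z.2 else 0)) * u w))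
    (fun v w => by split_ifs <;> fun_prop)
  simp only [clock_succ]
  refine hstep.trans_le ?_
  rw [← lintegral_const_mul' _ _ ENNReal.ofReal_ne_top]
  refine lintegral_mono fun ω => ?_
  generalize Y m ω = v
  generalize clock v₀ Y H m ω = A
  have := isProbabilityMeasure_expMeasure (hJ.rate_pos v)
  have h1 : ∀ w, ∫⁻ x, ENNReal.ofReal (Real.exp (-(A + if v = v₀ then x else 0)) * u w)
      ∂(expMeasure (q v)) = ENNReal.ofReal (Real.exp (-A) * u w *
        (if v = v₀ then q v / (q v + 1) else 1)) := by
    intro w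
    by_cases hv : v = v₀
    · simp only [hv, if_true]
      have hq := hJ.rate_pos v₀
      have h2 : ∀ x, ENNReal.ofReal (Real.exp (-(A + x)) * u w) =
          ENNReal.ofReal (Real.exp (-A) * u w) * ENNReal.ofReal (Real.exp (-(1 * x))) := by
        intro x
        rw [← ENNReal.ofReal_mul (mul_nonneg (Real.exp_pos _).le (hu0 w)), neg_add, Real.exp_add,
          one_mul]
        ring_nf
      simp only [h2]
      rw [lintegral_const_mul' _ _ ENNReal.ofReal_ne_top,
        lintegral_exp_neg_mul hq (by linarith), ← ENNReal.ofReal_mul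
          (mul_nonneg (Real.exp_pos _).le (hu0 w))]
    · simp [hv]
  simp only [h1]
  rw [← ENNReal.ofReal_mul hr]
  have h3 : ∀ w, ENNReal.ofReal (p v w) * ENNReal.ofReal (Real.exp (-A) * u w *
      (if v = v₀ then q v / (q v + 1) else 1)) = ENNReal.ofReal (p v w * (Real.exp (-A) * u w *
      (if v = v₀ then q v / (q v + 1) else 1))) := fun w =>
    (ENNReal.ofReal_mul (hJ.prob_nonneg v w)).symm
  have hκ : 0 ≤ (if v = v₀ then q v / (q v + 1) else 1) := by
    have := hJ.rate_pos v
    split_ifs <;> positivity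
  simp only [h3]
  rw [← ENNReal.ofReal_sum_of_nonneg fun w _ => mul_nonneg (hJ.prob_nonneg v w)
    (mul_nonneg (mul_nonneg (Real.exp_pos _).le (hu0 w)) hκ)]
  refine ENNReal.ofReal_le_ofReal ?_
  have h4 : ∑ w, p v w * (Real.exp (-A) * u w * (if v = v₀ then q v / (q v + 1) else 1)) =
      Real.exp (-A) * ((if v = v₀ then q v / (q v + 1) else 1) * ∑ w, p v w * u w) := by
    rw [Finset.mul_sum, Finset.mul_sum]
    exact Finset.sum_congr rfl fun w _ => by ring
  rw [h4]
  calc _ ≤ Real.exp (-A) * (r * u v) := mul_le_mul_of_nonneg_left (hu v) (Real.exp_pos _).le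
    _ = _ := by ring

open Classical in
/-- The Foster–Lyapunov criterion: the time spent at `v₀` grows without bound. -/
theorem tendsto_measure_clock_le (hJ : IsJumpChain P v₀ p q Y H) {u : V → ℝ} (hu1 : ∀ v, 1 ≤ u v)
    (hu : ∀ v, (if v = v₀ then q v / (q v + 1) else 1) * ∑ w, p v w * u w < u v) (t : ℝ) :
    Tendsto (fun m => P {ω | clock v₀ Y H m ω ≤ t}) atTop (𝓝 0) := by
  have hu0 : ∀ v, 0 < u v := fun v => zero_lt_one.trans_le (hu1 v)
  obtain ⟨v₁, -, hv₁⟩ := Finset.exists_max_image Finset.univ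
    (fun v => ((if v = v₀ then q v / (q v + 1) else 1) * ∑ w, p v w * u w) / u v)
    ⟨v₀, Finset.mem_univ _⟩
  set r := ((if v₁ = v₀ then q v₁ / (q v₁ + 1) else 1) * ∑ w, p v₁ w * u w) / u v₁ with hrdef
  have hr1 : r < 1 := (div_lt_one (hu0 v₁)).2 (hu v₁)
  have hr0 : 0 ≤ r := by
    have := hJ.rate_pos v₁
    refine div_nonneg (mul_nonneg (by split_ifs <;> positivity) (Finset.sum_nonneg fun w _ =>
      mul_nonneg (hJ.prob_nonneg _ _) (hu0 w).le)) (hu0 _).le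
  have hur : ∀ v, (if v = v₀ then q v / (q v + 1) else 1) * ∑ w, p v w * u w ≤ r * u v :=
    fun v => (div_le_iff₀ (hu0 v)).1 (hv₁ v (Finset.mem_univ v))
  have hE : ∀ m, ∫⁻ ω, ENNReal.ofReal (Real.exp (-clock v₀ Y H m ω) * u (Y m ω)) ∂P ≤
      ENNReal.ofReal r ^ m * ENNReal.ofReal (u v₀) := by
    intro m
    induction m with
    | zero =>
      rw [pow_zero, one_mul]
      refine le_of_eq ?_
      have h : ∀ᵐ ω ∂P, ENNReal.ofReal (Real.exp (-clock v₀ Y H 0 ω) * u (Y 0 ω)) =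
          ENNReal.ofReal (u v₀) := by
        filter_upwards [hJ.ae_chain_zero] with ω hω
        simp [clock, hω]
      rw [lintegral_congr_ae h]
      simp
    | succ m ih =>
      refine (hJ.lintegral_exp_clock_step hu1 hr0 hur m).trans ?_
      rw [pow_succ', mul_assoc]
      gcongr
  have hP : ∀ m, P {ω | clock v₀ Y H m ω ≤ t} ≤
      ENNReal.ofReal (Real.exp t) * (ENNReal.ofReal r ^ m * ENNReal.ofReal (u v₀)) := by
    intro m
    have hms : MeasurableSet {ω | clock v₀ Y H m ω ≤ t} :=
      measurableSet_le (hJ.measurable_clock m) measurable_const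
    rw [← lintegral_indicator_one hms]
    refine le_trans ?_ (mul_le_mul_right (hE m) _)
    rw [← lintegral_const_mul' _ _ ENNReal.ofReal_ne_top]
    refine lintegral_mono fun ω => ?_
    by_cases h : clock v₀ Y H m ω ≤ t
    · rw [indicator_of_mem (show ω ∈ {ω | clock v₀ Y H m ω ≤ t} from h), Pi.one_apply,
        ← ENNReal.ofReal_mul (Real.exp_pos _).le, ← ENNReal.ofReal_one]
      refine ENNReal.ofReal_le_ofReal ?_
      rw [← mul_assoc, ← Real.exp_add]
      have h1 : 1 ≤ Real.exp (t + -clock v₀ Y H m ω) := Real.one_le_exp (by linarith)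
      nlinarith [hu1 (Y m ω)]
    · rw [indicator_of_notMem (show ω ∉ {ω | clock v₀ Y H m ω ≤ t} from h)]
      exact bot_le
  refine tendsto_of_tendsto_of_tendsto_of_le_of_le tendsto_const_nhds ?_ (fun _ => bot_le) hP
  have h1 : Tendsto (fun m => ENNReal.ofReal r ^ m) atTop (𝓝 0) :=
    ENNReal.tendsto_pow_atTop_nhds_zero_of_lt_one (by
      rw [← ENNReal.ofReal_one]; exact (ENNReal.ofReal_lt_ofReal_iff one_pos).2 hr1)
  have h2 := ENNReal.Tendsto.mul_const (b := ENNReal.ofReal (u v₀)) h1 (Or.inr ENNReal.ofReal_ne_top)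
  have h3 := ENNReal.Tendsto.const_mul (a := ENNReal.ofReal (Real.exp t)) h2
    (Or.inr ENNReal.ofReal_ne_top)
  simpa using h3

section FeynmanKac

variable {S : Set V} {a u : V → ℝ} {c t : ℝ}

open Classical in
/-- The one-step operator of the Feynman–Kac martingale, from state `v` with clock `A` and
weight `W`. -/
def fkStep (v₀ : V) (S : Set V) (a u : V → ℝ) (c t : ℝ) (v w : V) (z : (ℝ × ENNReal) × ℝ) :
    ENNReal :=
  (if z.1.1 + (if v = v₀ then z.2 else 0) ≤ t then z.1.2 * stayWeight S a v z.2 *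
      ENNReal.ofReal (Real.exp (c * (z.1.1 + if v = v₀ then z.2 else 0)) * u w) else 0) +
    if z.1.1 ≤ t ∧ t < z.1.1 + (if v = v₀ then z.2 else 0) then
      z.1.2 * ENNReal.ofReal (Real.exp (c * t)) else 0

theorem measurable_fkStep (v w : V) : Measurable (fkStep v₀ S a u c t v w) := by
  classical
  unfold fkStep
  have h1 : Measurable fun z : (ℝ × ENNReal) × ℝ => z.1.1 + (if v = v₀ then z.2 else 0) := by
    split_ifs <;> fun_prop
  have h2 : Measurable fun z : (ℝ × ENNReal) × ℝ => stayWeight S a v z.2 :=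
    (measurable_stayWeight S a v).comp measurable_snd
  have h3 : MeasurableSet {z : (ℝ × ENNReal) × ℝ |
      z.1.1 ≤ t ∧ t < z.1.1 + (if v = v₀ then z.2 else 0)} :=
    (measurableSet_le (measurable_fst.comp measurable_fst) measurable_const).inter
      (measurableSet_lt measurable_const h1)
  refine Measurable.add (Measurable.ite (measurableSet_le h1 measurable_const) ?_
    measurable_const) (Measurable.ite h3 (by fun_prop) measurable_const)
  refine Measurable.mul (Measurable.mul (by fun_prop) h2) ?_
  exact ((Real.measurable_exp.comp (h1.const_mul c)).mul_const _).ennreal_ofReal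

/-- Once the clock has passed `t`, the Feynman–Kac martingale is stopped. -/
theorem sum_fkStep_of_gt (v : V) {A : ℝ} (W : ENNReal)
    (hA : t < A) :
    ∑ w, ENNReal.ofReal (p v w) * ∫⁻ x, fkStep v₀ S a u c t v w ((A, W), x)
      ∂(expMeasure (q v)) = 0 := by
  classical
  refine Finset.sum_eq_zero fun w _ => ?_
  rw [lintegral_congr_ae (g := fun _ => 0), lintegral_zero, mul_zero]
  filter_upwards [ae_expMeasure_nonneg] with x hx
  have h1 : ¬ A + (if v = v₀ then x else 0) ≤ t := by
    split_ifs <;> linarith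
  have h2 : ¬ A ≤ t := not_le.2 hA
  simp [fkStep, h1, h2]

open Classical in
/-- The mean of one step of the Feynman–Kac martingale from a state other than `v₀`, where the clock
does not move. -/
theorem sum_fkStep_of_ne (hJ : IsJumpChain P v₀ p q Y H) (hu : ∀ v, 0 ≤ u v)
    (ha : ∀ v, 0 < q v + a v) {v : V} (hv : v ≠ v₀) {A : ℝ} (W : ENNReal) (hA : A ≤ t) :
    ∑ w, ENNReal.ofReal (p v w) * ∫⁻ x, fkStep v₀ S a u c t v w ((A, W), x)
      ∂(expMeasure (q v)) = W * ENNReal.ofReal (Real.exp (c * A) *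
        if v ∈ S then 0 else q v / (q v + a v) * ∑ w, p v w * u w) := by
  have hq := hJ.rate_pos v
  have h1 : ∀ w, ∫⁻ x, fkStep v₀ S a u c t v w ((A, W), x) ∂(expMeasure (q v)) =
      W * ENNReal.ofReal (Real.exp (c * A) * u w *
        if v ∈ S then 0 else q v / (q v + a v)) := by
    intro w
    have h2 : ∀ x, fkStep v₀ S a u c t v w ((A, W), x) =
        W * ENNReal.ofReal (Real.exp (c * A) * u w) * stayWeight S a v x := by
      intro x
      have h3 : ¬ (A ≤ t ∧ t < A) := fun h => absurd h.1 (not_le.2 h.2)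
      simp only [fkStep, hv, if_false, add_zero, if_pos hA, if_neg h3]
      ring
    simp only [h2]
    rw [lintegral_const_mul _ (measurable_stayWeight S a v),
      ENNReal.ofReal_mul (mul_nonneg (Real.exp_pos _).le (hu w)), mul_assoc W]
    congr 2
    by_cases hS : v ∈ S
    · simp [stayWeight, hS]
    · simp only [stayWeight, hS, if_false]
      exact lintegral_exp_neg_mul hq (ha v)
  have hκ : 0 ≤ if v ∈ S then 0 else q v / (q v + a v) := by
    have := ha v
    split_ifs <;> positivity
  have h4 : ∀ w, ENNReal.ofReal (p v w) * (W * ENNReal.ofReal (Real.exp (c * A) * u w *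
        if v ∈ S then 0 else q v / (q v + a v))) = W * ENNReal.ofReal (p v w *
        (Real.exp (c * A) * u w * if v ∈ S then 0 else q v / (q v + a v))) := by
    intro w
    rw [ENNReal.ofReal_mul (hJ.prob_nonneg v w)]
    ring
  simp only [h1, h4]
  rw [← Finset.mul_sum, ← ENNReal.ofReal_sum_of_nonneg fun w _ => mul_nonneg
    (hJ.prob_nonneg v w) (mul_nonneg (mul_nonneg (Real.exp_pos _).le (hu w)) hκ)]
  congr 2
  by_cases hS : v ∈ S
  · simp [hS]
  · simp only [hS, if_false, Finset.mul_sum]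
    exact Finset.sum_congr rfl fun w _ => by ring

/-- From `v₀` the Feynman–Kac martingale is preserved in mean: the growth `exp (c * clock)`, stopped
at `t`, compensates the loss in `u`. -/
theorem sum_fkStep_self (hJ : IsJumpChain P v₀ p q Y H) (hu : ∀ v, 0 ≤ u v) (hS : v₀ ∉ S)
    (ha0 : a v₀ = 0) (hc : ∑ w, p v₀ w * u w = 1 - c / q v₀) {A : ℝ} (W : ENNReal) (hA : A ≤ t) :
    ∑ w, ENNReal.ofReal (p v₀ w) * ∫⁻ x, fkStep v₀ S a u c t v₀ w ((A, W), x)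
      ∂(expMeasure (q v₀)) = W * ENNReal.ofReal (Real.exp (c * A)) := by
  have hq := hJ.rate_pos v₀
  have := isProbabilityMeasure_expMeasure hq
  have hcq : c ≤ q v₀ := by
    have h : 0 ≤ 1 - c / q v₀ := by
      rw [← hc]
      exact Finset.sum_nonneg fun w _ => mul_nonneg (hJ.prob_nonneg _ _) (hu w)
    rw [sub_nonneg, div_le_one hq] at h
    exact h
  have hmI : Measurable (indicator (Iic (t - A)) fun x => ENNReal.ofReal (Real.exp (c * x))) :=
    (by fun_prop : Measurable fun x : ℝ => ENNReal.ofReal (Real.exp (c * x))).indicator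
      measurableSet_Iic
  have h1 : ∀ w, ∫⁻ x, fkStep v₀ S a u c t v₀ w ((A, W), x) ∂(expMeasure (q v₀)) =
      W * ENNReal.ofReal (Real.exp (c * A)) * (ENNReal.ofReal (u w) *
        (∫⁻ x, indicator (Iic (t - A)) (fun x => ENNReal.ofReal (Real.exp (c * x))) x
          ∂(expMeasure (q v₀))) +
        ENNReal.ofReal (Real.exp (c * (t - A))) * expMeasure (q v₀) (Ioi (t - A))) := by
    intro w
    have h2 : ∀ x, fkStep v₀ S a u c t v₀ w ((A, W), x) =
        W * ENNReal.ofReal (Real.exp (c * A)) * (ENNReal.ofReal (u w) *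
        indicator (Iic (t - A)) (fun x => ENNReal.ofReal (Real.exp (c * x))) x +
        ENNReal.ofReal (Real.exp (c * (t - A))) * indicator (Ioi (t - A)) 1 x) := by
      intro x
      have hw : stayWeight S a v₀ x = 1 := by simp [stayWeight, hS, ha0]
      by_cases hx : A + x ≤ t
      · have h3 : ¬ t < A + x := not_lt.2 hx
        rw [indicator_of_mem (show x ∈ Iic (t - A) by simp; linarith),
          indicator_of_notMem (show x ∉ Ioi (t - A) by simp; linarith)]
        simp only [fkStep, if_true, if_pos hx, h3, and_false, if_false, add_zero, hw, mul_one,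
          mul_zero]
        rw [mul_add c, Real.exp_add, ENNReal.ofReal_mul (by positivity),
          ENNReal.ofReal_mul (by positivity)]
        ring
      · have h3 : t < A + x := not_le.1 hx
        rw [indicator_of_notMem (show x ∉ Iic (t - A) by simp; linarith),
          indicator_of_mem (show x ∈ Ioi (t - A) by simp; linarith)]
        simp only [fkStep, if_true, if_neg hx, h3, hA, and_self, mul_one,
          mul_zero, zero_add, Pi.one_apply]
        rw [mul_assoc, ← ENNReal.ofReal_mul (by positivity), ← Real.exp_add]
        ring_nf
    simp only [h2]
    rw [lintegral_const_mul _ (by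
        exact (hmI.const_mul _).add ((measurable_one.indicator measurableSet_Ioi).const_mul _)),
      lintegral_add_left (hmI.const_mul _), lintegral_const_mul _ hmI,
      lintegral_const_mul _ (measurable_one.indicator measurableSet_Ioi),
      lintegral_indicator_one measurableSet_Ioi]
  simp only [h1]
  have h5 := lintegral_exp_stopped hq hcq (sub_nonneg.2 hA)
  rw [← hc, ENNReal.ofReal_sum_of_nonneg fun w _ => mul_nonneg (hJ.prob_nonneg _ _) (hu w)] at h5
  generalize (∫⁻ x, indicator (Iic (t - A)) (fun x => ENNReal.ofReal (Real.exp (c * x))) x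
          ∂(expMeasure (q v₀))) = I at h5 ⊢
  generalize ENNReal.ofReal (Real.exp (c * (t - A))) * expMeasure (q v₀) (Ioi (t - A)) = J at h5 ⊢
  have h6 : ∑ w, ENNReal.ofReal (p v₀ w) = 1 := by
    rw [← ENNReal.ofReal_sum_of_nonneg fun w _ => hJ.prob_nonneg _ _, hJ.prob_sum,
      ENNReal.ofReal_one]
  calc _ = W * ENNReal.ofReal (Real.exp (c * A)) *
        ((∑ w, ENNReal.ofReal (p v₀ w * u w)) * I + (∑ w, ENNReal.ofReal (p v₀ w)) * J) := by
        rw [Finset.sum_mul, Finset.sum_mul, ← Finset.sum_add_distrib, Finset.mul_sum]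
        refine Finset.sum_congr rfl fun w _ => ?_
        rw [ENNReal.ofReal_mul (hJ.prob_nonneg _ _)]
        ring
    _ = _ := by rw [h6, one_mul, h5, mul_one]

open Classical in
/-- The value of the Feynman–Kac martingale at step `m`, while the clock is at most `t`. -/
def fkAlive (v₀ : V) (S : Set V) (a u : V → ℝ) (c t : ℝ) (Y : ℕ → Ω → V) (H : ℕ → Ω → ℝ) (m : ℕ)
    (ω : Ω) : ENNReal :=
  if clock v₀ Y H m ω ≤ t then
    pathWeight S a Y H m ω * ENNReal.ofReal (Real.exp (c * clock v₀ Y H m ω) * u (Y m ω)) else 0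

open Classical in
/-- The value at which the Feynman–Kac martingale is stopped, if this happens during step `m`. -/
def fkStopped (v₀ : V) (S : Set V) (a : V → ℝ) (c t : ℝ) (Y : ℕ → Ω → V) (H : ℕ → Ω → ℝ) (m : ℕ)
    (ω : Ω) : ENNReal :=
  if clock v₀ Y H m ω ≤ t ∧ t < clock v₀ Y H (m + 1) ω then
    pathWeight S a Y H m ω * ENNReal.ofReal (Real.exp (c * t)) else 0

theorem measurable_fkAlive (hJ : IsJumpChain P v₀ p q Y H) (m : ℕ) :
    Measurable (fkAlive v₀ S a u c t Y H m) := by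
  have h : Measurable u := measurable_of_countable u
  refine Measurable.ite (measurableSet_le (hJ.measurable_clock m) measurable_const) ?_
    measurable_const
  exact (hJ.measurable_pathWeight S a m).mul
    (((Real.measurable_exp.comp ((hJ.measurable_clock m).const_mul c)).mul
      (h.comp (hJ.measurable_chain m))).ennreal_ofReal)

theorem measurable_fkStopped (hJ : IsJumpChain P v₀ p q Y H) (m : ℕ) :
    Measurable (fkStopped v₀ S a c t Y H m) :=
  Measurable.ite ((measurableSet_le (hJ.measurable_clock m) measurable_const).inter
    (measurableSet_lt measurable_const (hJ.measurable_clock (m + 1))))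
    ((hJ.measurable_pathWeight S a m).mul_const _) measurable_const

theorem lintegral_fk_succ (hJ : IsJumpChain P v₀ p q Y H) (m : ℕ) :
    ∫⁻ ω, fkAlive v₀ S a u c t Y H (m + 1) ω ∂P + ∫⁻ ω, fkStopped v₀ S a c t Y H m ω ∂P =
      ∫⁻ ω, ∑ w, ENNReal.ofReal (p (Y m ω) w) *
        ∫⁻ x, fkStep v₀ S a u c t (Y m ω) w ((clock v₀ Y H m ω, pathWeight S a Y H m ω), x)
          ∂(expMeasure (q (Y m ω))) ∂P := by
  classical
  rw [← lintegral_add_left (hJ.measurable_fkAlive _), ← hJ.lintegral_step m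
    (R := fun ω => (clock v₀ Y H m ω, pathWeight S a Y H m ω))
    (ρ := fun v h => (∑ i : Fin m, if v i.castSucc = v₀ then h i else 0,
      ∏ i : Fin m, stayWeight S a (v i.castSucc) (h i)))
    (fun v => (Finset.measurable_fun_sum _ fun i _ => by split_ifs <;> fun_prop).prodMk
      (Finset.measurable_fun_prod _ fun i _ =>
        (measurable_stayWeight S a _).comp (measurable_pi_apply i)))
    (fun ω => by simp [clock, pathWeight, Finset.sum_range, Finset.prod_range])
    (G := fkStep v₀ S a u c t) measurable_fkStep]
  refine lintegral_congr fun ω => ?_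
  simp only [fkAlive, fkStopped, fkStep, clock_succ]
  congr 2
  rw [pathWeight, Finset.prod_range_succ]
  rfl

theorem lintegral_fkAlive_zero (hJ : IsJumpChain P v₀ p q Y H) (hu0 : u v₀ = 1) (ht : 0 ≤ t) :
    ∫⁻ ω, fkAlive v₀ S a u c t Y H 0 ω ∂P = 1 := by
  rw [lintegral_congr_ae (g := fun _ => 1)]
  · simp
  · filter_upwards [hJ.ae_chain_zero] with ω hω
    simp [fkAlive, clock, pathWeight, hω, hu0, ht]

/-- Summed over the steps, the stopped values give the weight at the inverse local time. -/
theorem tsum_lintegral_fkStopped (hJ : IsJumpChain P v₀ p q Y H) (ht : 0 ≤ t)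
    (hrec : ∀ t : ℝ, Tendsto (fun m => P {ω | clock v₀ Y H m ω ≤ t}) atTop (𝓝 0)) :
    ∑' m, ∫⁻ ω, fkStopped v₀ S a c t Y H m ω ∂P =
      (∫⁻ ω, pathWeight S a Y H (crossIndex v₀ Y H t ω) ω ∂P) *
        ENNReal.ofReal (Real.exp (c * t)) := by
  rw [← lintegral_tsum fun m => (hJ.measurable_fkStopped m).aemeasurable,
    ← lintegral_mul_const' _ _ ENNReal.ofReal_ne_top]
  refine lintegral_congr_ae ?_
  filter_upwards [hJ.ae_time_pos, ae_exists_lt_clock hrec] with ω h1 h2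
  rw [tsum_eq_single (crossIndex v₀ Y H t ω)]
  · rw [fkStopped, if_pos (crossIndex_spec ht h1 (h2 t))]
  · intro m hm
    rw [fkStopped, if_neg]
    exact fun h => hm (eq_crossIndex h1 h.1 h.2).symm

open Classical in
/-- Feynman–Kac upper bound, from a supersolution `u`. -/
theorem lintegral_pathWeight_le (hJ : IsJumpChain P v₀ p q Y H) (ht : 0 ≤ t)
    (hrec : ∀ t : ℝ, Tendsto (fun m => P {ω | clock v₀ Y H m ω ≤ t}) atTop (𝓝 0))
    (hu : ∀ v, 0 ≤ u v) (hu0 : u v₀ = 1) (hS : v₀ ∉ S) (ha : ∀ v, 0 < q v + a v) (ha0 : a v₀ = 0)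
    (hc : ∑ w, p v₀ w * u w = 1 - c / q v₀)
    (hsup : ∀ v ∉ S, v ≠ v₀ → q v / (q v + a v) * ∑ w, p v w * u w ≤ u v) :
    ∫⁻ ω, pathWeight S a Y H (crossIndex v₀ Y H t ω) ω ∂P ≤
      ENNReal.ofReal (Real.exp (-(c * t))) := by
  have hstep : ∀ m, ∫⁻ ω, fkAlive v₀ S a u c t Y H (m + 1) ω ∂P +
      ∫⁻ ω, fkStopped v₀ S a c t Y H m ω ∂P ≤ ∫⁻ ω, fkAlive v₀ S a u c t Y H m ω ∂P := by
    intro m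
    rw [hJ.lintegral_fk_succ]
    refine lintegral_mono fun ω => ?_
    simp only [fkAlive]
    generalize clock v₀ Y H m ω = A
    generalize pathWeight S a Y H m ω = W
    generalize Y m ω = v
    by_cases hA : A ≤ t
    · rw [if_pos hA]
      by_cases hv : v = v₀
      · subst hv
        rw [hJ.sum_fkStep_self hu hS ha0 hc W hA, hu0, mul_one]
      · rw [hJ.sum_fkStep_of_ne hu ha hv W hA]
        gcongr
        by_cases hvS : v ∈ S
        · simp [hvS, hu v]
        · simpa [hvS] using hsup v hvS hv
    · rw [sum_fkStep_of_gt v W (not_le.1 hA)]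
      exact bot_le
  have hsum : ∀ M, ∫⁻ ω, fkAlive v₀ S a u c t Y H M ω ∂P +
      ∑ m ∈ Finset.range M, ∫⁻ ω, fkStopped v₀ S a c t Y H m ω ∂P ≤ 1 := by
    intro M
    induction M with
    | zero => rw [hJ.lintegral_fkAlive_zero hu0 ht]; simp
    | succ M ih =>
      refine le_trans ?_ ih
      rw [Finset.sum_range_succ, ← add_assoc, add_right_comm]
      gcongr
      exact hstep M
  have htot : ∑' m, ∫⁻ ω, fkStopped v₀ S a c t Y H m ω ∂P ≤ 1 := by
    rw [ENNReal.tsum_eq_iSup_nat]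
    exact iSup_le fun M => le_add_self.trans (hsum M)
  rw [hJ.tsum_lintegral_fkStopped ht hrec] at htot
  rw [Real.exp_neg, ENNReal.ofReal_inv_of_pos (Real.exp_pos _)]
  exact ENNReal.le_inv_iff_mul_le.2 htot

open Classical in
/-- Feynman–Kac lower bound, from a subsolution `u`. -/
theorem le_lintegral_pathWeight (hJ : IsJumpChain P v₀ p q Y H) (ht : 0 ≤ t)
    (hrec : ∀ t : ℝ, Tendsto (fun m => P {ω | clock v₀ Y H m ω ≤ t}) atTop (𝓝 0))
    (hu : ∀ v, 0 ≤ u v) (hu0 : u v₀ = 1) (hS : v₀ ∉ S) (ha : ∀ v, 0 ≤ a v) (ha0 : a v₀ = 0)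
    (hc0 : 0 ≤ c) (hc : ∑ w, p v₀ w * u w = 1 - c / q v₀) (huS : ∀ v ∈ S, u v = 0)
    (hsub : ∀ v ∉ S, v ≠ v₀ → u v ≤ q v / (q v + a v) * ∑ w, p v w * u w) :
    ENNReal.ofReal (Real.exp (-(c * t))) ≤
      ∫⁻ ω, pathWeight S a Y H (crossIndex v₀ Y H t ω) ω ∂P := by
  have hstep : ∀ m, ∫⁻ ω, fkAlive v₀ S a u c t Y H m ω ∂P ≤
      ∫⁻ ω, fkAlive v₀ S a u c t Y H (m + 1) ω ∂P +
      ∫⁻ ω, fkStopped v₀ S a c t Y H m ω ∂P := by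
    intro m
    rw [hJ.lintegral_fk_succ]
    refine lintegral_mono fun ω => ?_
    simp only [fkAlive]
    generalize clock v₀ Y H m ω = A
    generalize pathWeight S a Y H m ω = W
    generalize Y m ω = v
    by_cases hA : A ≤ t
    · rw [if_pos hA]
      by_cases hv : v = v₀
      · subst hv
        rw [hJ.sum_fkStep_self hu hS ha0 hc W hA, hu0, mul_one]
      · rw [hJ.sum_fkStep_of_ne hu (fun v => add_pos_of_pos_of_nonneg (hJ.rate_pos v) (ha v))
          hv W hA]
        gcongr
        by_cases hvS : v ∈ S
        · simp [hvS, huS v hvS]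
        · simpa [hvS] using hsub v hvS hv
    · rw [if_neg hA]
      exact bot_le
  have hsum : ∀ M, 1 ≤ ∫⁻ ω, fkAlive v₀ S a u c t Y H M ω ∂P +
      ∑ m ∈ Finset.range M, ∫⁻ ω, fkStopped v₀ S a c t Y H m ω ∂P := by
    intro M
    induction M with
    | zero => rw [hJ.lintegral_fkAlive_zero hu0 ht]; simp
    | succ M ih =>
      refine ih.trans ?_
      rw [Finset.sum_range_succ, ← add_assoc, add_right_comm]
      gcongr
      exact hstep M
  have hpw : ∀ M, ∀ᵐ ω ∂P, pathWeight S a Y H M ω ≤ 1 := by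
    intro M
    filter_upwards [hJ.ae_time_pos] with ω hω
    refine Finset.prod_le_one (fun _ _ => bot_le) fun i _ => ?_
    unfold stayWeight
    split_ifs
    · exact zero_le_one
    · rw [← ENNReal.ofReal_one]
      refine ENNReal.ofReal_le_ofReal (Real.exp_le_one_iff.2 ?_)
      rw [neg_nonpos]
      exact mul_nonneg (ha _) (hω i).le
  have halive : ∀ M, ∫⁻ ω, fkAlive v₀ S a u c t Y H M ω ∂P ≤
      ENNReal.ofReal (Real.exp (c * t) * ∑ v, u v) * P {ω | clock v₀ Y H M ω ≤ t} := by
    intro M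
    have hms : MeasurableSet {ω | clock v₀ Y H M ω ≤ t} :=
      measurableSet_le (hJ.measurable_clock M) measurable_const
    rw [← lintegral_indicator_const hms]
    refine lintegral_mono_ae ?_
    filter_upwards [hpw M] with ω hω
    by_cases h : clock v₀ Y H M ω ≤ t
    · rw [fkAlive, if_pos h, indicator_of_mem (show ω ∈ {ω | clock v₀ Y H M ω ≤ t} from h)]
      calc _ ≤ 1 * ENNReal.ofReal (Real.exp (c * t) * ∑ v, u v) := by
            gcongr
            · exact hu _
            · exact Finset.single_le_sum (fun v _ => hu v) (Finset.mem_univ (Y M ω))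
        _ = _ := one_mul _
    · rw [fkAlive, if_neg h]
      exact bot_le
  have hlim : Tendsto (fun M => ∫⁻ ω, fkAlive v₀ S a u c t Y H M ω ∂P) atTop (𝓝 0) := by
    refine tendsto_of_tendsto_of_tendsto_of_le_of_le tendsto_const_nhds ?_ (fun _ => bot_le) halive
    simpa using ENNReal.Tendsto.const_mul (a := ENNReal.ofReal (Real.exp (c * t) * ∑ v, u v))
      (hrec t) (Or.inr ENNReal.ofReal_ne_top)
  have htot : 1 ≤ ∑' m, ∫⁻ ω, fkStopped v₀ S a c t Y H m ω ∂P := by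
    have h := hlim.add_const (∑' m, ∫⁻ ω, fkStopped v₀ S a c t Y H m ω ∂P)
    rw [zero_add] at h
    refine ge_of_tendsto' h fun M => (hsum M).trans ?_
    gcongr
    exact ENNReal.sum_le_tsum _
  rw [hJ.tsum_lintegral_fkStopped ht hrec] at htot
  rw [Real.exp_neg, ENNReal.ofReal_inv_of_pos (Real.exp_pos _)]
  rw [ENNReal.inv_le_iff_le_mul (by simp [Real.exp_pos]) (by simp), mul_comm]
  exact htot

end FeynmanKac

end IsJumpChain

/-! ### Local times of a step trajectory -/

section Trajectory

variable {U : Set Site} {x : ℝ → WiredVertex U} {Ω : Type*} {Y : ℕ → Ω → WiredVertex U}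
  {H : ℕ → Ω → ℝ} {ω : Ω}

theorem integral_indicator_step (hx : ∀ (k : ℕ) (u : ℝ), ∑ i ∈ Finset.range k, H i ω ≤ u →
      u < ∑ i ∈ Finset.range (k + 1), H i ω → x u = Y k ω) (v : WiredVertex U)
    [DecidableEq (WiredVertex U)] {k : ℕ} {a b : ℝ}
    (ha : ∑ i ∈ Finset.range k, H i ω ≤ a) (hab : a ≤ b)
    (hb : b ≤ ∑ i ∈ Finset.range (k + 1), H i ω) :
    IntervalIntegrable (fun r => if x r = v then (1 : ℝ) else 0) volume a b ∧
      ∫ r in a..b, (if x r = v then (1 : ℝ) else 0) = if Y k ω = v then b - a else 0 := by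
  have hae : ∀ᵐ r ∂volume, r ∈ uIoc a b →
      (if Y k ω = v then (1 : ℝ) else 0) = if x r = v then (1 : ℝ) else 0 := by
    filter_upwards [(measure_singleton b : volume {b} = 0) |> measure_eq_zero_iff_ae_notMem.1]
      with r hr hmem
    rw [uIoc_of_le hab] at hmem
    rw [hx k r (ha.trans hmem.1.le) ((lt_of_le_of_ne hmem.2 hr).trans_le hb)]
  constructor
  · exact (intervalIntegrable_const (c := if Y k ω = v then (1 : ℝ) else 0)).congr_ae
      ((ae_restrict_iff' measurableSet_uIoc).2 hae)
  · rw [← intervalIntegral.integral_congr_ae hae, intervalIntegral.integral_const]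
    split_ifs <;> simp

open Classical in
theorem localTime_eq (hH : ∀ k, 0 < H k ω)
    (hx : ∀ (k : ℕ) (u : ℝ), ∑ i ∈ Finset.range k, H i ω ≤ u →
      u < ∑ i ∈ Finset.range (k + 1), H i ω → x u = Y k ω) (v : WiredVertex U) {k : ℕ} {u : ℝ}
    (hu : ∑ i ∈ Finset.range k, H i ω ≤ u) (hu' : u ≤ ∑ i ∈ Finset.range (k + 1), H i ω) :
    IntervalIntegrable (fun r => if x r = v then (1 : ℝ) else 0) volume 0 u ∧
      localTime x u v = clock v Y H k ω +
        if Y k ω = v then u - ∑ i ∈ Finset.range k, H i ω else 0 := by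
  have hk : ∀ k, IntervalIntegrable (fun r => if x r = v then (1 : ℝ) else 0) volume 0
      (∑ i ∈ Finset.range k, H i ω) ∧
      ∫ r in (0 : ℝ)..∑ i ∈ Finset.range k, H i ω, (if x r = v then (1 : ℝ) else 0) =
        clock v Y H k ω := by
    intro k
    induction k with
    | zero => simp [clock]
    | succ k ih =>
      have hle : ∑ i ∈ Finset.range k, H i ω ≤ ∑ i ∈ Finset.range (k + 1), H i ω := by
        rw [Finset.sum_range_succ]; linarith [hH k]
      have h := integral_indicator_step hx v le_rfl hle le_rfl
      refine ⟨ih.1.trans h.1, ?_⟩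
      rw [← intervalIntegral.integral_add_adjacent_intervals ih.1 h.1, ih.2, h.2, clock_succ,
        Finset.sum_range_succ, add_sub_cancel_left]
      congr
  have h := integral_indicator_step hx v le_rfl hu hu'
  refine ⟨(hk k).1.trans h.1, ?_⟩
  rw [localTime, ← intervalIntegral.integral_add_adjacent_intervals (hk k).1 h.1, (hk k).2, h.2]

/-- The local time at a site by `∂`-time `t` is the total duration of the stays at that site before
the step during which the clock at `∂` passes `t`. -/
theorem boundaryLocalTime_eq (hH : ∀ k, 0 < H k ω)
    (hx : ∀ (k : ℕ) (u : ℝ), ∑ i ∈ Finset.range k, H i ω ≤ u →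
      u < ∑ i ∈ Finset.range (k + 1), H i ω → x u = Y k ω) {t : ℝ} (ht : 0 ≤ t)
    (hrec : ∃ m, t < clock none Y H m ω) (v : WiredVertex U) (hv : v ≠ none) :
    boundaryLocalTime x t v = clock v Y H (crossIndex none Y H t ω) ω := by
  classical
  obtain ⟨h1, h2⟩ := crossIndex_spec ht hH hrec
  set K := crossIndex none Y H t ω with hK
  have hYK : Y K ω = none := by
    by_contra h
    rw [clock_succ, if_neg h] at h2
    linarith
  rw [clock_succ, if_pos hYK] at h2
  set S := ∑ i ∈ Finset.range K, H i ω with hS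
  have hS' : ∑ i ∈ Finset.range (K + 1), H i ω = S + H K ω := Finset.sum_range_succ _ _
  have hS0 : 0 ≤ S := Finset.sum_nonneg fun i _ => (hH i).le
  set A := clock none Y H K ω with hA
  have hloc : ∀ u, S ≤ u → u ≤ S + H K ω → localTime x u none = A + (u - S) := by
    intro u hu hu'
    rw [(localTime_eq hH hx none hu (hS' ▸ hu')).2, if_pos hYK]
  have hτ : inverseLocalTime x t = S + (t - A) := by
    refine csInf_eq_of_forall_ge_of_forall_gt_exists_lt
      ⟨S + H K ω, add_nonneg hS0 (hH K).le, ?_⟩ ?_ ?_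
    · rw [hloc _ (by linarith [hH K]) le_rfl]; linarith
    · rintro u ⟨hu0, hu⟩
      by_contra hlt
      push Not at hlt
      -- the local time at `∂` is monotone and equals `t` at time `S + (t - A)`
      have hτt := hloc (S + (t - A)) (by linarith) (by linarith)
      have hint := (localTime_eq hH hx none (k := K) (u := S + (t - A)) (by linarith)
        (by rw [hS']; linarith)).1
      have hint1 : IntervalIntegrable (fun r => if x r = none then (1 : ℝ) else 0) volume 0 u :=
        hint.mono_set (by
          rw [uIcc_of_le hu0, uIcc_of_le (by linarith)]; exact Icc_subset_Icc le_rfl hlt.le)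
      have hint2 : IntervalIntegrable (fun r => if x r = none then (1 : ℝ) else 0) volume u
          (S + (t - A)) :=
        hint.mono_set (by
          rw [uIcc_of_le hlt.le, uIcc_of_le (by linarith)]; exact Icc_subset_Icc hu0 le_rfl)
      have hadd := intervalIntegral.integral_add_adjacent_intervals hint1 hint2
      have hnn : 0 ≤ ∫ r in u..(S + (t - A)), (if x r = none then (1 : ℝ) else 0) :=
        intervalIntegral.integral_nonneg hlt.le fun r _ => by split_ifs <;> norm_num
      have h3 : ∫ r in (0 : ℝ)..u, (if x r = none then (1 : ℝ) else 0) = localTime x u none := rfl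
      have h4 : ∫ r in (0 : ℝ)..(S + (t - A)), (if x r = none then (1 : ℝ) else 0) =
          localTime x (S + (t - A)) none := rfl
      rw [h3, h4, hτt] at hadd
      linarith
    · intro w hw
      have h3 : S + (t - A) < min ((S + (t - A) + w) / 2) (S + H K ω) :=
        lt_min (by linarith) (by linarith)
      refine ⟨min ((S + (t - A) + w) / 2) (S + H K ω), ⟨by linarith, ?_⟩, ?_⟩
      · rw [hloc _ (by linarith) (min_le_right _ _)]
        linarith
      · exact (min_le_left _ _).trans_lt (by linarith)
  rw [boundaryLocalTime, hτ, (localTime_eq hH hx v (k := K) (by linarith)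
    (by rw [hS']; linarith)).2, if_neg (by rw [hYK]; exact hv.symm), add_zero]

end Trajectory

/-! ### The wired walk as a jump chain -/

section Wired

variable {F : Finset Site}

/-- The number of lattice edges from `x` to the complement of `F`. -/
def exitDegree (F : Finset Site) (x : Site) : ℕ := ((nbrs x).filter (· ∉ F)).card

theorem ncard_exit (x : Site) :
    {y : Site | LatticeAdj x y ∧ y ∉ (F : Set Site)}.ncard = exitDegree F x := by
  rw [exitDegree, ← Set.ncard_coe_finset]
  congr 1
  ext y
  simp [mem_nbrs]

theorem sum_wiredVertex (g : WiredVertex (F : Set Site) → ℝ) :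
    ∑ w, g w = g none + ∑ x : (F : Set Site), g (some x) := Fintype.sum_option g

/-- A function on the sites that is one off `F`, as a function on the vertices of the wired
graph. -/
def wiredLift (F : Finset Site) (f : Site → ℝ) : WiredVertex (F : Set Site) → ℝ
  | none => 1
  | some x => f x

theorem sum_edgeCount_some {f : Site → ℝ} (hf : ∀ y ∉ F, f y = 1) (x : (F : Set Site)) :
    ∑ w, (edgeCount (F : Set Site) (some x) w : ℝ) * wiredLift F f w = ∑ y ∈ nbrs x, f y := by
  classical
  rw [sum_wiredVertex]
  simp only [edgeCount, wiredLift, ncard_exit]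
  have h1 : ∑ y : (F : Set Site), ((if LatticeAdj x y then 1 else 0 : ℕ) : ℝ) * f y =
      ∑ y ∈ (nbrs x).filter (· ∈ F), f y := by
    have h2 := Finset.sum_coe_sort F fun y => ((if LatticeAdj x y then 1 else 0 : ℕ) : ℝ) * f y
    refine Eq.trans h2 ?_
    push_cast
    simp only [ite_mul, one_mul, zero_mul]
    rw [← Finset.sum_filter]
    refine Finset.sum_congr ?_ fun _ _ => rfl
    ext y
    simp [mem_nbrs, and_comm]
  rw [h1, mul_one, ← Finset.sum_filter_add_sum_filter_not (nbrs x) (· ∈ F), add_comm]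
  congr 1
  rw [Finset.sum_congr rfl fun y hy => hf y (Finset.mem_filter.1 hy).2, Finset.sum_const,
    nsmul_eq_mul, mul_one]
  rfl

theorem sum_edgeCount_none (f : Site → ℝ) :
    ∑ w, (edgeCount (F : Set Site) none w : ℝ) * wiredLift F f w =
      ∑ x ∈ F, (exitDegree F x : ℝ) * f x := by
  rw [sum_wiredVertex]
  simp only [edgeCount, wiredLift, ncard_exit, Nat.cast_zero, zero_mul, zero_add]
  exact Finset.sum_coe_sort F fun x => (exitDegree F x : ℝ) * f x

theorem wiredDegree_eq_sum (v : WiredVertex (F : Set Site)) :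
    (wiredDegree (F : Set Site) v : ℝ) =
      ∑ w, (edgeCount (F : Set Site) v w : ℝ) * wiredLift F (fun _ => 1) w := by
  rw [wiredDegree, finsum_eq_sum_of_fintype]
  push_cast
  refine Finset.sum_congr rfl fun w _ => ?_
  cases w <;> simp [wiredLift]

theorem wiredDegree_some (x : (F : Set Site)) :
    (wiredDegree (F : Set Site) (some x) : ℝ) = 4 := by
  rw [wiredDegree_eq_sum, sum_edgeCount_some fun _ _ => rfl, Finset.sum_const, card_nbrs]
  norm_num

theorem wiredDegree_none : (wiredDegree (F : Set Site) none : ℝ) =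
    ∑ x ∈ F, (exitDegree F x : ℝ) := by
  rw [wiredDegree_eq_sum, sum_edgeCount_none]
  simp

theorem wiredDegree_none_pos (hF : F.Nonempty) : (0 : ℝ) < wiredDegree (F : Set Site) none := by
  obtain ⟨y, hy⟩ := hF
  have h := sum_boundary_green hy
  rw [wiredDegree_none]
  refine (Finset.sum_nonneg fun x _ => Nat.cast_nonneg _).lt_of_ne fun h0 => ?_
  have h0' := (Finset.sum_eq_zero_iff_of_nonneg fun x _ => Nat.cast_nonneg _).1 h0.symm
  rw [Finset.sum_eq_zero fun x hx => by
    have := h0' x hx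
    rw [exitDegree] at this
    rw [this, zero_mul]] at h
  linarith [Real.pi_pos]

theorem wiredDegree_pos (hF : F.Nonempty) (v : WiredVertex (F : Set Site)) :
    (0 : ℝ) < wiredDegree (F : Set Site) v := by
  cases v with
  | none => exact wiredDegree_none_pos hF
  | some x => rw [wiredDegree_some]; norm_num

theorem sum_jumpProb_mul (v : WiredVertex (F : Set Site)) (u : WiredVertex (F : Set Site) → ℝ) :
    ∑ w, jumpProb (F : Set Site) v w * u w =
      (∑ w, (edgeCount (F : Set Site) v w : ℝ) * u w) / wiredDegree (F : Set Site) v := by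
  rw [Finset.sum_div]
  exact Finset.sum_congr rfl fun w _ => by rw [jumpProb]; ring

/-- The discrete skeleton and the holding times of the wired walk. -/
abbrev IsWiredChain (F : Finset Site) {Ω : Type*} [MeasurableSpace Ω] (P : Measure Ω)
    (Y : ℕ → Ω → WiredVertex (F : Set Site)) (H : ℕ → Ω → ℝ) : Prop :=
  letI : MeasurableSpace (WiredVertex (F : Set Site)) := ⊤
  IsJumpChain P none (jumpProb (F : Set Site))
    (fun v => 1 / (2 * Real.pi) * wiredDegree (F : Set Site) v) Y H

theorem IsWiredWalk.exists_chain (hF : F.Nonempty) {Ω : Type*} [MeasurableSpace Ω] {P : Measure Ω}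
    {X : ℝ → Ω → WiredVertex (F : Set Site)}
    (hX : IsWiredWalk (F : Set Site) (1 / (2 * Real.pi)) P X) :
    ∃ (Y : ℕ → Ω → WiredVertex (F : Set Site)) (H : ℕ → Ω → ℝ), IsWiredChain F P Y H ∧
      ∀ᵐ ω ∂P, ∀ (k : ℕ) (u : ℝ), ∑ i ∈ Finset.range k, H i ω ≤ u →
        u < ∑ i ∈ Finset.range (k + 1), H i ω → X u ω = Y k ω := by
  obtain ⟨Y, H, hY, hH, hlaw, hpath⟩ := hX
  let _ : MeasurableSpace (WiredVertex (F : Set Site)) := ⊤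
  refine ⟨Y, H, ⟨fun k => ?_, hH, fun v => ?_, fun v w => ?_, fun v => ?_,
    fun m v t ht => ?_⟩, hpath⟩
  · exact measurable_to_countable' fun v => hY k v
  · have := wiredDegree_pos hF v
    have := Real.pi_pos
    positivity
  · unfold jumpProb; positivity
  · have h1 : ∑ w, jumpProb (F : Set Site) v w =
        ∑ w, jumpProb (F : Set Site) v w * wiredLift F (fun _ => 1) w :=
      Finset.sum_congr rfl fun w _ => by cases w <;> simp [wiredLift]
    rw [h1, sum_jumpProb_mul, ← wiredDegree_eq_sum, div_self (wiredDegree_pos hF v).ne']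
  · rw [hlaw m v t ht]
    congr

/-- The clock at `∂` grows without bound; the Lyapunov function is a quadratic one. -/
theorem tendsto_measure_clock_none_le (hF : F.Nonempty) {Ω : Type*} [MeasurableSpace Ω]
    {P : Measure Ω} [IsProbabilityMeasure P] {Y : ℕ → Ω → WiredVertex (F : Set Site)}
    {H : ℕ → Ω → ℝ} (hJ : IsWiredChain F P Y H) (t : ℝ) :
    Tendsto (fun m => P {ω | clock none Y H m ω ≤ t}) atTop (𝓝 0) := by
  classical
  let _ : MeasurableSpace (WiredVertex (F : Set Site)) := ⊤
  have hJ' : IsJumpChain P none (jumpProb (F : Set Site))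
    (fun v => 1 / (2 * Real.pi) * wiredDegree (F : Set Site) v) Y H := hJ
  set M : ℝ := ∑ x ∈ F, ((|(x.1 : ℝ)| + 1) ^ 2 + (|(x.2 : ℝ)| + 1) ^ 2) with hM
  have hM0 : 0 ≤ M := Finset.sum_nonneg fun x _ => by positivity
  have hMx : ∀ x ∈ F, (|(x.1 : ℝ)| + 1) ^ 2 + (|(x.2 : ℝ)| + 1) ^ 2 ≤ M := fun x hx =>
    Finset.single_le_sum (f := fun x : Site => (|(x.1 : ℝ)| + 1) ^ 2 + (|(x.2 : ℝ)| + 1) ^ 2)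
      (fun x _ => by positivity) hx
  set q := 1 / (2 * Real.pi) * (wiredDegree (F : Set Site) none : ℝ) with hq
  have hq0 : 0 < q := hJ'.rate_pos none
  set ε : ℝ := 1 / (2 * (M + 1) * (q + 1)) with hε
  have hε0 : 0 < ε := by positivity
  set g : Site → ℝ := fun x => 1 + ε * (M - ((x.1 : ℝ) ^ 2 + (x.2 : ℝ) ^ 2)) with hg
  set f : Site → ℝ := fun x => if x ∈ F then g x else 1 with hf
  have hfout : ∀ y ∉ F, f y = 1 := fun y hy => by simp [hf, hy]
  have hgin : ∀ x ∈ F, 1 ≤ g x ∧ g x ≤ 1 + ε * M := by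
    intro x hx
    have h1 := hMx x hx
    have h2 : (x.1 : ℝ) ^ 2 + (x.2 : ℝ) ^ 2 ≤ M := by
      nlinarith [sq_abs (x.1 : ℝ), sq_abs (x.2 : ℝ), abs_nonneg (x.1 : ℝ), abs_nonneg (x.2 : ℝ)]
    have h3 : 0 ≤ (x.1 : ℝ) ^ 2 + (x.2 : ℝ) ^ 2 := by positivity
    constructor
    · have := mul_nonneg hε0.le (sub_nonneg.2 h2)
      simp only [hg]; linarith
    · have := mul_le_mul_of_nonneg_left (show M - ((x.1 : ℝ) ^ 2 + (x.2 : ℝ) ^ 2) ≤ M by linarith)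
        hε0.le
      simp only [hg]; linarith
  have hfg : ∀ x ∈ F, ∀ y ∈ nbrs x, f y ≤ g y := by
    intro x hx y hy
    by_cases hyF : y ∈ F
    · simp [hf, hyF]
    · rw [hfout y hyF]
      have h1 := hMx x hx
      have h2 : (y.1 : ℝ) ^ 2 + (y.2 : ℝ) ^ 2 ≤ M := by
        refine le_trans ?_ h1
        have e1 := sq_abs (x.1 : ℝ)
        have e2 := sq_abs (x.2 : ℝ)
        have a1 := le_abs_self (x.1 : ℝ)
        have a2 := neg_abs_le (x.1 : ℝ)
        have a3 := le_abs_self (x.2 : ℝ)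
        have a4 := neg_abs_le (x.2 : ℝ)
        simp only [nbrs, Finset.mem_insert, Finset.mem_singleton] at hy
        rcases hy with rfl | rfl | rfl | rfl <;> push_cast <;> nlinarith
      have := mul_nonneg hε0.le (sub_nonneg.2 h2)
      simp only [hg]; linarith
  refine hJ'.tendsto_measure_clock_le (u := wiredLift F f) (fun v => ?_) (fun v => ?_) t
  · cases v with
    | none => exact le_rfl
    | some x =>
      have hx : (x : Site) ∈ F := x.2
      simpa [wiredLift, hf, hx] using (hgin x hx).1
  · rw [sum_jumpProb_mul]
    cases v with
    | none =>
      rw [if_pos rfl, sum_edgeCount_none]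
      have hd := wiredDegree_none_pos hF
      have h1 : (∑ x ∈ F, (exitDegree F x : ℝ) * f x) / (wiredDegree (F : Set Site) none : ℝ) ≤
          1 + ε * M := by
        rw [div_le_iff₀ hd, wiredDegree_none, Finset.mul_sum]
        refine Finset.sum_le_sum fun x hx => ?_
        rw [mul_comm]
        refine mul_le_mul_of_nonneg_right ?_ (Nat.cast_nonneg _)
        simpa [hf, hx] using (hgin x hx).2
      have h2 : q / (q + 1) * (1 + ε * M) < 1 := by
        rw [div_mul_eq_mul_div, div_lt_one (by linarith)]
        have h3 : ε * M * q < 1 := by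
          rw [hε, div_mul_eq_mul_div, one_mul, div_mul_eq_mul_div, div_lt_one (by positivity)]
          nlinarith [mul_nonneg hM0 hq0.le]
        nlinarith
      have h3 : (1 : ℝ) = wiredLift F f none := rfl
      rw [← h3]
      exact (mul_le_mul_of_nonneg_left h1 (by positivity)).trans_lt h2
    | some x =>
      have hx : (x : Site) ∈ F := x.2
      rw [if_neg (by simp), one_mul, sum_edgeCount_some hfout, wiredDegree_some]
      have h1 : wiredLift F f (some x) = g x := by simp [wiredLift, hf, hx]
      rw [h1, div_lt_iff₀ (by norm_num)]
      refine (Finset.sum_le_sum fun y hy => hfg x hx y hy).trans_lt ?_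
      rw [sum_nbrs]
      simp only [hg]
      push_cast
      nlinarith

end Wired

/-! ### The local time field at an inverse local time of the boundary -/

section Occupation

variable {F : Finset Site} {Ω : Type*}

section Weight

variable {Y : ℕ → Ω → WiredVertex (F : Set Site)} {H : ℕ → Ω → ℝ}

open Classical in
/-- The time spent at a site during the first `m` steps. -/
def siteClock (F : Finset Site) (Y : ℕ → Ω → WiredVertex (F : Set Site)) (H : ℕ → Ω → ℝ) (m : ℕ)
    (x : Site) (ω : Ω) : ℝ :=
  if h : x ∈ F then clock (some ⟨x, h⟩) Y H m ω else 0

theorem sum_mul_siteClock (a : Site → ℝ) (m : ℕ) (ω : Ω) :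
    ∑ x ∈ F, a x * siteClock F Y H m x ω =
      ∑ i ∈ Finset.range m, (Y i ω).elim 0 (fun x => a x) * H i ω := by
  classical
  have h1 : ∀ x : F, a x * siteClock F Y H m x ω =
      ∑ i ∈ Finset.range m, if Y i ω = some ⟨x, x.2⟩ then a x * H i ω else 0 := by
    intro x
    rw [siteClock, dif_pos x.2, clock, Finset.mul_sum]
    refine Finset.sum_congr rfl fun i _ => ?_
    split_ifs <;> simp
  rw [← Finset.sum_coe_sort, Finset.sum_congr rfl fun x _ => h1 x, Finset.sum_comm]
  refine Finset.sum_congr rfl fun i _ => ?_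
  rcases Y i ω with _ | y
  · simp
  · rw [Finset.sum_eq_single (⟨y.1, y.2⟩ : F)]
    · simp
    · intro x _ hx
      rw [if_neg]
      intro h
      apply hx
      have := Option.some.inj h
      exact Subtype.ext (congrArg Subtype.val this).symm
    · simp

open Classical in
/-- The weight of a path in terms of its local times. -/
theorem pathWeight_eq {S : Finset Site} (hS : S ⊆ F) (a : Site → ℝ) {ω : Ω}
    (hH : ∀ k, 0 < H k ω) (m : ℕ) :
    pathWeight {v : WiredVertex (F : Set Site) | v.elim False fun x => (x : Site) ∈ S}
        (fun v => v.elim 0 fun x => a x) Y H m ω =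
      if ∀ x ∈ S, siteClock F Y H m x ω = 0 then
        ENNReal.ofReal (Real.exp (-∑ x ∈ F, a x * siteClock F Y H m x ω)) else 0 := by
  have hz : (∀ x ∈ S, siteClock F Y H m x ω = 0) ↔ ∀ i ∈ Finset.range m,
      Y i ω ∉ {v : WiredVertex (F : Set Site) | v.elim False fun x => (x : Site) ∈ S} := by
    constructor
    · intro h i hi hmem
      rcases hy : Y i ω with _ | y
      · rw [hy] at hmem; exact hmem
      · rw [hy] at hmem
        have hmem' : (y : Site) ∈ S := hmem
        have h1 := h y hmem'
        rw [siteClock, dif_pos (show (y : Site) ∈ F from y.2), clock,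
          Finset.sum_eq_zero_iff_of_nonneg fun j _ => by
            split_ifs
            · exact (hH j).le
            · exact le_rfl] at h1
        have h2 := h1 i hi
        rw [if_pos (by rw [hy])] at h2
        exact (hH i).ne' h2
    · intro h x hx
      rw [siteClock, dif_pos (hS hx), clock]
      refine Finset.sum_eq_zero fun i hi => if_neg fun hy => h i hi ?_
      rw [hy]
      exact hx
  rw [sum_mul_siteClock]
  by_cases hc : ∀ x ∈ S, siteClock F Y H m x ω = 0
  · rw [if_pos hc, pathWeight, ← Finset.sum_neg_distrib, Real.exp_sum,
      ENNReal.ofReal_prod_of_nonneg fun _ _ => (Real.exp_pos _).le]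
    refine Finset.prod_congr rfl fun i hi => ?_
    rw [stayWeight, if_neg (hz.1 hc i hi)]
  · rw [if_neg hc]
    rw [hz] at hc
    push Not at hc
    obtain ⟨i, hi, hmem⟩ := hc
    exact Finset.prod_eq_zero hi (by rw [stayWeight, if_pos hmem])

end Weight

variable [MeasurableSpace Ω]

/-- The rate, per unit of local time at `∂`, at which the walk is killed, when `f` is the
probability of a return to `∂`. -/
def escapeRate (F : Finset Site) (f : Site → ℝ) : ℝ :=
  (2 * Real.pi)⁻¹ * ∑ x ∈ F, (exitDegree F x : ℝ) * (1 - f x)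

/-- `L` satisfies the Feynman–Kac bounds for the local times on `F` of the wired walk by `∂`-time
`t`: an upper bound from each supersolution `f` for the walk killed on `S` and with potential `a`
elsewhere, and, without potential, a lower bound from each subsolution. The number `4 / (2π)` is the
total jump rate at a site; a potential above its negative keeps the weight of a stay integrable. -/
structure IsOccupationField (F : Finset Site) (P : Measure Ω) (t : ℝ) (L : Site → Ω → ℝ) :
    Prop where
  measurable : ∀ x, Measurable (L x)
  le_exp : ∀ (S : Finset Site) (a f : Site → ℝ), S ⊆ F → (∀ x, 0 ≤ f x) → (∀ x ∉ F, f x = 1) →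
    (∀ x, 0 < 4 / (2 * Real.pi) + a x) →
    (∀ x ∈ F, x ∉ S → (2 * Real.pi)⁻¹ * lap f x ≤ a x * f x) →
    ∫⁻ ω in {ω | ∀ x ∈ S, L x ω = 0}, ENNReal.ofReal (Real.exp (-∑ x ∈ F, a x * L x ω)) ∂P ≤
      ENNReal.ofReal (Real.exp (-(escapeRate F f * t)))
  exp_le : ∀ (S : Finset Site) (f : Site → ℝ), S ⊆ F → (∀ x, 0 ≤ f x) → (∀ x, f x ≤ 1) →
    (∀ x ∉ F, f x = 1) → (∀ x ∈ S, f x = 0) → (∀ x ∈ F, x ∉ S → 0 ≤ lap f x) →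
    ENNReal.ofReal (Real.exp (-(escapeRate F f * t))) ≤ P {ω | ∀ x ∈ S, L x ω = 0}

theorem measurable_crossIndex {V : Type*} {v₀ : V} {Y : ℕ → Ω → V} {H : ℕ → Ω → ℝ} (t : ℝ)
    (hm : ∀ m, Measurable (clock v₀ Y H m)) : Measurable (crossIndex v₀ Y H t) := by
  refine measurable_to_countable' fun m => ?_
  have h : crossIndex v₀ Y H t ⁻¹' {m} =
      ({ω | t < clock v₀ Y H (m + 1) ω} ∩ ⋂ j, ⋂ (_ : j < m), {ω | clock v₀ Y H (j + 1) ω ≤ t}) ∪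
      ({_ω | m = 0} ∩ ⋂ j, {ω | clock v₀ Y H (j + 1) ω ≤ t}) := by
    ext ω
    simp only [Set.mem_preimage, Set.mem_singleton_iff, Set.mem_union, Set.mem_inter_iff,
      Set.mem_ofPred_eq, Set.mem_iInter]
    constructor
    · intro hm
      by_cases hne : {j | t < clock v₀ Y H (j + 1) ω}.Nonempty
      · left
        subst hm
        exact ⟨Nat.sInf_mem hne, fun j hj => not_lt.1 (Nat.notMem_of_lt_sInf hj)⟩
      · right
        rw [Set.not_nonempty_iff_eq_empty] at hne
        refine ⟨?_, fun j => ?_⟩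
        · rw [← hm, crossIndex, hne, Nat.sInf_empty]
        · by_contra hlt
          have : j ∈ ({j | t < clock v₀ Y H (j + 1) ω} : Set ℕ) := not_le.1 hlt
          rw [hne] at this
          exact this
    · rintro (⟨h1, h2⟩ | ⟨h1, h2⟩)
      · refine le_antisymm (Nat.sInf_le h1) (le_csInf ⟨m, h1⟩ fun j hj => ?_)
        by_contra hlt
        exact absurd (h2 j (not_le.1 hlt)) (not_le.2 hj)
      · have : {j | t < clock v₀ Y H (j + 1) ω} = ∅ :=
          Set.eq_empty_of_forall_notMem fun j hj => absurd (h2 j) (not_le.2 hj)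
        rw [crossIndex, this, Nat.sInf_empty, h1]
  rw [h]
  refine ((measurableSet_lt measurable_const (hm _)).inter (MeasurableSet.iInter fun j =>
    MeasurableSet.iInter fun _ => measurableSet_le (hm _) measurable_const)).union
    ((MeasurableSet.const _).inter (MeasurableSet.iInter fun j =>
      measurableSet_le (hm _) measurable_const))

/-- Supersolutions for the generator are supersolutions for the jump chain. -/
theorem lap_some_supersolution {a l f : ℝ} (ha : 0 < 4 / (2 * Real.pi) + a)
    (h : (2 * Real.pi)⁻¹ * l ≤ a * f) : 1 / (2 * Real.pi) * 4 / (1 / (2 * Real.pi) * 4 + a) *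
      ((l + 4 * f) / 4) ≤ f := by
  have hpi := Real.pi_pos
  have e : 1 / (2 * Real.pi) * 4 = 4 / (2 * Real.pi) := by ring
  rw [e, div_mul_eq_mul_div, div_le_iff₀ ha]
  have : 4 / (2 * Real.pi) * ((l + 4 * f) / 4) = (2 * Real.pi)⁻¹ * l + 4 / (2 * Real.pi) * f := by
    field_simp
  rw [this]
  linarith

/-- The local times of the wired walk by `∂`-time `t` form an occupation field. -/
theorem IsWiredWalk.exists_occupationField (hF : F.Nonempty) {P : Measure Ω}
    [IsProbabilityMeasure P] {X : ℝ → Ω → WiredVertex (F : Set Site)}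
    (hX : IsWiredWalk (F : Set Site) (1 / (2 * Real.pi)) P X) {t : ℝ} (ht : 0 ≤ t) :
    ∃ L : Site → Ω → ℝ, IsOccupationField F P t L ∧
      ∀ᵐ ω ∂P, ∀ x (h : x ∈ (F : Set Site)),
        boundaryLocalTime (fun u => X u ω) t (some ⟨x, h⟩) = L x ω ∧ 0 ≤ L x ω := by
  classical
  have hpi := Real.pi_pos
  obtain ⟨Y, H, hJ, hpath⟩ := hX.exists_chain hF
  let _ : MeasurableSpace (WiredVertex (F : Set Site)) := ⊤
  have hJ' : IsJumpChain P none (jumpProb (F : Set Site))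
    (fun v => 1 / (2 * Real.pi) * wiredDegree (F : Set Site) v) Y H := hJ
  have hrec := tendsto_measure_clock_none_le hF hJ
  have hK : Measurable (crossIndex none Y H t) :=
    measurable_crossIndex t fun m => hJ'.measurable_clock m
  have hclock : ∀ v : WiredVertex (F : Set Site), ∀ m, Measurable (clock v Y H m) := by
    intro v m
    refine Finset.measurable_fun_sum _ fun i _ => Measurable.ite ?_ (hJ'.measurable_time i)
      measurable_const
    exact hJ'.measurable_chain i (MeasurableSet.of_discrete (s := {v}))
  have hL : ∀ x, Measurable fun ω => siteClock F Y H (crossIndex none Y H t ω) x ω := by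
    intro x
    have h1 : Measurable fun z : ℕ × Ω => siteClock F Y H z.1 x z.2 :=
      measurable_from_prod_countable_right fun m => by
        by_cases hx : x ∈ F
        · simp only [siteClock, hx, dif_pos]
          exact hclock _ m
        · simp only [siteClock, hx, dif_neg, not_false_eq_true]
          exact measurable_const
    exact h1.comp (hK.prodMk measurable_id)
  have hms : ∀ S : Finset Site, MeasurableSet
      {ω | ∀ x ∈ S, siteClock F Y H (crossIndex none Y H t ω) x ω = 0} := by
    intro S
    have : {ω | ∀ x ∈ S, siteClock F Y H (crossIndex none Y H t ω) x ω = 0} =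
        ⋂ x ∈ S, {ω | siteClock F Y H (crossIndex none Y H t ω) x ω = 0} := by
      ext ω; simp
    rw [this]
    exact Finset.measurableSet_biInter _ fun x _ => measurableSet_eq_fun (hL x) measurable_const
  have hrate : ∀ f : Site → ℝ, ∑ w, jumpProb (F : Set Site) none w * wiredLift F f w =
      1 - escapeRate F f / (1 / (2 * Real.pi) * (wiredDegree (F : Set Site) none : ℝ)) := by
    intro f
    have hd := wiredDegree_none_pos hF
    rw [sum_jumpProb_mul, sum_edgeCount_none, escapeRate]
    have h1 : ∑ x ∈ F, (exitDegree F x : ℝ) * (1 - f x) =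
        wiredDegree (F : Set Site) none - ∑ x ∈ F, (exitDegree F x : ℝ) * f x := by
      rw [wiredDegree_none, ← Finset.sum_sub_distrib]
      exact Finset.sum_congr rfl fun x _ => by ring
    rw [h1]
    field_simp
    ring
  have hlift : ∀ {f : Site → ℝ}, (∀ x, 0 ≤ f x) → ∀ v, 0 ≤ wiredLift F f v := fun hf v => by
    cases v
    · exact zero_le_one
    · exact hf _
  have hW : ∀ {S : Finset Site}, S ⊆ F → ∀ a : Site → ℝ,
      ∫⁻ ω, pathWeight {v : WiredVertex (F : Set Site) | v.elim False fun x => (x : Site) ∈ S}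
        (fun v => v.elim 0 fun x => a x) Y H (crossIndex none Y H t ω) ω ∂P =
      ∫⁻ ω in {ω | ∀ x ∈ S, siteClock F Y H (crossIndex none Y H t ω) x ω = 0},
        ENNReal.ofReal (Real.exp
          (-∑ x ∈ F, a x * siteClock F Y H (crossIndex none Y H t ω) x ω)) ∂P := by
    intro S hS a
    rw [← lintegral_indicator (hms S)]
    refine lintegral_congr_ae ?_
    filter_upwards [hJ'.ae_time_pos] with ω hω
    rw [pathWeight_eq hS a hω]
    simp only [Set.indicator_apply, Set.mem_ofPred_eq]
  refine ⟨fun x ω => siteClock F Y H (crossIndex none Y H t ω) x ω, ⟨hL, ?_, ?_⟩, ?_⟩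
  · intro S a f hS hf0 hf1 ha hsup
    rw [← hW hS a]
    refine hJ'.lintegral_pathWeight_le (u := wiredLift F f) ht hrec (hlift hf0) rfl id (fun v => ?_)
      rfl (hrate f) fun v hv hv0 => ?_
    · cases v with
      | none =>
        rw [Option.elim_none, add_zero]
        exact hJ'.rate_pos none
      | some x =>
        rw [Option.elim_some, wiredDegree_some]
        have := ha x
        rw [show 1 / (2 * Real.pi) * 4 = 4 / (2 * Real.pi) by ring]
        exact this
    · cases v with
      | none => exact absurd rfl hv0
      | some x =>
        rw [sum_jumpProb_mul, sum_edgeCount_some hf1, wiredDegree_some, Option.elim_some]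
        have h1 := lap_some_supersolution (ha x) (hsup x x.2 hv)
        rw [lap_eq, sub_add_cancel] at h1
        exact h1
  · intro S f hS hf0 hf1 hf2 hfS hsub
    have h0 := hW hS (fun _ => 0)
    simp only [zero_mul, Finset.sum_const_zero, neg_zero, Real.exp_zero, ENNReal.ofReal_one,
      lintegral_const, one_mul, Measure.restrict_apply_univ] at h0
    rw [← h0]
    refine hJ'.le_lintegral_pathWeight (u := wiredLift F f) ht hrec (hlift hf0) rfl id (fun v => ?_)
      rfl ?_ (hrate f) (fun v hv => ?_) fun v hv hv0 => ?_
    · cases v <;> exact le_rfl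
    · exact mul_nonneg (by positivity) (Finset.sum_nonneg fun x _ =>
        mul_nonneg (Nat.cast_nonneg _) (by linarith [hf1 x]))
    · cases v with
      | none => exact absurd hv id
      | some x => exact hfS x hv
    · cases v with
      | none => exact absurd rfl hv0
      | some x =>
        rw [sum_jumpProb_mul, sum_edgeCount_some hf2, wiredDegree_some, Option.elim_some, add_zero,
          div_self (by positivity), one_mul]
        have h1 := hsub x x.2 hv
        rw [lap_eq] at h1
        simp only [wiredLift]
        linarith
  · filter_upwards [hJ'.ae_time_pos, ae_exists_lt_clock hrec, hpath] with ω h1 h2 h3 x hx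
    have hx' : x ∈ F := hx
    rw [boundaryLocalTime_eq h1 h3 ht (h2 t) _ (by simp), siteClock, dif_pos hx']
    exact ⟨rfl, Finset.sum_nonneg fun i _ => by split_ifs; exacts [(h1 i).le, le_rfl]⟩

end Occupation

/-! ### Probabilities of unvisited sets -/

section Bounds

variable {F : Finset Site} {Ω : Type*} [MeasurableSpace Ω] {P : Measure Ω} {t : ℝ}
  {L : Site → Ω → ℝ}

theorem lap_le_lap {f g : Site → ℝ} {x : Site} (h : ∀ y, f y ≤ g y) (hx : f x = g x) :
    lap f x ≤ lap g x := by
  refine Finset.sum_le_sum fun y _ => ?_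
  rw [hx]
  exact sub_le_sub_right (h y) _

theorem escapeRate_mono {f g : Site → ℝ} (h : ∀ y, f y ≤ g y) :
    escapeRate F g ≤ escapeRate F f := by
  have := Real.pi_pos
  unfold escapeRate
  gcongr with y
  exact h y

theorem escapeRate_green {y : Site} (hy : y ∈ F) :
    (2 * Real.pi)⁻¹ * ∑ x ∈ F, (exitDegree F x : ℝ) * green F x y = 1 := by
  have := Real.pi_pos
  rw [show ∑ x ∈ F, (exitDegree F x : ℝ) * green F x y = 2 * Real.pi from sum_boundary_green hy]
  exact inv_mul_cancel₀ (by positivity)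

/-- The function is harmonic off `S`; if it vanishes on `S`, it is the probability to reach `∂`
before `S`, and the escape rate is the capacity of `S`. -/
theorem escapeRate_potential {S : Finset Site} (hS : S ⊆ F) (α : ℝ) :
    escapeRate F (fun x => 1 - α * ∑ y ∈ S, green F x y) = α * S.card := by
  have h1 : ∀ x, (exitDegree F x : ℝ) * (1 - (1 - α * ∑ y ∈ S, green F x y)) =
      ∑ y ∈ S, α * ((exitDegree F x : ℝ) * green F x y) := by
    intro x
    rw [sub_sub_cancel, Finset.mul_sum, Finset.mul_sum]
    exact Finset.sum_congr rfl fun y _ => by ring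
  simp only [escapeRate, h1]
  rw [Finset.sum_comm, Finset.mul_sum]
  rw [Finset.sum_congr rfl fun y hy => show (2 * Real.pi)⁻¹ *
    ∑ x ∈ F, α * ((exitDegree F x : ℝ) * green F x y) = α by
      rw [← Finset.mul_sum, mul_left_comm, escapeRate_green (hS hy), mul_one]]
  rw [Finset.sum_const, nsmul_eq_mul, mul_comm]

theorem lap_potential {S : Finset Site} (α : ℝ) {x : Site} (hx : x ∈ F) (hxS : x ∉ S) :
    lap (fun z => 1 - α * ∑ y ∈ S, green F z y) x = 0 := by
  have h : lap (fun z => 1 + (-α) * ∑ y ∈ S, green F z y) x = 0 := by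
    rw [lap_add, lap_const, lap_const_mul, lap_sum S (fun y z => green F z y),
      Finset.sum_eq_zero fun y hy => lap_green_of_ne hx fun h => hxS (h ▸ hy)]
    simp
  convert h using 2
  ext z
  ring

namespace IsOccupationField

/-- Upper bound for the probability that a set is not visited, by a lower bound for its capacity. -/
theorem prob_unvisited_le (hL : IsOccupationField F P t L) (ht : 0 ≤ t) {S : Finset Site}
    (hS : S ⊆ F) {α : ℝ} (hα : ∀ x ∈ F, α * ∑ y ∈ S, green F x y ≤ 1) :
    P.real {ω | ∀ x ∈ S, L x ω = 0} ≤ Real.exp (-(α * S.card * t)) := by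
  classical
  set φ : Site → ℝ := fun x => 1 - α * ∑ y ∈ S, green F x y with hφ
  have hφout : ∀ x ∉ F, φ x = 1 := fun x hx => by
    simp only [hφ]
    rw [Finset.sum_eq_zero fun y _ => green_left hx y]
    simp
  have hφ0 : ∀ x, 0 ≤ φ x := fun x => by
    by_cases hx : x ∈ F
    · exact sub_nonneg.2 (hα x hx)
    · rw [hφout x hx]; exact zero_le_one
  set f : Site → ℝ := fun x => if x ∈ S then 0 else φ x with hf
  have hfφ : ∀ x, f x ≤ φ x := fun x => by
    by_cases hx : x ∈ S
    · simpa [hf, hx] using hφ0 x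
    · simp [hf, hx]
  have h := hL.le_exp S (fun _ => 0) f hS
    (fun x => by by_cases hx : x ∈ S <;> simp [hf, hx, hφ0])
    (fun x hx => by
      have hxS : x ∉ S := fun h => hx (hS h)
      simp [hf, hxS, hφout x hx])
    (fun x => by have := Real.pi_pos; positivity)
    (fun x hx hxS => by
      have h1 := lap_le_lap hfφ (x := x) (by simp [hf, hxS])
      rw [lap_potential α hx hxS] at h1
      have := Real.pi_pos
      rw [zero_mul]
      exact mul_nonpos_of_nonneg_of_nonpos (by positivity) h1)
  simp only [zero_mul, Finset.sum_const_zero, neg_zero, Real.exp_zero, ENNReal.ofReal_one,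
    lintegral_const, one_mul, Measure.restrict_apply_univ] at h
  have h2 := ENNReal.toReal_mono ENNReal.ofReal_ne_top h
  rw [ENNReal.toReal_ofReal (Real.exp_pos _).le] at h2
  refine h2.trans (Real.exp_le_exp.2 (neg_le_neg (mul_le_mul_of_nonneg_right ?_ ht)))
  rw [← escapeRate_potential hS α]
  exact escapeRate_mono hfφ

/-- Lower bound for the probability that a set is not visited, by an upper bound for its
capacity. -/
theorem le_prob_unvisited [IsProbabilityMeasure P] (hL : IsOccupationField F P t L) (ht : 0 ≤ t)
    {S : Finset Site} (hS : S ⊆ F) {α : ℝ} (hα0 : 0 ≤ α)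
    (hα : ∀ x ∈ S, 1 ≤ α * ∑ y ∈ S, green F x y) :
    Real.exp (-(α * S.card * t)) ≤ P.real {ω | ∀ x ∈ S, L x ω = 0} := by
  set φ : Site → ℝ := fun x => 1 - α * ∑ y ∈ S, green F x y with hφ
  have hφout : ∀ x ∉ F, φ x = 1 := fun x hx => by
    simp only [hφ]
    rw [Finset.sum_eq_zero fun y _ => green_left hx y]
    simp
  have hφ1 : ∀ x, φ x ≤ 1 := fun x =>
    sub_le_self _ (mul_nonneg hα0 (Finset.sum_nonneg fun y _ => green_nonneg x y))
  set f : Site → ℝ := fun x => max (φ x) 0 with hf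
  have hfφ : ∀ x, φ x ≤ f x := fun x => le_max_left _ _
  have h := hL.exp_le S f hS (fun x => le_max_right _ _) (fun x => max_le (hφ1 x) zero_le_one)
    (fun x hx => by simp [hf, hφout x hx])
    (fun x hx => max_eq_right (sub_nonpos.2 (hα x hx)))
    (fun x hx hxS => by
      rcases le_total 0 (φ x) with h0 | h0
      · have h1 := lap_le_lap hfφ (x := x) (by simp [hf, h0])
        rwa [lap_potential α hx hxS] at h1
      · refine Finset.sum_nonneg fun y _ => ?_
        simp [hf, h0])
  have h2 := ENNReal.toReal_mono (measure_ne_top _ _) h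
  rw [ENNReal.toReal_ofReal (Real.exp_pos _).le] at h2
  refine le_trans (Real.exp_le_exp.2 (neg_le_neg (mul_le_mul_of_nonneg_right ?_ ht))) h2
  rw [← escapeRate_potential hS α]
  exact escapeRate_mono hfφ

/-- Chernoff bound for a small local time. The right side is close to the probability that the site
is not visited at all, so the local time is unlikely to be small but positive. -/
theorem prob_le_of_small (hL : IsOccupationField F P t L) {x : Site} (hx : x ∈ F) {l : ℝ}
    (hl : 0 < l) (a : ℝ) :
    P.real {ω | L x ω ≤ a} ≤
      Real.exp (l * a) * Real.exp (-(l / (1 + l * green F x x) * t)) := by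
  classical
  have hpi := Real.pi_pos
  have hg := green_nonneg (U := F) x x
  have hd : 0 < 1 + l * green F x x := by positivity
  set β := l / (1 + l * green F x x) with hβ
  have hβ0 : 0 < β := by positivity
  have hβg : β * green F x x ≤ 1 := by
    rw [hβ, div_mul_eq_mul_div, div_le_one hd]; linarith
  have h := hL.le_exp ∅ (fun z => if z = x then l else 0)
    (fun z => 1 - β * ∑ y ∈ {x}, green F z y) (Finset.empty_subset _)
    (fun z => by
      rw [Finset.sum_singleton, sub_nonneg]
      exact (mul_le_mul_of_nonneg_left (green_le_diag z x) hβ0.le).trans hβg)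
    (fun z hz => by rw [Finset.sum_singleton, green_left hz]; simp)
    (fun z => by
      have : 0 < 4 / (2 * Real.pi) := by positivity
      split_ifs <;> linarith)
    (fun z hz _ => by
      by_cases hzx : z = x
      · subst hzx
        have h1 : lap (fun w => 1 - β * ∑ y ∈ {z}, green F w y) z = β * (2 * Real.pi) := by
          have h2 : lap (fun w => 1 + (-β) * green F w z) z = β * (2 * Real.pi) := by
            rw [lap_add, lap_const, lap_const_mul, lap_green_self hz]; ring
          rw [← h2]
          congr 1
          ext w
          rw [Finset.sum_singleton]; ring
        rw [h1, if_pos rfl, Finset.sum_singleton]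
        refine le_of_eq ?_
        rw [hβ]
        field_simp
        ring
      · rw [lap_potential β hz (by simpa using hzx), if_neg hzx]; simp)
  rw [escapeRate_potential (Finset.singleton_subset_iff.2 hx), Finset.card_singleton, Nat.cast_one,
    mul_one] at h
  simp only [ite_mul, zero_mul, Finset.sum_ite_eq', hx, if_true, Finset.notMem_empty,
    IsEmpty.forall_iff, implies_true, Set.ofPred_true, Measure.restrict_univ] at h
  have hms : MeasurableSet {ω | L x ω ≤ a} := measurableSet_le (hL.measurable x) measurable_const
  have h1 : P {ω | L x ω ≤ a} ≤ ENNReal.ofReal (Real.exp (l * a)) *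
      ENNReal.ofReal (Real.exp (-(β * t))) := by
    refine le_trans ?_ (mul_le_mul_right h _)
    rw [← lintegral_indicator_one hms, ← lintegral_const_mul' _ _ ENNReal.ofReal_ne_top]
    refine lintegral_mono fun ω => ?_
    by_cases hω : L x ω ≤ a
    · rw [indicator_of_mem (show ω ∈ {ω | L x ω ≤ a} from hω), Pi.one_apply,
        ← ENNReal.ofReal_mul (Real.exp_pos _).le, ← ENNReal.ofReal_one, ← Real.exp_add]
      exact ENNReal.ofReal_le_ofReal (Real.one_le_exp (by nlinarith))
    · rw [indicator_of_notMem (show ω ∉ {ω | L x ω ≤ a} from hω)]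
      exact bot_le
  rw [← ENNReal.ofReal_mul (Real.exp_pos _).le] at h1
  exact ENNReal.toReal_le_of_le_ofReal (by positivity) h1

/-- If the local time at `x` is large, a site `y` close to `x` is likely to have been visited:
`h` is the probability to reach `∂` from `x` before `y`, and `D` is the value at `x` of the Green
function of the walk killed also at `y`. -/
theorem prob_large_and_unvisited_le (hL : IsOccupationField F P t L) {x y : Site}
    (hx : x ∈ F) (hy : y ∈ F) (hxy : x ≠ y) {h D θ a : ℝ} (hpos : 0 < green F y y)
    (hh : h = 1 - green F x y / green F y y)
    (hD : D = green F x x - green F x y * green F x y / green F y y)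
    (hθ : 0 < θ) (hθ2 : θ < 1 / 2) (hθD : θ * D < 1) (ht : 0 ≤ t) :
    P.real {ω | a < L x ω ∧ L y ω = 0} ≤
      Real.exp (-(θ * a)) * Real.exp (θ * h / (1 - θ * D) * h * t) := by
  classical
  have hpi := Real.pi_pos
  have hh0 : 0 ≤ h := by
    rw [hh, sub_nonneg, div_le_one hpos]; exact green_le_diag x y
  set β := θ * h / (1 - θ * D) with hβ
  have hd : 0 < 1 - θ * D := by linarith
  have hβ0 : 0 ≤ β := by positivity
  -- `α` makes the supersolution `f` vanish at `y`, and `β` solves `β = θ * f x`, which is the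
  -- equation at `x`, where the potential is `-θ`
  set α := (1 + β * green F x y) / green F y y with hα
  set f : Site → ℝ := fun z => 1 + (-α) * green F z y + β * green F z x with hf
  have hfy : f y = 0 := by
    simp only [hf, hα, green_comm y x]
    field_simp
    ring
  have hfx : β = θ * f x := by
    have h1 : f x = h + β * D := by
      simp only [hf, hα, hh, hD]
      field_simp
      ring
    rw [h1, hβ]
    field_simp
    ring
  have hfout : ∀ z ∉ F, f z = 1 := fun z hz => by
    simp only [hf, green_left hz]; ring
  have hflap : ∀ z ∈ F, z ≠ y → lap f z = β * if z = x then -(2 * Real.pi) else 0 := by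
    intro z hz hzy
    have h1 : lap f z = lap (fun z => 1 + (-α) * green F z y) z + lap (fun z => β * green F z x) z :=
      lap_add _ _ _
    rw [h1, lap_add, lap_const, lap_const_mul, lap_const_mul, lap_green_of_ne hz hzy,
      lap_green hz hx]
    simp
  have hf0 : ∀ z, 0 ≤ f z := by
    refine nonneg_of_lap_nonpos (W := F.erase y) (fun z hz => ?_) fun z hz => ?_
    · by_cases hzy : z = y
      · rw [hzy, hfy]
      · rw [hfout z fun hzF => hz (Finset.mem_erase.2 ⟨hzy, hzF⟩)]; exact zero_le_one
    · rw [Finset.mem_erase] at hz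
      rw [hflap z hz.2 hz.1]
      refine mul_nonpos_of_nonneg_of_nonpos hβ0 ?_
      split_ifs <;> linarith
  have hrate : escapeRate F f = α - β := by
    have h1 : ∀ z, (exitDegree F z : ℝ) * (1 - f z) =
        α * ((exitDegree F z : ℝ) * green F z y) - β * ((exitDegree F z : ℝ) * green F z x) :=
      fun z => by simp only [hf]; ring
    simp only [escapeRate, h1]
    rw [Finset.sum_sub_distrib, ← Finset.mul_sum, ← Finset.mul_sum, mul_sub,
      mul_left_comm, escapeRate_green hy, mul_left_comm, escapeRate_green hx]
    ring
  have hle : -(β * h) ≤ escapeRate F f := by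
    rw [hrate, hα, hh]
    have h1 : 0 ≤ 1 / green F y y := by positivity
    have h2 : (1 + β * green F x y) / green F y y - β =
        1 / green F y y + -(β * (1 - green F x y / green F y y)) := by
      field_simp
      ring
    rw [h2]
    linarith
  have hmain := hL.le_exp {y} (fun z => if z = x then -θ else 0) f
    (Finset.singleton_subset_iff.2 hy) hf0 hfout
    (fun z => by
      have h1 : 1 / 2 < 4 / (2 * Real.pi) := by
        rw [div_lt_div_iff₀ (by norm_num) (by positivity)]
        linarith [Real.pi_lt_d2]
      split_ifs <;> linarith)
    (fun z hz hzy => by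
      rw [hflap z hz (by simpa using hzy)]
      by_cases hzx : z = x
      · subst hzx
        rw [if_pos rfl, if_pos rfl]
        have h1 : (2 * Real.pi)⁻¹ * (β * -(2 * Real.pi)) = -β := by field_simp
        rw [h1, hfx]
        linarith
      · simp [hzx])
  simp only [ite_mul, zero_mul, Finset.sum_ite_eq', hx, if_true, Finset.mem_singleton,
    forall_eq, neg_mul, neg_neg] at hmain
  have hms : MeasurableSet {ω | L y ω = 0} :=
    measurableSet_eq_fun (hL.measurable y) measurable_const
  have hms2 : MeasurableSet {ω | a < L x ω ∧ L y ω = 0} :=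
    (measurableSet_lt measurable_const (hL.measurable x)).inter hms
  have h1 : P {ω | a < L x ω ∧ L y ω = 0} ≤ ENNReal.ofReal (Real.exp (-(θ * a))) *
      ENNReal.ofReal (Real.exp (-(escapeRate F f * t))) := by
    refine le_trans ?_ (mul_le_mul_right hmain _)
    rw [← lintegral_indicator_one hms2, ← lintegral_indicator hms,
      ← lintegral_const_mul' _ _ ENNReal.ofReal_ne_top]
    refine lintegral_mono fun ω => ?_
    by_cases hω : a < L x ω ∧ L y ω = 0
    · rw [indicator_of_mem (show ω ∈ {ω | a < L x ω ∧ L y ω = 0} from hω), Pi.one_apply,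
        indicator_of_mem (show ω ∈ {ω | L y ω = 0} from hω.2),
        ← ENNReal.ofReal_mul (Real.exp_pos _).le, ← ENNReal.ofReal_one, ← Real.exp_add]
      exact ENNReal.ofReal_le_ofReal (Real.one_le_exp (by nlinarith [hω.1]))
    · rw [indicator_of_notMem (show ω ∉ {ω | a < L x ω ∧ L y ω = 0} from hω)]
      exact bot_le
  rw [← ENNReal.ofReal_mul (Real.exp_pos _).le] at h1
  refine (ENNReal.toReal_le_of_le_ofReal (by positivity) h1).trans ?_
  refine mul_le_mul_of_nonneg_left (Real.exp_le_exp.2 ?_) (Real.exp_pos _).le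
  have := mul_le_mul_of_nonneg_right hle ht
  linarith

end IsOccupationField

end Bounds

/-! ### Poisson approximation from the inclusion–exclusion inequalities -/

/-- The inclusion–exclusion inequalities for the binomial theorem. For `p = 1` they are the
Bonferroni inequalities for the number `N` of events that occur. -/
theorem binomial_remainder {p : ℝ} (hp0 : 0 ≤ p) (hp1 : p ≤ 1) (N : ℕ) : ∀ K : ℕ,
    0 ≤ (-1) ^ K * ((1 - p) ^ N - ∑ j ∈ Finset.range K, (-1) ^ j * (N.choose j : ℝ) * p ^ j) ∧
    (-1) ^ K * ((1 - p) ^ N - ∑ j ∈ Finset.range K, (-1) ^ j * (N.choose j : ℝ) * p ^ j) ≤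
      (N.choose K : ℝ) * p ^ K := by
  have h1p : 0 ≤ 1 - p := by linarith
  induction N with
  | zero =>
    intro K
    cases K with
    | zero => simp
    | succ K =>
      rw [Finset.sum_range_succ']
      simp
  | succ N ih =>
    intro K
    cases K with
    | zero =>
      simp only [pow_zero, Finset.range_zero, Finset.sum_empty, sub_zero, one_mul,
        Nat.choose_zero_right, Nat.cast_one, mul_one]
      exact ⟨pow_nonneg h1p _, pow_le_one₀ h1p (by linarith)⟩
    | succ K =>
      have hsum : ∑ j ∈ Finset.range (K + 1), (-1) ^ j * ((N + 1).choose j : ℝ) * p ^ j =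
          ∑ j ∈ Finset.range (K + 1), (-1) ^ j * (N.choose j : ℝ) * p ^ j -
            p * ∑ j ∈ Finset.range K, (-1) ^ j * (N.choose j : ℝ) * p ^ j := by
        rw [Finset.sum_range_succ', Finset.sum_range_succ' (fun j => (-1) ^ j *
          (N.choose j : ℝ) * p ^ j), Finset.mul_sum]
        simp only [Nat.choose_succ_succ', Nat.choose_zero_right]
        rw [add_sub_right_comm, ← Finset.sum_sub_distrib]
        congr 1
        refine Finset.sum_congr rfl fun j _ => ?_
        push_cast
        ring
      have hrec : (-1) ^ (K + 1) * ((1 - p) ^ (N + 1) -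
          ∑ j ∈ Finset.range (K + 1), (-1) ^ j * ((N + 1).choose j : ℝ) * p ^ j) =
          (-1) ^ (K + 1) * ((1 - p) ^ N -
            ∑ j ∈ Finset.range (K + 1), (-1) ^ j * (N.choose j : ℝ) * p ^ j) +
          p * ((-1) ^ K * ((1 - p) ^ N -
            ∑ j ∈ Finset.range K, (-1) ^ j * (N.choose j : ℝ) * p ^ j)) := by
        rw [hsum]; ring
      rw [hrec, Nat.choose_succ_succ']
      obtain ⟨h1, h2⟩ := ih (K + 1)
      obtain ⟨h3, h4⟩ := ih K
      refine ⟨add_nonneg h1 (mul_nonneg hp0 h3), ?_⟩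
      have h5 := mul_le_mul_of_nonneg_left h4 hp0
      push_cast
      rw [add_mul, pow_succ p K]
      rw [pow_succ p K] at h2
      linarith

theorem abs_binomial_remainder {p : ℝ} (hp0 : 0 ≤ p) (hp1 : p ≤ 1) (N K : ℕ) :
    |(1 - p) ^ N - ∑ j ∈ Finset.range K, (-1) ^ j * (N.choose j : ℝ) * p ^ j| ≤
      (N.choose K : ℝ) * p ^ K := by
  obtain ⟨h1, h2⟩ := binomial_remainder hp0 hp1 N K
  rw [← abs_of_nonneg h1, abs_mul, abs_pow, abs_neg, abs_one, one_pow, one_mul] at h2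
  exact h2

theorem choose_mul_pow_le {p : ℝ} (hp0 : 0 ≤ p) (N j : ℕ) :
    (N.choose j : ℝ) * p ^ j ≤ (N * p) ^ j / j.factorial := by
  have h := Nat.choose_le_pow_div (α := ℝ) j N
  calc (N.choose j : ℝ) * p ^ j ≤ (N ^ j / j.factorial : ℝ) * p ^ j := by gcongr
    _ = _ := by rw [mul_pow]; ring

theorem abs_one_sub_pow_sub_exp_le {p : ℝ} (hp0 : 0 ≤ p) (hp1 : p ≤ 1) (N : ℕ) :
    |(1 - p) ^ N - Real.exp (-(N * p))| ≤ N * p ^ 2 := by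
  have h := Real.abs_exp_sub_one_sub_id_le (x := -p) (by rw [abs_neg, abs_of_nonneg hp0]; exact hp1)
  have h1 : |(1 - p) - Real.exp (-p)| ≤ p ^ 2 := by
    rw [abs_sub_comm]
    rw [neg_sq] at h
    convert h using 2
    ring
  have hE : Real.exp (-(N * p)) = Real.exp (-p) ^ N := by
    rw [← Real.exp_nat_mul]; ring_nf
  rw [hE]
  have hb : Real.exp (-p) ≤ 1 := Real.exp_le_one_iff.2 (by linarith)
  have hb0 := (Real.exp_pos (-p)).le
  generalize Real.exp (-p) = b at *
  clear hE h
  induction N with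
  | zero => simp
  | succ N ih =>
    have e : (1 - p) ^ (N + 1) - b ^ (N + 1) =
        (1 - p) * ((1 - p) ^ N - b ^ N) + ((1 - p) - b) * b ^ N := by ring
    rw [e]
    refine (abs_add_le _ _).trans ?_
    rw [abs_mul, abs_mul, abs_of_nonneg (show 0 ≤ 1 - p by linarith), abs_of_nonneg
      (pow_nonneg hb0 N)]
    have h2 : b ^ N ≤ 1 := pow_le_one₀ hb0 hb
    have h3 : (1 - p) * |(1 - p) ^ N - b ^ N| ≤ |(1 - p) ^ N - b ^ N| :=
      mul_le_of_le_one_left (abs_nonneg _) (by linarith)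
    have h4 : |(1 - p) - b| * b ^ N ≤ |(1 - p) - b| := mul_le_of_le_one_right (abs_nonneg _) h2
    push_cast
    linarith

section Bonferroni

variable {Ω ι : Type*} {E E' : ι → Set Ω}

open Classical in
theorem sum_indicator_inter_eq_choose (s : Finset ι) (j : ℕ) (ω : Ω) :
    ∑ J ∈ s.powersetCard j, indicator {ω | ∀ i ∈ J, ω ∈ E i} (1 : Ω → ℝ) ω =
      ((s.filter fun i => ω ∈ E i).card.choose j : ℝ) := by
  rw [← Finset.card_powersetCard]
  simp only [Set.indicator_apply, Pi.one_apply, Set.mem_ofPred_eq]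
  rw [Finset.sum_boole]
  congr 2
  ext J
  simp only [Finset.mem_filter, Finset.mem_powersetCard, Finset.subset_iff]
  constructor
  · rintro ⟨⟨h1, h2⟩, h3⟩
    exact ⟨fun i hi => ⟨h1 hi, h3 i hi⟩, h2⟩
  · rintro ⟨h1, h2⟩
    exact ⟨⟨fun i hi => (h1 hi).1, h2⟩, fun i hi => (h1 hi).2⟩

variable [MeasurableSpace Ω] {P : Measure Ω} [IsProbabilityMeasure P]

theorem measurableSet_forall_mem (hE : ∀ i, MeasurableSet (E i)) (J : Finset ι) :
    MeasurableSet {ω | ∀ i ∈ J, ω ∈ E i} := by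
  have : {ω | ∀ i ∈ J, ω ∈ E i} = ⋂ i ∈ J, E i := by ext; simp
  rw [this]
  exact Finset.measurableSet_biInter _ fun i _ => hE i

theorem measurableSet_forall_notMem (hE : ∀ i, MeasurableSet (E i)) (J : Finset ι) :
    MeasurableSet {ω | ∀ i ∈ J, ω ∉ E i} :=
  measurableSet_forall_mem (E := fun i => (E i)ᶜ) (fun i => (hE i).compl) J

/-- The Bonferroni inequalities. -/
theorem abs_prob_none_sub_le (hE : ∀ i, MeasurableSet (E i)) (s : Finset ι) (K : ℕ) :
    |P.real {ω | ∀ i ∈ s, ω ∉ E i} - ∑ j ∈ Finset.range K, (-1) ^ j *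
        ∑ J ∈ s.powersetCard j, P.real {ω | ∀ i ∈ J, ω ∈ E i}| ≤
      ∑ J ∈ s.powersetCard K, P.real {ω | ∀ i ∈ J, ω ∈ E i} := by
  classical
  have hint : ∀ J : Finset ι, Integrable (indicator {ω | ∀ i ∈ J, ω ∈ E i} (1 : Ω → ℝ)) P :=
    fun J => (integrable_const (1 : ℝ)).indicator (measurableSet_forall_mem hE J)
  have hint' : Integrable (indicator {ω | ∀ i ∈ s, ω ∉ E i} (1 : Ω → ℝ)) P :=
    (integrable_const (1 : ℝ)).indicator (measurableSet_forall_notMem hE s)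
  have hP : ∀ J : Finset ι, P.real {ω | ∀ i ∈ J, ω ∈ E i} =
      ∫ ω, indicator {ω | ∀ i ∈ J, ω ∈ E i} (1 : Ω → ℝ) ω ∂P := fun J =>
    (integral_indicator_one (measurableSet_forall_mem hE J)).symm
  rw [← integral_indicator_one (measurableSet_forall_notMem hE s)]
  simp only [hP]
  have hS : ∀ j, Integrable (fun ω => ∑ J ∈ s.powersetCard j,
      indicator {ω | ∀ i ∈ J, ω ∈ E i} (1 : Ω → ℝ) ω) P := fun j =>
    integrable_finsetSum _ fun J _ => hint J
  simp only [← integral_finsetSum _ fun J _ => hint J, ← integral_const_mul]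
  rw [← integral_finsetSum _ fun j _ => (hS j).const_mul _, ← integral_sub hint'
    (integrable_finsetSum _ fun j _ => (hS j).const_mul _), ← Real.norm_eq_abs]
  refine norm_integral_le_of_norm_le (hS K) (Eventually.of_forall fun ω => ?_)
  simp only [sum_indicator_inter_eq_choose]
  have h := abs_binomial_remainder (p := 1) zero_le_one le_rfl
    (s.filter fun i => ω ∈ E i).card K
  simp only [one_pow, mul_one, sub_self] at h
  have h0 : indicator {ω | ∀ i ∈ s, ω ∉ E i} (1 : Ω → ℝ) ω =
      0 ^ (s.filter fun i => ω ∈ E i).card := by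
    by_cases hω : ∀ i ∈ s, ω ∉ E i
    · rw [Set.indicator_of_mem (Set.mem_ofPred.2 hω), Finset.filter_eq_empty_iff.2 fun i hi => hω i hi]
      simp
    · rw [Set.indicator_of_notMem (mt Set.mem_ofPred.1 hω), zero_pow]
      rw [Ne, Finset.card_eq_zero, Finset.filter_eq_empty_iff]
      exact fun h => hω fun i hi => h hi
  rw [h0, Real.norm_eq_abs]
  exact h

/-- If joint probabilities up to order `K` are close to those of independent events of probability
`p`, then so is the probability that no event occurs. -/
theorem abs_prob_none_sub_one_sub_pow_le (hE : ∀ i, MeasurableSet (E i)) (s : Finset ι) {K : ℕ}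
    {p δ : ℝ} (hp0 : 0 ≤ p) (hp1 : p ≤ 1) (hδ0 : 0 ≤ δ)
    (hJ : ∀ J ⊆ s, J.card ≤ K → |P.real {ω | ∀ i ∈ J, ω ∈ E i} - p ^ J.card| ≤ δ * p ^ J.card) :
    |P.real {ω | ∀ i ∈ s, ω ∉ E i} - (1 - p) ^ s.card| ≤
      δ * Real.exp (s.card * p) + (2 + δ) * ((s.card * p) ^ K / K.factorial) := by
  have hS : ∀ j ≤ K, |∑ J ∈ s.powersetCard j, P.real {ω | ∀ i ∈ J, ω ∈ E i} -
      (s.card.choose j : ℝ) * p ^ j| ≤ δ * ((s.card.choose j : ℝ) * p ^ j) := by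
    intro j hj
    have h1 : (s.card.choose j : ℝ) * p ^ j = ∑ J ∈ s.powersetCard j, p ^ j := by
      rw [Finset.sum_const, Finset.card_powersetCard, nsmul_eq_mul]
    rw [h1, ← Finset.sum_sub_distrib, Finset.mul_sum]
    refine (Finset.abs_sum_le_sum_abs _ _).trans (Finset.sum_le_sum fun J hJs => ?_)
    rw [Finset.mem_powersetCard] at hJs
    rw [← hJs.2]
    exact hJ J hJs.1 (hJs.2 ▸ hj)
  have h1 := abs_prob_none_sub_le (P := P) hE s K
  have h2 := abs_binomial_remainder hp0 hp1 s.card K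
  have h3 : |∑ j ∈ Finset.range K, (-1) ^ j *
        ∑ J ∈ s.powersetCard j, P.real {ω | ∀ i ∈ J, ω ∈ E i} -
      ∑ j ∈ Finset.range K, (-1) ^ j * (s.card.choose j : ℝ) * p ^ j| ≤
      δ * Real.exp (s.card * p) := by
    rw [← Finset.sum_sub_distrib]
    refine (Finset.abs_sum_le_sum_abs _ _).trans ?_
    refine le_trans ?_ (mul_le_mul_of_nonneg_left
      (Real.sum_le_exp_of_nonneg (mul_nonneg (Nat.cast_nonneg s.card) hp0) K) hδ0)
    rw [Finset.mul_sum]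
    refine Finset.sum_le_sum fun j hj => ?_
    rw [mul_assoc, ← mul_sub, abs_mul, abs_pow, abs_neg, abs_one, one_pow, one_mul]
    exact (hS j (Finset.mem_range.1 hj).le).trans
      (mul_le_mul_of_nonneg_left (choose_mul_pow_le hp0 _ _) hδ0)
  have h4 := abs_le.1 (hS K le_rfl)
  have h5 := choose_mul_pow_le hp0 s.card K
  rw [abs_le] at h1 h2 h3 ⊢
  have h6 := mul_le_mul_of_nonneg_left h5 hδ0
  constructor <;> linarith [h1.1, h1.2, h2.1, h2.2, h3.1, h3.2, h4.1, h4.2]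

/-- Poisson approximation. The joint probabilities of the events `E i` are assumed only up to
order `K`, and of the larger events `E' i` only the probability is controlled; if there are more
than `M / p` events, a subfamily decides. -/
theorem abs_prob_none_sub_exp_le (hE : ∀ i, MeasurableSet (E i))
    (s : Finset ι) {K : ℕ} (hK : 1 ≤ K) {p δ M : ℝ} (hp0 : 0 < p) (hp1 : p ≤ 1) (hδ0 : 0 ≤ δ)
    (hM : 0 ≤ M)
    (hJ : ∀ J ⊆ s, J.card ≤ K → |P.real {ω | ∀ i ∈ J, ω ∈ E i} - p ^ J.card| ≤ δ * p ^ J.card)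
    (hsub : ∀ i ∈ s, E i ⊆ E' i) (hprob : ∀ i ∈ s, P.real (E' i) ≤ (1 + δ) * p) :
    |P.real {ω | ∀ i ∈ s, ω ∉ E' i} - Real.exp (-(s.card * p))| ≤
      Real.exp (-M) + δ * Real.exp (M + 1) + (2 + δ) * ((M + 1) ^ K / K.factorial) +
        (M + 1) * p + 2 * δ * (M + 1) := by
  have hcore : ∀ s' ⊆ s, (s'.card : ℝ) * p ≤ M + 1 →
      |P.real {ω | ∀ i ∈ s', ω ∉ E i} - Real.exp (-(s'.card * p))| ≤
        δ * Real.exp (M + 1) + (2 + δ) * ((M + 1) ^ K / K.factorial) + (M + 1) * p := by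
    intro s' hs' hle
    have h1 := abs_prob_none_sub_one_sub_pow_le (P := P) hE s' hp0.le hp1 hδ0
      fun J hJs => hJ J (hJs.trans hs')
    have h2 := abs_one_sub_pow_sub_exp_le hp0.le hp1 s'.card
    have h3 : (s'.card : ℝ) * p ^ 2 ≤ (M + 1) * p := by
      rw [sq, ← mul_assoc]; exact mul_le_mul_of_nonneg_right hle hp0.le
    have h4 : δ * Real.exp (s'.card * p) ≤ δ * Real.exp (M + 1) := by gcongr
    have h5 : (2 + δ) * ((s'.card * p) ^ K / K.factorial) ≤
        (2 + δ) * ((M + 1) ^ K / K.factorial) := by gcongr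
    have h6 := abs_sub_le (P.real {ω | ∀ i ∈ s', ω ∉ E i}) ((1 - p) ^ s'.card)
      (Real.exp (-(s'.card * p)))
    linarith
  have hexpM := (Real.exp_pos (-M)).le
  have hmono : ∀ s' ⊆ s, P.real {ω | ∀ i ∈ s, ω ∉ E' i} ≤ P.real {ω | ∀ i ∈ s', ω ∉ E i} :=
    fun s' hs' => measureReal_mono fun ω hω i hi h => hω i (hs' hi) (hsub i (hs' hi) h)
  have hδM : 0 ≤ 2 * δ * (M + 1) := by positivity
  rcases le_or_gt ((s.card : ℝ) * p) (M + 1) with hle | hgt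
  · have h1 := hcore s subset_rfl hle
    have h2 := hmono s subset_rfl
    have h3 : P.real {ω | ∀ i ∈ s, ω ∉ E i} ≤
        P.real {ω | ∀ i ∈ s, ω ∉ E' i} + 2 * δ * (M + 1) := by
      have hcov : {ω | ∀ i ∈ s, ω ∉ E i} ⊆ {ω | ∀ i ∈ s, ω ∉ E' i} ∪ ⋃ i ∈ s, (E' i \ E i) := by
        intro ω hω
        by_cases h : ∀ i ∈ s, ω ∉ E' i
        · exact Or.inl h
        · push Not at h
          obtain ⟨i, hi, h⟩ := h
          refine Or.inr (Set.mem_iUnion₂.2 ⟨i, hi, h, hω i hi⟩)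
      refine (measureReal_mono hcov).trans ((measureReal_union_le _ _).trans ?_)
      gcongr
      refine (measureReal_biUnion_finset_le _ _).trans ?_
      have h4 : ∀ i ∈ s, P.real (E' i \ E i) ≤ 2 * δ * p := by
        intro i hi
        have h5 := hJ {i} (Finset.singleton_subset_iff.2 hi) (by simpa using hK)
        simp only [Finset.mem_singleton, forall_eq, Finset.card_singleton, pow_one,
          Set.ofPred_mem_eq] at h5
        rw [measureReal_sdiff (hsub i hi) (hE i)]
        linarith [hprob i hi, (abs_le.1 h5).1]
      refine (Finset.sum_le_sum h4).trans ?_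
      rw [Finset.sum_const, nsmul_eq_mul]
      nlinarith
    rw [abs_le] at h1 ⊢
    constructor <;> linarith [h1.1, h1.2]
  · obtain ⟨s', hs', hcard⟩ := Finset.exists_subset_card_eq
      (show ⌈M / p⌉₊ ≤ s.card from Nat.ceil_le.2 (by rw [div_le_iff₀ hp0]; linarith))
    have hlow : M ≤ (s'.card : ℝ) * p := by
      rw [hcard, ← div_le_iff₀ hp0]; exact Nat.le_ceil _
    have hup : (s'.card : ℝ) * p ≤ M + 1 := by
      have h1 := Nat.ceil_lt_add_one (div_nonneg hM hp0.le)
      rw [hcard]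
      have h2 := mul_le_mul_of_nonneg_right h1.le hp0.le
      rw [add_mul, div_mul_cancel₀ _ hp0.ne'] at h2
      linarith
    have h1 := hcore s' hs' hup
    have h2 := hmono s' hs'
    have h3 : Real.exp (-(s'.card * p)) ≤ Real.exp (-M) := Real.exp_le_exp.2 (by linarith)
    have h4 : Real.exp (-(s.card * p)) ≤ Real.exp (-M) := Real.exp_le_exp.2 (by linarith)
    have h5 := (Real.exp_pos (-(s.card * p))).le
    have h6 : 0 ≤ P.real {ω | ∀ i ∈ s, ω ∉ E' i} := measureReal_nonneg
    rw [abs_le] at h1 ⊢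
    constructor <;> linarith [h1.1, h1.2, abs_nonneg
      (P.real {ω | ∀ i ∈ s', ω ∉ E i} - Real.exp (-(s'.card * p)))]

end Bonferroni

/-! ### Clusters -/

theorem dist_toPlane (x y : Site) : dist (toPlane x) (toPlane y) =
    √(((x.1 : ℝ) - y.1) ^ 2 + ((x.2 : ℝ) - y.2) ^ 2) := by
  simp [EuclideanSpace.dist_eq, toPlane, Fin.sum_univ_two, Real.dist_eq, sq_abs]

theorem logKernel_sub (x y : Site) :
    logKernel (x - y) = 1 / 2 * Real.log (dist (toPlane x) (toPlane y) ^ 2 + 1) := by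
  rw [dist_toPlane, Real.sq_sqrt (by positivity), logKernel]
  simp

theorem le_logKernel_sub {x y : Site} {c : ℝ} (h : Real.exp c ≤ dist (toPlane x) (toPlane y)) :
    c ≤ logKernel (x - y) := by
  have hc := Real.exp_pos c
  have h1 : Real.log (Real.exp c ^ 2) ≤ Real.log (dist (toPlane x) (toPlane y) ^ 2 + 1) :=
    Real.log_le_log (by positivity) (by nlinarith)
  rw [logKernel_sub]
  rw [Real.log_pow, Real.log_exp] at h1
  push_cast at h1
  linarith

theorem logKernel_sub_le {x y : Site} {c b : ℝ} (hc : 0 ≤ c)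
    (h : dist (toPlane x) (toPlane y) ≤ b * Real.exp c) :
    logKernel (x - y) ≤ c + 1 / 2 * Real.log (b ^ 2 + 1) := by
  have h1 : dist (toPlane x) (toPlane y) ^ 2 + 1 ≤ (b ^ 2 + 1) * Real.exp c ^ 2 := by
    have := pow_le_pow_left₀ dist_nonneg h 2
    have := one_le_pow₀ (n := 2) (Real.one_le_exp hc)
    nlinarith
  have h2 := Real.log_le_log (by positivity) h1
  rw [Real.log_mul (by positivity) (by positivity), Real.log_pow, Real.log_exp] at h2
  rw [logKernel_sub]
  push_cast at h2
  linarith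

/-- Rounding both coordinates gives the distance `√2 / 2` times the mesh, and `√2 / 2 ≤ 3 / 4`. -/
theorem exists_scaledLattice_near (x : Site) (k : ℕ) :
    ∃ z ∈ scaledLattice k, dist (toPlane z) (toPlane x) ≤ 3 / 4 * Real.exp k := by
  have hN : (1 : ℝ) ≤ (⌊Real.exp k⌋ : ℝ) := by
    exact_mod_cast Int.le_floor.2 (by simp)
  have hle : (⌊Real.exp k⌋ : ℝ) ≤ Real.exp k := Int.floor_le _
  refine ⟨_, ⟨(round ((x.1 : ℝ) / ⌊Real.exp k⌋), round ((x.2 : ℝ) / ⌊Real.exp k⌋)), rfl⟩, ?_⟩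
  rw [dist_toPlane]
  push_cast
  generalize (⌊Real.exp k⌋ : ℝ) = N at *
  have hN0 : 0 < N := by linarith
  have key : ∀ a : ℝ, (N * round (a / N) - a) ^ 2 ≤ (N / 2) ^ 2 := by
    intro a
    have h := abs_sub_round (a / N)
    have e : N * round (a / N) - a = -(N * (a / N - round (a / N))) := by
      field_simp
      ring
    rw [e, neg_sq, ← sq_abs, abs_mul, abs_of_pos hN0]
    gcongr
    linarith [mul_le_mul_of_nonneg_left h hN0.le]
  refine Real.sqrt_le_iff.2 ⟨by positivity, ?_⟩
  have h1 := key x.1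
  have h2 := key x.2
  have h3 := pow_le_pow_left₀ hN0.le hle 2
  nlinarith

theorem mem_latticeBall {x y : Site} {k : ℕ} :
    y ∈ latticeBall x k ↔ dist (toPlane x) (toPlane y) < Real.exp k := Iff.rfl

theorem exists_subset_latticeBall_logScale {U : Set Site} (hU : U.Finite) :
    ∃ y, U ⊆ latticeBall y (logScale U) := by
  have hne : {k : ℕ | ∃ y ∈ scaledLattice k, U ⊆ latticeBall y k}.Nonempty := by
    obtain ⟨R, hR⟩ := (hU.image fun x => dist (toPlane 0) (toPlane x)).bddAbove
    obtain ⟨k, hk⟩ := exists_nat_gt R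
    refine ⟨k, 0, ⟨0, by ext <;> simp⟩, fun x hx => ?_⟩
    have h1 := hR (Set.mem_image_of_mem _ hx)
    have h2 := Real.add_one_le_exp (k : ℝ)
    rw [mem_latticeBall]
    linarith
  obtain ⟨y, _, hy⟩ := Nat.sInf_mem hne
  exact ⟨y, hy⟩

theorem card_le_of_dist_le {K : Finset Site} {x : Site} {R : ℝ} (hR : 1 ≤ R)
    (h : ∀ y ∈ K, dist (toPlane x) (toPlane y) ≤ R) : (K.card : ℝ) ≤ 9 * R ^ 2 := by
  have hsub : K ⊆ Finset.Icc (x.1 - ⌊R⌋₊) (x.1 + ⌊R⌋₊) ×ˢ Finset.Icc (x.2 - ⌊R⌋₊) (x.2 + ⌊R⌋₊) := by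
    intro y hy
    have h1 := h y hy
    rw [dist_toPlane, Real.sqrt_le_iff] at h1
    have key : ∀ a b : ℤ, ((a : ℝ) - b) ^ 2 ≤ R ^ 2 → a - ⌊R⌋₊ ≤ b ∧ b ≤ a + ⌊R⌋₊ := by
      intro a b hab
      have h2 := abs_le_of_sq_le_sq hab (by linarith)
      have h3 : (a - b).natAbs ≤ ⌊R⌋₊ := by
        refine Nat.le_floor ?_
        rw [Nat.cast_natAbs]
        push_cast
        exact h2
      omega
    rw [Finset.mem_product, Finset.mem_Icc, Finset.mem_Icc]
    exact ⟨key _ _ (by nlinarith), key _ _ (by nlinarith)⟩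
  have h1 := Finset.card_le_card hsub
  rw [Finset.card_product, Int.card_Icc, Int.card_Icc] at h1
  have h2 : K.card ≤ (2 * ⌊R⌋₊ + 1) * (2 * ⌊R⌋₊ + 1) := by
    refine h1.trans (Nat.mul_le_mul ?_ ?_) <;> omega
  have h3 := Nat.floor_le (show 0 ≤ R by linarith)
  have h4 : (K.card : ℝ) ≤ (2 * (⌊R⌋₊ : ℝ) + 1) * (2 * (⌊R⌋₊ : ℝ) + 1) := by exact_mod_cast h2
  have h5 : (0 : ℝ) ≤ ⌊R⌋₊ := Nat.cast_nonneg _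
  nlinarith

/-- The optimal cover of a clustered set by balls splits the set into small clusters, one for each
ball, with well separated representatives: two close clusters could be covered by a single ball. -/
theorem IsClustered.exists_decomposition {a b : ℝ} {A : Set Site} (hA : IsClustered a b A)
    (hfin : A.Finite) (hne : A.Nonempty) (hab : 40 * Real.exp a ≤ Real.exp ⌊b⌋₊) :
    ∃ (x : Fin (clusteringNumber b A) → Site) (K : Fin (clusteringNumber b A) → Finset Site),
      (∀ i, x i ∈ K i) ∧ A = ⋃ i, (K i : Set Site) ∧
      (∀ i, ∀ y ∈ K i, dist (toPlane (x i)) (toPlane y) ≤ 2 * Real.exp a) ∧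
      ∀ i j, i ≠ j → 1 / 10 * Real.exp ⌊b⌋₊ ≤ dist (toPlane (x i)) (toPlane (x j)) := by
  classical
  set k := ⌊b⌋₊ with hk
  set T : Set ℕ := {m : ℕ | 1 ≤ m ∧ ∃ z : Fin m → Site, (∀ i, z i ∈ scaledLattice k) ∧
    A ⊆ ⋃ i, latticeBall (z i) k} with hT
  have hmin : ∀ m ∈ T, clusteringNumber b A ≤ m := fun m hm => Nat.sInf_le hm
  have hTne : T.Nonempty := by
    choose z hz hzd using fun x => exists_scaledLattice_near x k
    refine ⟨hfin.toFinset.card, Finset.card_pos.2 (by simpa using hne),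
      fun i => z (hfin.toFinset.equivFin.symm i), fun i => hz _, fun x hx => ?_⟩
    refine Set.mem_iUnion.2 ⟨hfin.toFinset.equivFin ⟨x, by simpa using hx⟩, ?_⟩
    simp only [Equiv.symm_apply_apply, mem_latticeBall]
    have := hzd x
    have := Real.exp_pos (k : ℝ)
    linarith
  have hmem : clusteringNumber b A ∈ T := Nat.sInf_mem hTne
  generalize clusteringNumber b A = m at *
  obtain ⟨hm1, z, hz, hcov⟩ := hmem
  -- a ball of an optimal cover cannot be dropped
  have hKne : ∀ i, (latticeBall (z i) k ∩ A).Nonempty := by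
    intro i
    by_contra hempty
    rw [Set.not_nonempty_iff_eq_empty] at hempty
    have hother : ∀ x ∈ A, ∃ j, j ≠ i ∧ x ∈ latticeBall (z j) k := by
      intro x hx
      obtain ⟨j, hj⟩ := Set.mem_iUnion.1 (hcov hx)
      refine ⟨j, ?_, hj⟩
      rintro rfl
      exact (Set.mem_empty_iff_false x).1 (hempty ▸ ⟨hj, hx⟩)
    obtain ⟨m, rfl⟩ : ∃ m', m = m' + 1 := ⟨m - 1, by omega⟩
    obtain ⟨x, hx⟩ := hne
    have hm0 : 1 ≤ m := by
      obtain ⟨j, hj, _⟩ := hother x hx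
      by_contra h
      exact hj (Fin.ext (by omega))
    have := hmin m ⟨hm0, z ∘ i.succAbove, fun j => hz _, fun y hy => by
      obtain ⟨j, hj, hyj⟩ := hother y hy
      obtain ⟨j, rfl⟩ := Fin.exists_succAbove_eq hj
      exact Set.mem_iUnion.2 ⟨j, hyj⟩⟩
    omega
  choose x hx using hKne
  have hKfin : ∀ i, (latticeBall (z i) k ∩ A).Finite := fun i => hfin.subset Set.inter_subset_right
  have hsmall : ∀ i, ∀ y ∈ latticeBall (z i) k ∩ A,
      dist (toPlane (x i)) (toPlane y) ≤ 2 * Real.exp a := by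
    intro i y hy
    obtain ⟨w, hw⟩ := exists_subset_latticeBall_logScale (hKfin i)
    have h1 := hw (hx i)
    have h2 := hw hy
    rw [mem_latticeBall] at h1 h2
    have h3 := Real.exp_le_exp.2 (hA (z i) (hz i))
    have h4 := dist_triangle_left (toPlane (x i)) (toPlane y) (toPlane w)
    rw [← hk] at h3
    linarith
  refine ⟨x, fun i => (hKfin i).toFinset, fun i => by simpa using hx i, ?_,
    fun i y hy => hsmall i y (by simpa using hy), ?_⟩
  · ext y
    simp only [Set.Finite.coe_toFinset, Set.mem_iUnion]
    constructor
    · intro hy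
      obtain ⟨j, hj⟩ := Set.mem_iUnion.1 (hcov hy)
      exact ⟨j, hj, hy⟩
    · rintro ⟨j, hj⟩
      exact hj.2
  · intro i j hij
    by_contra! hlt
    obtain ⟨w, hw, hwd⟩ := exists_scaledLattice_near (x i) k
    -- the ball around `w` covers both clusters, as `3 / 4 + 1 / 10 + 2 / 40 < 1`
    have hw1 : ∀ y ∈ latticeBall (z i) k ∩ A, y ∈ latticeBall w k := by
      intro y hy
      have h1 := hsmall i y hy
      have h2 := dist_triangle (toPlane w) (toPlane (x i)) (toPlane y)
      have h3 := Real.exp_pos (k : ℝ)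
      rw [mem_latticeBall]
      linarith
    have hw2 : ∀ y ∈ latticeBall (z j) k ∩ A, y ∈ latticeBall w k := by
      intro y hy
      have h1 := hsmall j y hy
      have h2 := dist_triangle4 (toPlane w) (toPlane (x i)) (toPlane (x j)) (toPlane y)
      have h3 := Real.exp_pos (k : ℝ)
      rw [mem_latticeBall]
      linarith
    obtain ⟨m, rfl⟩ : ∃ m', m = m' + 1 := ⟨m - 1, by omega⟩
    have hm0 : 1 ≤ m := by
      by_contra h
      exact hij (Fin.ext (by omega))
    have := hmin m ⟨hm0, (Function.update z i w) ∘ j.succAbove, fun l => ?_, fun y hy => ?_⟩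
    · omega
    · simp only [Function.comp_apply, Function.update_apply]
      split_ifs
      · exact hw
      · exact hz _
    · have hyw : y ∈ latticeBall w k → y ∈ ⋃ l, latticeBall
          (((Function.update z i w) ∘ j.succAbove) l) k := by
        intro h
        obtain ⟨l, hl⟩ := Fin.exists_succAbove_eq hij
        refine Set.mem_iUnion.2 ⟨l, ?_⟩
        rwa [Function.comp_apply, hl, Function.update_self]
      obtain ⟨l, hl⟩ := Set.mem_iUnion.1 (hcov hy)
      by_cases hli : l = i
      · subst hli
        exact hyw (hw1 y ⟨hl, hy⟩)
      by_cases hlj : l = j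
      · subst hlj
        exact hyw (hw2 y ⟨hl, hy⟩)
      obtain ⟨l', rfl⟩ := Fin.exists_succAbove_eq hlj
      refine Set.mem_iUnion.2 ⟨l', ?_⟩
      rwa [Function.comp_apply, Function.update_of_ne hli]

theorem clusteringNumber_empty (b : ℝ) : clusteringNumber b ∅ = 1 := by
  have h1 : 1 ∈ {k : ℕ | 1 ≤ k ∧ ∃ z : Fin k → Site, (∀ i, z i ∈ scaledLattice ⌊b⌋₊) ∧
      (∅ : Set Site) ⊆ ⋃ i, latticeBall (z i) ⌊b⌋₊} :=
    ⟨le_rfl, fun _ => 0, fun _ => ⟨0, by ext <;> simp⟩, Set.empty_subset _⟩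
  exact le_antisymm (Nat.sInf_le h1) (Nat.sInf_mem ⟨1, h1⟩).1

/-! ### The Green function of the lattice domain -/

section Domain

variable {D : Set Plane}

theorem smul_toPlane_mem {n : ℝ} {x : Site} (hx : x ∈ latticeDomain D n) :
    (Real.exp n)⁻¹ • toPlane x ∈ D := by
  by_contra h
  have h1 : 1 / Real.exp n < Metric.infDist ((Real.exp n)⁻¹ • toPlane x) Dᶜ := hx
  rw [Metric.infDist_zero_of_mem h] at h1
  exact absurd h1 (not_lt.2 (by positivity))

theorem exists_norm_toPlane_le (hD : Bornology.IsBounded D) :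
    ∃ R, 0 ≤ R ∧ ∀ n, ∀ x ∈ latticeDomain D n, ‖toPlane x‖ ≤ R * Real.exp n := by
  obtain ⟨R, hR0, hR⟩ := hD.exists_pos_norm_le
  refine ⟨R, hR0.le, fun n x hx => ?_⟩
  have h := hR _ (smul_toPlane_mem hx)
  rwa [norm_smul, norm_inv, Real.norm_of_nonneg (Real.exp_pos n).le, inv_mul_le_iff₀
    (Real.exp_pos n), mul_comm] at h

theorem norm_toPlane (x : Site) : ‖toPlane x‖ = √((x.1 : ℝ) ^ 2 + (x.2 : ℝ) ^ 2) := by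
  simp [EuclideanSpace.norm_eq, toPlane, Fin.sum_univ_two, sq_abs]

theorem finite_latticeDomain (hD : Bornology.IsBounded D) (n : ℝ) :
    (latticeDomain D n).Finite := by
  obtain ⟨R, hR0, hR⟩ := exists_norm_toPlane_le hD
  set B := R * Real.exp n with hB
  have hB0 : 0 ≤ B := by positivity
  refine ((Set.finite_Icc (-(⌊B⌋₊ : ℤ)) ⌊B⌋₊).prod (Set.finite_Icc (-(⌊B⌋₊ : ℤ)) ⌊B⌋₊)).subset
    fun x hx => ?_
  have h := hR n x hx
  rw [norm_toPlane, Real.sqrt_le_iff] at h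
  have key : ∀ a : ℤ, (a : ℝ) ^ 2 ≤ B ^ 2 → a ∈ Icc (-(⌊B⌋₊ : ℤ)) ⌊B⌋₊ := by
    intro a ha
    have h2 := abs_le_of_sq_le_sq ha hB0
    have h3 : a.natAbs ≤ ⌊B⌋₊ := by
      refine Nat.le_floor ?_
      rw [Nat.cast_natAbs]
      push_cast
      exact h2
    rw [Set.mem_Icc]
    omega
  exact ⟨key _ (by nlinarith), key _ (by nlinarith)⟩

theorem eventually_latticeDomain_nonempty (hD : IsNice D) :
    ∀ᶠ n : ℝ in atTop, (latticeDomain D n).Nonempty := by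
  have hne : (Dᶜ).Nonempty := by
    rw [Set.nonempty_compl]
    rintro rfl
    exact NormedSpace.unbounded_univ ℝ Plane hD.isBounded
  have hpos : 0 < Metric.infDist (0 : Plane) Dᶜ := by
    rw [← hD.isOpen.isClosed_compl.notMem_iff_infDist_pos hne]
    exact fun h => h hD.zero_mem
  have h1 : Tendsto (fun n : ℝ => 1 / Real.exp n) atTop (𝓝 0) := by
    simpa [Real.exp_neg] using Real.tendsto_exp_neg_atTop_nhds_zero
  filter_upwards [h1.eventually (gt_mem_nhds hpos)] with n hn
  refine ⟨0, ?_⟩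
  have h0 : toPlane 0 = 0 := by
    ext i; fin_cases i <;> simp [toPlane]
  change 1 / Real.exp n < Metric.infDist ((Real.exp n)⁻¹ • toPlane 0) Dᶜ
  rwa [h0, smul_zero]

theorem domainBulk_subset (D : Set Plane) (n : ℝ) : domainBulk D n ⊆ latticeDomain D n := by
  intro x hx
  by_contra h
  have h1 : Real.exp _ < Metric.infDist (toPlane x) (toPlane '' (latticeDomain D n)ᶜ) := hx
  rw [Metric.infDist_zero_of_mem (Set.mem_image_of_mem _ h)] at h1
  exact absurd h1 (not_lt.2 (by positivity))

theorem dist_toPlane_of_mem_nbrs {x y : Site} (h : y ∈ nbrs x) :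
    dist (toPlane x) (toPlane y) ≤ 1 := by
  rw [mem_nbrs, LatticeAdj] at h
  rw [dist_toPlane]
  refine Real.sqrt_le_iff.2 ⟨zero_le_one, ?_⟩
  have h1 : |x.1 - y.1| ^ 2 + |x.2 - y.2| ^ 2 ≤ 1 := by
    nlinarith [abs_nonneg (x.1 - y.1), abs_nonneg (x.2 - y.2)]
  rw [sq_abs, sq_abs] at h1
  rw [one_pow]
  exact_mod_cast h1

/-- In the lattice domain of scale `e ^ n` the Green function is `n - log |x - y|`, up to a bounded
error from above, and up to `2 log n` from below if one point is in the bulk. -/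
theorem exists_green_bounds (hD : Bornology.IsBounded D) : ∃ C, 0 ≤ C ∧ ∀ n, 0 ≤ n →
    ∀ F : Finset Site, (F : Set Site) = latticeDomain D n →
      (∀ x ∈ F, ∀ y ∈ F, green F x y ≤ n + C - logKernel (x - y)) ∧
      ∀ x ∈ F, ∀ y ∈ domainBulk D n,
        n - 2 * Real.log n - C - logKernel (x - y) ≤ green F x y := by
  obtain ⟨R, hR0, hR⟩ := exists_norm_toPlane_le hD
  have hlog : 0 ≤ 1 / 2 * Real.log ((2 * R + 1) ^ 2 + 1) :=
    mul_nonneg (by norm_num) (Real.log_nonneg (by nlinarith))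
  refine ⟨greenError + 1 / 2 * Real.log ((2 * R + 1) ^ 2 + 1),
    add_nonneg greenError_nonneg hlog, fun n hn F hF => ?_⟩
  have hmem : ∀ x, x ∈ F ↔ x ∈ latticeDomain D n := fun x => by rw [← hF, Finset.mem_coe]
  constructor
  · intro x hx y hy
    have h := green_le (U := F) (y := y) (b := n + 1 / 2 * Real.log ((2 * R + 1) ^ 2 + 1))
      (fun w hw z hz _ => logKernel_sub_le hn ?_) hx
    · linarith
    · have h1 := dist_toPlane_of_mem_nbrs hz
      have h2 := hR n w ((hmem w).1 hw)
      have h3 := hR n y ((hmem y).1 hy)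
      have h4 := dist_triangle_left (toPlane z) (toPlane y) (toPlane w)
      have h5 := dist_le_norm_add_norm (toPlane w) (toPlane y)
      have h6 := Real.one_le_exp hn
      linarith
  · intro x hx y hy
    have h := le_green (U := F) (y := y) (b := n - 2 * Real.log n)
      (fun w hw z _ hzF => le_logKernel_sub ?_) hx
    · linarith
    · have h1 : Real.exp (n - 2 * Real.log n) <
          Metric.infDist (toPlane y) (toPlane '' (latticeDomain D n)ᶜ) := hy
      have h2 := Metric.infDist_le_dist_of_mem (x := toPlane y)
        (Set.mem_image_of_mem toPlane (show z ∈ (latticeDomain D n)ᶜ from fun h => hzF ((hmem z).2 h)))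
      rw [dist_comm] at h2
      linarith

end Domain

/-! ### Probability estimates at a fixed scale -/

namespace IsOccupationField

variable {F : Finset Site} {Ω : Type*} [MeasurableSpace Ω] {P : Measure Ω} {t M : ℝ}
  {L : Site → Ω → ℝ}

/-- Well separated sites are visited nearly independently, upper bound: a site of the domain is
close to at most one of them. -/
theorem prob_separated_unvisited_le (hL : IsOccupationField F P t L) (ht : 0 ≤ t)
    (hup : ∀ x ∈ F, ∀ y ∈ F, green F x y ≤ M - logKernel (x - y)) {J : Finset Site} (hJ : J ⊆ F)
    {c : ℝ} (hM : 0 < M) (hcM : c ≤ M)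
    (hsep : ∀ x ∈ J, ∀ y ∈ J, x ≠ y → 2 * Real.exp c ≤ dist (toPlane x) (toPlane y)) :
    P.real {ω | ∀ x ∈ J, L x ω = 0} ≤ Real.exp (-(J.card * (t / (M + J.card * (M - c))))) := by
  have hpos : 0 < M + J.card * (M - c) :=
    add_pos_of_pos_of_nonneg hM (mul_nonneg (Nat.cast_nonneg _) (sub_nonneg.2 hcM))
  refine (hL.prob_unvisited_le ht hJ (α := 1 / (M + J.card * (M - c))) fun x hx => ?_).trans_eq ?_
  · rw [div_mul_eq_mul_div, one_mul, div_le_one hpos]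
    obtain ⟨y₀, hy₀⟩ : ∃ y₀, ∀ y ∈ J, y ≠ y₀ → Real.exp c ≤ dist (toPlane x) (toPlane y) := by
      by_contra! h
      obtain ⟨y, hy, _, hxy⟩ := h x
      obtain ⟨z, hz, hzy, hxz⟩ := h y
      have := hsep z hz y hy hzy
      have := dist_triangle_left (toPlane z) (toPlane y) (toPlane x)
      linarith
    have hle : ∀ y ∈ J, green F x y ≤ (M - c) + if y = y₀ then c else 0 := by
      intro y hy
      have h1 := hup x hx y (hJ hy)
      split_ifs with h
      · linarith [logKernel_nonneg (x - y)]
      · linarith [le_logKernel_sub (hy₀ y hy h)]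
    refine (Finset.sum_le_sum hle).trans ?_
    rw [Finset.sum_add_distrib, Finset.sum_const, nsmul_eq_mul, Finset.sum_ite_eq']
    split_ifs <;> linarith
  · congr 1
    ring

/-- Sites are visited nearly independently, lower bound. -/
theorem le_prob_set_unvisited [IsProbabilityMeasure P] (hL : IsOccupationField F P t L)
    (ht : 0 ≤ t) {J : Finset Site} (hJ : J ⊆ F) {m : ℝ} (hm : 0 < m)
    (hlow : ∀ x ∈ J, m ≤ green F x x) :
    Real.exp (-(J.card * (t / m))) ≤ P.real {ω | ∀ x ∈ J, L x ω = 0} := by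
  refine le_of_eq_of_le ?_ (hL.le_prob_unvisited ht hJ (α := 1 / m) (by positivity) fun x hx => ?_)
  · congr 1
    ring
  · rw [div_mul_eq_mul_div, one_mul, le_div_iff₀ hm, one_mul]
    exact (hlow x hx).trans (Finset.single_le_sum (f := fun y => green F x y)
      (fun y _ => green_nonneg x y) hx)

/-- If the Green function varies by at most `R` on the cluster `K`, then the cluster is hardly more
likely to be hit by the unvisited set than a single one of its sites `x`: either the local time at
`x` is at most `a`, or some site of `K` is missed although the local time at `x` exceeds `a`. -/
theorem prob_exists_unvisited_le [IsProbabilityMeasure P] (hL : IsOccupationField F P t L)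
    (ht : 0 ≤ t) (hup : ∀ x ∈ F, ∀ y ∈ F, green F x y ≤ M) {K : Finset Site} (hK : K ⊆ F)
    {x : Site} (hx : x ∈ K) {R : ℝ} (hR : 1 ≤ R) (hRM : 2 * R ≤ M)
    (hlow : ∀ y ∈ K, M - R ≤ green F x y ∧ M - R ≤ green F y y) {l a : ℝ} (hl : 0 < l)
    (ha : 0 ≤ a) :
    P.real {ω | ∃ y ∈ K, L y ω = 0} ≤ Real.exp (l * a) * Real.exp (-(t / (M + 1 / l))) +
      K.card * Real.exp (-(a / (8 * R)) + R * (t / M ^ 2)) := by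
  have hM : 0 < M := by linarith
  have hsmall : P.real {ω | L x ω ≤ a} ≤
      Real.exp (l * a) * Real.exp (-(t / (M + 1 / l))) := by
    refine (hL.prob_le_of_small (hK hx) hl a).trans ?_
    gcongr Real.exp (l * a) * Real.exp (-?_)
    have hg := green_nonneg (U := F) x x
    have e : t / (M + 1 / l) = l / (1 + l * M) * t := by
      field_simp
      ring
    rw [e]
    gcongr
    exact hup x (hK hx) x (hK hx)
  have hlarge : ∀ y ∈ K, P.real {ω | a < L x ω ∧ L y ω = 0} ≤
      Real.exp (-(a / (8 * R)) + R * (t / M ^ 2)) := by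
    intro y hy
    by_cases hxy : x = y
    · have : {ω | a < L x ω ∧ L y ω = 0} = ∅ := by
        ext ω
        simp only [Set.mem_ofPred_eq, Set.mem_empty_iff_false, iff_false, not_and]
        intro h h'
        rw [hxy] at h
        linarith
      rw [this, measureReal_empty]
      positivity
    have hxx := hup x (hK hx) x (hK hx)
    have hyy := hup y (hK hy) y (hK hy)
    have hdiag := green_le_diag (U := F) x y
    obtain ⟨h1, h2⟩ := hlow y hy
    set g := green F x y with hg
    set d := green F y y with hd
    have hd0 : M / 2 ≤ d := by linarith
    have hdpos : 0 < d := by linarith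
    have hh0 : 0 ≤ 1 - g / d := by rw [sub_nonneg, div_le_one hdpos]; exact hdiag
    have hh1 : 1 - g / d ≤ 2 * R / M := by
      rw [sub_le_comm, le_div_iff₀ hdpos]
      have : (1 - 2 * R / M) * d = d - 2 * R / M * d := by ring
      have h3 : R ≤ 2 * R / M * d := by
        calc R = 2 * R / M * (M / 2) := by field_simp
          _ ≤ _ := by gcongr
      linarith
    have hD : green F x x - g * g / d ≤ 2 * R := by
      have : (M - 2 * R) ≤ g * g / d := by
        rw [le_div_iff₀ hdpos]
        nlinarith
      linarith
    have hθ : 0 < 1 / (8 * R) := by positivity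
    have hθD : 1 / (8 * R) * (green F x x - g * g / d) ≤ 1 / 4 := by
      calc 1 / (8 * R) * (green F x x - g * g / d) ≤ 1 / (8 * R) * (2 * R) := by gcongr
        _ = 1 / 4 := by field_simp; norm_num
    refine (hL.prob_large_and_unvisited_le (hK hx) (hK hy) hxy (θ := 1 / (8 * R)) (a := a) hdpos
      rfl rfl hθ ?_ (by linarith) ht).trans ?_
    · rw [div_lt_div_iff₀ (by positivity) (by norm_num)]
      linarith
    rw [← Real.exp_add, Real.exp_le_exp]
    have e1 : -(1 / (8 * R) * a) = -(a / (8 * R)) := by ring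
    rw [e1]
    refine add_le_add le_rfl ?_
    set D' := green F x x - g * g / d
    set h := 1 - g / d
    have h4 : 1 / (8 * R) * h / (1 - 1 / (8 * R) * D') ≤ 1 / (8 * R) * h / (1 / 2) := by
      gcongr
      linarith
    calc 1 / (8 * R) * h / (1 - 1 / (8 * R) * D') * h * t
        ≤ 1 / (8 * R) * h / (1 / 2) * h * t := by gcongr
      _ = 1 / (4 * R) * h ^ 2 * t := by ring
      _ ≤ 1 / (4 * R) * (2 * R / M) ^ 2 * t := by gcongr
      _ = R * (t / M ^ 2) := by field_simp; norm_num
  have hcov : {ω | ∃ y ∈ K, L y ω = 0} ⊆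
      {ω | L x ω ≤ a} ∪ ⋃ y ∈ K, {ω | a < L x ω ∧ L y ω = 0} := by
    rintro ω ⟨y, hy, h⟩
    rcases le_or_gt (L x ω) a with h1 | h1
    · exact Or.inl h1
    · exact Or.inr (Set.mem_iUnion₂.2 ⟨y, hy, h1, h⟩)
  refine (measureReal_mono hcov).trans ((measureReal_union_le _ _).trans (add_le_add hsmall ?_))
  refine (measureReal_biUnion_finset_le _ _).trans ((Finset.sum_le_sum hlarge).trans_eq ?_)
  rw [Finset.sum_const, nsmul_eq_mul]

end IsOccupationField

/-- The Poisson approximation for a clustered set at a fixed scale. One representative for each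
cluster yields nearly independent events, and the clusters are replaced by their
representatives. The hypotheses `h1`, `h2` say that the visits to the representatives are nearly
independent, and `h3` that a cluster is hardly more likely to contain an unvisited site than its
representative to be one. -/
theorem IsOccupationField.abs_prob_clustered_sub_exp_le {F : Finset Site} {Ω : Type*}
    [MeasurableSpace Ω] {P : Measure Ω} [IsProbabilityMeasure P] {t : ℝ} {L : Site → Ω → ℝ}
    (hL : IsOccupationField F P t L) (ht : 0 ≤ t) {A : Set Site} (hAF : A ⊆ F) (hne : A.Nonempty)
    {M m : ℝ} (hm : 0 < m)
    (hup : ∀ x ∈ F, ∀ y ∈ F, green F x y ≤ M - logKernel (x - y))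
    (hlow : ∀ x ∈ F, ∀ y ∈ A, m - logKernel (x - y) ≤ green F x y)
    {r b : ℝ} (hr : 0 ≤ r) (hA : IsClustered r b A) (hrb : 40 * Real.exp r ≤ Real.exp ⌊b⌋₊)
    {c : ℝ} (hcM : c ≤ M) (hcb : 2 * Real.exp c ≤ 1 / 10 * Real.exp ⌊b⌋₊)
    {R : ℝ} (hR : 1 ≤ R) (hRM : 2 * R ≤ M) (hRm : M - R ≤ m - (r + 1 / 2 * Real.log (2 ^ 2 + 1)))
    {l a : ℝ} (hl : 0 < l) (ha : 0 ≤ a) {K : ℕ} (hK : 1 ≤ K) {p δ B : ℝ} (hp0 : 0 < p) (hp1 : p ≤ 1)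
    (hδ0 : 0 ≤ δ) (hB : 0 ≤ B)
    (h1 : ∀ j : ℕ, j ≤ K → Real.exp (-(j * (t / (M + j * (M - c))))) ≤ (1 + δ) * p ^ j)
    (h2 : ∀ j : ℕ, j ≤ K → (1 - δ) * p ^ j ≤ Real.exp (-(j * (t / m))))
    (h3 : Real.exp (l * a) * Real.exp (-(t / (M + 1 / l))) +
      36 * Real.exp r ^ 2 * Real.exp (-(a / (8 * R)) + R * (t / M ^ 2)) ≤ (1 + δ) * p) :
    |P.real {ω | ∀ y ∈ A, L y ω ≠ 0} - Real.exp (-(clusteringNumber b A * p))| ≤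
      Real.exp (-B) + δ * Real.exp (B + 1) + (2 + δ) * ((B + 1) ^ K / K.factorial) +
        (B + 1) * p + 2 * δ * (B + 1) := by
  classical
  obtain ⟨x, C, hxC, hAC, hdist, hsep⟩ :=
    hA.exists_decomposition (F.finite_toSet.subset hAF) hne hrb
  have hCA : ∀ i, ∀ y ∈ C i, y ∈ A := fun i y hy => by
    rw [hAC]; exact Set.mem_iUnion.2 ⟨i, hy⟩
  have hCF : ∀ i, C i ⊆ F := fun i y hy => hAF (hCA i y hy)
  have hlog0 : logKernel 0 = 0 := by simp [logKernel]
  have hlow' : ∀ y ∈ A, m ≤ green F y y := fun y hy => by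
    have := hlow y (hAF hy) y hy
    rwa [sub_self, hlog0, sub_zero] at this
  have hinj : Function.Injective x := by
    intro i j hij
    by_contra h
    have h4 := hsep i j h
    rw [hij, dist_self] at h4
    have := Real.exp_pos (⌊b⌋₊ : ℝ)
    linarith
  have hM : 0 < M := by linarith
  have hmain := abs_prob_none_sub_exp_le (P := P) (E := fun i => {ω | L (x i) ω = 0})
    (E' := fun i => {ω | ∃ y ∈ C i, L y ω = 0})
    (fun i => measurableSet_eq_fun (hL.measurable _) measurable_const) Finset.univ hK hp0 hp1 hδ0
    hB (fun J _ hJ => ?_) (fun i _ ω hω => ⟨x i, hxC i, hω⟩) (fun i _ => ?_)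
  · rw [Finset.card_univ, Fintype.card_fin] at hmain
    convert hmain using 4
    ext ω
    simp only [Finset.mem_univ, Set.mem_ofPred_eq, not_exists, not_and, forall_const]
    refine ⟨fun h i y hy => h y (hCA i y hy), fun h y hy => ?_⟩
    rw [hAC] at hy
    obtain ⟨i, hi⟩ := Set.mem_iUnion.1 hy
    exact h i y hi
  · have hset : {ω | ∀ i ∈ J, ω ∈ {ω | L (x i) ω = 0}} = {ω | ∀ y ∈ J.image x, L y ω = 0} := by
      ext ω; simp
    have hJF : J.image x ⊆ F := by
      intro y hy
      obtain ⟨i, _, rfl⟩ := Finset.mem_image.1 hy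
      exact hCF i (hxC i)
    have h4 := hL.prob_separated_unvisited_le ht hup hJF (c := c) hM hcM (by
      intro y hy z hz hyz
      obtain ⟨i, _, rfl⟩ := Finset.mem_image.1 hy
      obtain ⟨j, _, rfl⟩ := Finset.mem_image.1 hz
      exact hcb.trans (hsep i j fun h => hyz (by rw [h])))
    have h5 := hL.le_prob_set_unvisited ht hJF hm (by
      intro y hy
      obtain ⟨i, _, rfl⟩ := Finset.mem_image.1 hy
      exact hlow' _ (hCA i _ (hxC i)))
    rw [Finset.card_image_of_injective _ hinj] at h4 h5
    rw [hset, abs_le]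
    constructor <;> linarith [h1 _ hJ, h2 _ hJ]
  · have h4 : ∀ y ∈ C i, M - R ≤ green F (x i) y ∧ M - R ≤ green F y y := by
      intro y hy
      have h5 := hlow (x i) (hCF i (hxC i)) y (hCA i y hy)
      have h6 := logKernel_sub_le hr (hdist i y hy)
      have h7 := hlow' y (hCA i y hy)
      have h8 := (logKernel_nonneg _).trans (logKernel_sub_le hr (hdist i y hy))
      constructor <;> linarith
    have h5 := hL.prob_exists_unvisited_le ht
      (fun x hx y hy => (hup x hx y hy).trans (sub_le_self _ (logKernel_nonneg _)))
      (hCF i) (hxC i) hR hRM h4 hl ha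
    refine h5.trans (le_trans ?_ h3)
    gcongr
    have h6 := card_le_of_dist_le (R := 2 * Real.exp r)
      (by linarith [Real.one_le_exp hr]) (hdist i)
    linarith

/-- The unvisited set agrees almost surely with the zero set of an occupation field. The events need
not be measurable, as the trajectory is only determined almost surely. -/
theorem IsWiredWalk.exists_prob_lowSites_eq {U : Set Site} (hU : U.Finite) (hne : U.Nonempty)
    {Ω : Type*} [MeasurableSpace Ω] {P : Measure Ω} [IsProbabilityMeasure P]
    {X : ℝ → Ω → WiredVertex U} (hX : IsWiredWalk U (1 / (2 * Real.pi)) P X) {t : ℝ}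
    (ht : 0 ≤ t) :
    ∃ (F : Finset Site) (L : Site → Ω → ℝ), (F : Set Site) = U ∧ IsOccupationField F P t L ∧
      ∀ E ⊆ U, P.real {ω | E ∩ lowSites (fun u => X u ω) t 0 = ∅} =
          P.real {ω | ∀ y ∈ E, L y ω ≠ 0} ∧
        P.real {ω | E ∩ lowSites (fun u => X u ω) t 0 ≠ ∅} = P.real {ω | ∃ y ∈ E, L y ω = 0} := by
  obtain ⟨F, rfl⟩ := hU.exists_finset_coe
  obtain ⟨L, hL, hae⟩ := hX.exists_occupationField (by simpa using hne) ht
  refine ⟨F, L, rfl, hL, fun E hE => ?_⟩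
  have key : ∀ᵐ ω ∂P, E ∩ lowSites (fun u => X u ω) t 0 = ∅ ↔ ∀ y ∈ E, L y ω ≠ 0 := by
    filter_upwards [hae] with ω hω
    rw [Set.eq_empty_iff_forall_notMem]
    refine forall_congr' fun y => ?_
    rw [Set.mem_inter_iff, not_and]
    refine forall_congr' fun hy => not_congr ?_
    have hmem : y ∈ lowSites (fun u => X u ω) t 0 ↔ ∃ h : y ∈ (F : Set Site),
      boundaryLocalTime (fun u => X u ω) t (some ⟨y, h⟩) ≤ 0 := Iff.rfl
    rw [hmem]
    constructor
    · rintro ⟨h, hle⟩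
      obtain ⟨h1, h2⟩ := hω y h
      rw [h1] at hle
      exact le_antisymm hle h2
    · intro h0
      exact ⟨hE hy, by rw [(hω y (hE hy)).1, h0]⟩
  constructor
  · refine measureReal_congr ?_
    filter_upwards [key] with ω hω
    exact propext hω
  · refine measureReal_congr ?_
    filter_upwards [key] with ω hω
    refine propext ((not_congr hω).trans ?_)
    push Not
    rfl

/-! ### Asymptotics -/

/-- A perturbation `e n` of the Green function scale `n` is negligible if it does not change the
exponent `t / n` of the visiting probabilities, which has order `log n`, in the limit. -/
def Negligible (e : ℝ → ℝ) : Prop := Tendsto (fun n => e n * Real.log n / n) atTop (𝓝 0)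

namespace Negligible

variable {e e' : ℝ → ℝ}

theorem add (he : Negligible e) (he' : Negligible e') : Negligible fun n => e n + e' n := by
  have h : Tendsto _ atTop _ := Tendsto.add he he'
  rw [add_zero] at h
  refine h.congr fun n => ?_
  ring

theorem const_mul (a : ℝ) (he : Negligible e) : Negligible fun n => a * e n := by
  have h : Tendsto _ atTop _ := Tendsto.const_mul a he
  rw [mul_zero] at h
  refine h.congr fun n => ?_
  ring

theorem rpow {b : ℝ} (hb : b < 1) : Negligible fun n => n ^ b := by
  have h := (isLittleO_log_rpow_atTop (sub_pos.2 hb)).tendsto_div_nhds_zero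
  refine h.congr' ?_
  filter_upwards [eventually_gt_atTop 0] with n hn
  rw [Real.rpow_sub hn, Real.rpow_one]
  have := (Real.rpow_pos_of_pos hn b).ne'
  field_simp

theorem const (a : ℝ) : Negligible fun _ => a := by
  have h := (rpow (b := 0) zero_lt_one).const_mul a
  simpa using h

theorem log : Negligible Real.log := by
  have h := (Real.isLittleO_pow_log_id_atTop (n := 2)).tendsto_div_nhds_zero
  refine h.congr fun n => ?_
  rw [sq, id]

theorem tendsto_div (he : Negligible e) : Tendsto (fun n => e n / n) atTop (𝓝 0) := by
  have h : Tendsto _ atTop _ := Tendsto.mul he Real.tendsto_log_atTop.inv_tendsto_atTop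
  rw [zero_mul] at h
  refine h.congr' ?_
  filter_upwards [eventually_gt_atTop 1] with n hn
  have := (Real.log_pos hn).ne'
  simp only [Pi.inv_apply]
  field_simp

theorem eventually_pos (he : Negligible e) : ∀ᶠ n in atTop, 0 < n + e n := by
  filter_upwards [he.tendsto_div.eventually (lt_mem_nhds (show (-1 : ℝ) < 0 by norm_num)),
    eventually_gt_atTop 0] with n h hn
  rw [lt_div_iff₀ hn] at h
  linarith

theorem tendsto_phase_sub (he : Negligible e) (s : ℝ) :
    Tendsto (fun n => phaseBTime s n / n - phaseBTime s n / (n + e n)) atTop (𝓝 0) := by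
  have h1 : Tendsto _ atTop _ :=
    (((Tendsto.const_mul (1 / 2) he).add (he.tendsto_div.const_mul s)).div
      (he.tendsto_div.const_add 1) (by norm_num))
  simp only [mul_zero, add_zero, zero_div] at h1
  refine h1.congr' ?_
  filter_upwards [he.eventually_pos, eventually_gt_atTop 0] with n h hn
  have h2 : 1 + e n / n ≠ 0 := by
    have : 1 + e n / n = (n + e n) / n := by field_simp
    rw [this]
    positivity
  rw [phaseBTime, Pi.div_apply]
  field_simp
  ring

end Negligible

theorem exp_neg_phaseBTime_div (s : ℝ) {n : ℝ} (hn : 0 < n) :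
    Real.exp (-(phaseBTime s n / n)) = Real.exp (-s) / √n := by
  have h : -(phaseBTime s n / n) = -s - Real.log n / 2 := by
    rw [phaseBTime]; field_simp; ring
  rw [h, Real.exp_sub, Real.sqrt_eq_rpow, Real.rpow_def_of_pos hn]
  ring_nf

/-- With `e = 0` these are the probabilities `(e ^ (-s) / √n) ^ j` of `j` independent rare events; a
negligible `e` does not matter. -/
theorem eventually_exp_phase {e : ℝ → ℝ} (he : Negligible e) (s : ℝ) (j : ℕ) {δ : ℝ} (hδ : 0 < δ) :
    ∀ᶠ n in atTop,
      Real.exp (-(j * (phaseBTime s n / (n + e n)))) ≤ (1 + δ) * (Real.exp (-s) / √n) ^ j ∧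
      (1 - δ) * (Real.exp (-s) / √n) ^ j ≤ Real.exp (-(j * (phaseBTime s n / (n + e n)))) := by
  have h := ((he.tendsto_phase_sub s).const_mul (j : ℝ)).rexp
  rw [mul_zero, Real.exp_zero] at h
  filter_upwards [h.eventually (gt_mem_nhds (show 1 < 1 + δ by linarith)),
    h.eventually (lt_mem_nhds (show 1 - δ < 1 by linarith)), eventually_gt_atTop 0] with n h1 h2 hn
  have e1 : Real.exp (-(j * (phaseBTime s n / (n + e n)))) =
      Real.exp (j * (phaseBTime s n / n - phaseBTime s n / (n + e n))) *
        (Real.exp (-s) / √n) ^ j := by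
    rw [← exp_neg_phaseBTime_div s hn, ← Real.exp_nat_mul, ← Real.exp_add]
    ring_nf
  have hp : 0 < Real.exp (-s) / √n := by positivity
  rw [e1]
  constructor <;> gcongr

theorem eventually_phaseBTime_nonneg (s : ℝ) : ∀ᶠ n in atTop, 0 ≤ phaseBTime s n := by
  filter_upwards [Real.tendsto_log_atTop.eventually_ge_atTop (-2 * s), eventually_gt_atTop 0]
    with n h hn
  rw [phaseBTime]
  nlinarith

theorem tendsto_exp_div_sqrt (s : ℝ) :
    Tendsto (fun n : ℝ => Real.exp (-s) / √n) atTop (𝓝 0) :=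
  Real.tendsto_sqrt_atTop.const_div_atTop _

theorem tendsto_clusterScale_div {η₀ : ℝ} (hη : 0 < η₀) :
    Tendsto (fun n => clusterScale η₀ n / n ^ (1 / 2 - η₀ / 2)) atTop (𝓝 0) := by
  have h := tendsto_rpow_neg_atTop (y := η₀ / 2) (by linarith)
  refine h.congr' ?_
  filter_upwards [eventually_gt_atTop 0] with n hn
  rw [clusterScale, ← Real.rpow_sub hn]
  congr 1
  ring

/-- The scale `n ^ (1 / 2 - η₀ / 2)` dominates the cluster scale and the logarithm. -/
theorem tendsto_cluster_fluctuation {η₀ : ℝ} (hη : 0 < η₀) (hη' : η₀ < 1 / 2) (a b c : ℝ) :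
    Tendsto (fun n => (a + b * Real.log n + c * clusterScale η₀ n) / n ^ (1 / 2 - η₀ / 2))
      atTop (𝓝 0) := by
  have hpos : 0 < 1 / 2 - η₀ / 2 := by linarith
  have h1 := (tendsto_rpow_atTop hpos).const_div_atTop a
  have h2 := (isLittleO_log_rpow_atTop hpos).tendsto_div_nhds_zero.const_mul b
  have h3 := (tendsto_clusterScale_div hη).const_mul c
  have h := (h1.add h2).add h3
  simp only [mul_zero, add_zero] at h
  refine h.congr fun n => ?_
  ring

/-- The bound for the probability that a cluster contains an unvisited site, with the bound
`R = n ^ (1 / 2 - η₀ / 2)` for the variation of the Green function, the threshold `a = R ^ 2` for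
the local time, and `l = n ^ (-1 + η₀ / 2)`. Then `l * a → 0` while `1 / l` is negligible, and the decay
`exp (-a / (8 * R)) = exp (-R / 8)` beats the number of sites in a cluster. -/
theorem eventually_cluster_prob_le {η₀ : ℝ} (hη : 0 < η₀) (hη' : η₀ < 1 / 2) (s : ℝ) {C : ℝ}
    (hC : 0 ≤ C) {δ : ℝ} (hδ : 0 < δ) :
    ∀ᶠ n in atTop,
      Real.exp (1 / n ^ (1 - η₀ / 2) * (n ^ (1 / 2 - η₀ / 2)) ^ 2) *
          Real.exp (-(phaseBTime s n / (n + C + 1 / (1 / n ^ (1 - η₀ / 2))))) +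
        36 * Real.exp (clusterScale η₀ n) ^ 2 *
          Real.exp (-((n ^ (1 / 2 - η₀ / 2)) ^ 2 / (8 * n ^ (1 / 2 - η₀ / 2))) +
            n ^ (1 / 2 - η₀ / 2) * (phaseBTime s n / (n + C) ^ 2)) ≤
      (1 + δ) * (Real.exp (-s) / √n) := by
  have hpos : 0 < 1 / 2 - η₀ / 2 := by linarith
  have hE := ((Negligible.const C).add (Negligible.rpow (b := 1 - η₀ / 2)
    (by linarith))).tendsto_phase_sub s
  have h1 := ((tendsto_rpow_neg_atTop (y := η₀ / 2) (by linarith)).add hE).rexp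
  rw [add_zero, Real.exp_zero] at h1
  have hphase : Tendsto (fun n => phaseBTime s n / n ^ 2) atTop (𝓝 0) := by
    have h := (Negligible.log.tendsto_div.const_mul (1 / 2)).add
      ((Negligible.const s).tendsto_div)
    simp only [mul_zero, add_zero] at h
    refine h.congr' ?_
    filter_upwards [eventually_gt_atTop 0] with n hn
    rw [phaseBTime]
    field_simp
  have h2 : Tendsto (fun n => n ^ (1 / 2 - η₀ / 2) *
      ((Real.log 36 + s + 1 / 2 * Real.log n + 2 * clusterScale η₀ n) / n ^ (1 / 2 - η₀ / 2) -
        1 / 8 + phaseBTime s n / n ^ 2)) atTop atBot := by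
    refine (tendsto_rpow_atTop hpos).atTop_mul_neg (show (-(1 / 8) : ℝ) < 0 by norm_num) ?_
    have := ((tendsto_cluster_fluctuation hη hη' (Real.log 36 + s) (1 / 2) 2).sub_const
      (1 / 8)).add hphase
    rwa [zero_sub, add_zero] at this
  filter_upwards [h1.eventually (gt_mem_nhds (show 1 < 1 + δ / 2 by linarith)),
    (Real.tendsto_exp_atBot.comp h2).eventually (gt_mem_nhds (show 0 < δ / 2 by linarith)),
    eventually_gt_atTop 0, eventually_phaseBTime_nonneg s] with n g1 g2 hn ht
  have hp : 0 < Real.exp (-s) / √n := by positivity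
  have hR : 0 < n ^ (1 / 2 - η₀ / 2) := Real.rpow_pos_of_pos hn _
  have e1 : 1 / n ^ (1 - η₀ / 2) * (n ^ (1 / 2 - η₀ / 2)) ^ 2 = n ^ (-(η₀ / 2)) := by
    rw [← Real.rpow_natCast, ← Real.rpow_mul hn.le, one_div, ← Real.rpow_neg hn.le,
      ← Real.rpow_add hn]
    congr 1
    push_cast
    ring
  have e2 : Real.exp (n ^ (-(η₀ / 2))) *
      Real.exp (-(phaseBTime s n / (n + C + 1 / (1 / n ^ (1 - η₀ / 2))))) =
      Real.exp (n ^ (-(η₀ / 2)) + (phaseBTime s n / n -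
        phaseBTime s n / (n + (C + n ^ (1 - η₀ / 2))))) * (Real.exp (-s) / √n) := by
    rw [← exp_neg_phaseBTime_div s hn, ← Real.exp_add, ← Real.exp_add, one_div_one_div, add_assoc n]
    ring_nf
  rw [e1, e2, add_comm 1 δ, show (δ + 1) * (Real.exp (-s) / √n) =
    (1 + δ / 2) * (Real.exp (-s) / √n) + δ / 2 * (Real.exp (-s) / √n) by ring]
  refine add_le_add (by gcongr) ?_
  have e3 : 36 * Real.exp (clusterScale η₀ n) ^ 2 *
      Real.exp (-((n ^ (1 / 2 - η₀ / 2)) ^ 2 / (8 * n ^ (1 / 2 - η₀ / 2))) +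
            n ^ (1 / 2 - η₀ / 2) * (phaseBTime s n / (n + C) ^ 2)) =
      Real.exp (Real.log 36 + s + 1 / 2 * Real.log n + 2 * clusterScale η₀ n -
        n ^ (1 / 2 - η₀ / 2) / 8 + n ^ (1 / 2 - η₀ / 2) * (phaseBTime s n / (n + C) ^ 2)) *
        (Real.exp (-s) / √n) := by
    have h36 : (36 : ℝ) = Real.exp (Real.log 36) := (Real.exp_log (by norm_num)).symm
    nth_rewrite 1 [h36]
    rw [← exp_neg_phaseBTime_div s hn, ← Real.exp_nat_mul, ← Real.exp_add, ← Real.exp_add,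
      ← Real.exp_add]
    congr 1
    rw [phaseBTime]
    field_simp
    ring
  rw [e3]
  gcongr
  refine le_trans ?_ g2.le
  rw [Function.comp_apply, Real.exp_le_exp, mul_add, mul_sub, mul_div_cancel₀ _ hR.ne']
  have : phaseBTime s n / (n + C) ^ 2 ≤ phaseBTime s n / n ^ 2 := by
    gcongr
    linarith
  have := mul_le_mul_of_nonneg_left this hR.le
  linarith

/-! ### The two claims -/

/-- The first moment bound for the unvisited set. -/
theorem eventually_prob_hit_le {D : Set Plane} (hD : IsNice D) (s : ℝ) :
    ∀ᶠ n : ℝ in atTop, ∀ {Ω : Type*} [MeasurableSpace Ω] (P : Measure Ω) [IsProbabilityMeasure P]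
      (X : ℝ → Ω → WiredVertex (latticeDomain D n)),
      IsWiredWalk (latticeDomain D n) (1 / (2 * Real.pi)) P X →
      ∀ E ⊆ latticeDomain D n,
        P.real {ω | E ∩ lowSites (fun u => X u ω) (phaseBTime s n) 0 ≠ ∅} ≤
          2 * Real.exp (-s) * ((E.ncard : ℝ) / √n) := by
  obtain ⟨C, hC, hgreen⟩ := exists_green_bounds hD.isBounded
  filter_upwards [eventually_latticeDomain_nonempty hD, eventually_phaseBTime_nonneg s,
    eventually_gt_atTop 0, eventually_exp_phase (Negligible.const C) s 1 zero_lt_one]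
    with n hne ht hn hexp Ω _ P _ X hX E hE
  obtain ⟨F, L, hF, hL, hlow⟩ :=
    hX.exists_prob_lowSites_eq (finite_latticeDomain hD.isBounded n) hne ht
  have hEF : E ⊆ (F : Set Site) := hF ▸ hE
  have hEfin : E.Finite := F.finite_toSet.subset hEF
  rw [(hlow E hE).2]
  lift E to Finset Site using hEfin
  rw [Finset.coe_subset] at hEF
  have hone : ∀ y ∈ E, P.real {ω | L y ω = 0} ≤ 2 * (Real.exp (-s) / √n) := by
    intro y hy
    have h := hL.prob_separated_unvisited_le ht (hgreen n hn.le F hF).1 (J := {y}) (c := n + C)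
      (by simpa using hEF hy) (by linarith) le_rfl (by simp)
    simp only [Finset.mem_singleton, forall_eq, Finset.card_singleton, sub_self, mul_zero,
      add_zero] at h
    refine h.trans (hexp.1.trans_eq ?_)
    ring
  have hcov : {ω | ∃ y ∈ (E : Set Site), L y ω = 0} ⊆ ⋃ y ∈ E, {ω | L y ω = 0} := by
    rintro ω ⟨y, hy, h⟩
    exact Set.mem_iUnion₂.2 ⟨y, hy, h⟩
  refine (measureReal_mono hcov (measure_ne_top P _)).trans ((measureReal_biUnion_finset_le _ _).trans
    ((Finset.sum_le_sum hone).trans_eq ?_))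
  rw [Finset.sum_const, nsmul_eq_mul, Set.ncard_coe_finset]
  ring

/-- The constants in the Poisson approximation: `B` makes `exp (-B)` small, then `K` the tail of the
exponential series, then `δ` the errors of the joint probabilities. -/
theorem exists_poisson_constants {ε : ℝ} (hε : 0 < ε) : ∃ (B : ℝ) (K : ℕ) (δ : ℝ),
    0 ≤ B ∧ 1 ≤ K ∧ 0 < δ ∧ Real.exp (-B) + δ * Real.exp (B + 1) +
      (2 + δ) * ((B + 1) ^ K / K.factorial) + 2 * δ * (B + 1) ≤ ε := by
  obtain ⟨B, hB, hB0⟩ := ((Real.tendsto_exp_neg_atTop_nhds_zero.eventually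
    (gt_mem_nhds (show 0 < ε / 4 by linarith))).and (eventually_ge_atTop 0)).exists
  obtain ⟨K, hK, hK1⟩ := (((FloorSemiring.tendsto_pow_div_factorial_atTop (B + 1)).eventually
    (gt_mem_nhds (show 0 < ε / 12 by linarith))).and (eventually_ge_atTop 1)).exists
  set W := Real.exp (B + 1) + 2 * (B + 1) with hW
  have hW0 : 0 < W := by positivity
  refine ⟨B, K, min 1 (ε / 4 / W), hB0, hK1, by positivity, ?_⟩
  have h1 : min 1 (ε / 4 / W) ≤ 1 := min_le_left _ _
  have h2 : min 1 (ε / 4 / W) * W ≤ ε / 4 := by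
    rw [← le_div_iff₀ hW0]; exact min_le_right _ _
  have h3 : 0 ≤ (B + 1) ^ K / (K.factorial : ℝ) := by positivity
  generalize min 1 (ε / 4 / W) = δ at *
  have h4 : (2 + δ) * ((B + 1) ^ K / K.factorial) ≤ 3 * (ε / 12) := by
    refine mul_le_mul (by linarith) hK.le h3 (by norm_num)
  rw [hW] at h2
  linarith

/-- The Poisson approximation, uniformly over all clustered sets in the bulk. -/
theorem eventually_abs_prob_clustered_sub_le {D : Set Plane} (hD : IsNice D) {η₀ : ℝ}
    (hη : 0 < η₀) (hη' : η₀ < 1 / 2) (s : ℝ) {ε : ℝ} (hε : 0 < ε) :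
    ∀ᶠ n : ℝ in atTop, ∀ {Ω : Type*} [MeasurableSpace Ω] (P : Measure Ω) [IsProbabilityMeasure P]
      (X : ℝ → Ω → WiredVertex (latticeDomain D n)),
      IsWiredWalk (latticeDomain D n) (1 / (2 * Real.pi)) P X →
      ∀ A ⊆ domainBulk D n, IsClustered (clusterScale η₀ n) (n - clusterScale η₀ n) A →
        |P.real {ω | A ∩ lowSites (fun u => X u ω) (phaseBTime s n) 0 = ∅} -
          Real.exp (-(Real.exp (-s) * (clusteringNumber (n - clusterScale η₀ n) A : ℝ) / √n))| ≤
        ε := by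
  obtain ⟨C, hC, hgreen⟩ := exists_green_bounds hD.isBounded
  obtain ⟨B, K, δ, hB, hK, hδ, hconst⟩ := exists_poisson_constants (half_pos hε)
  have hr : Negligible (clusterScale η₀) := Negligible.rpow (by linarith)
  have hm : Negligible fun n => -C + -2 * Real.log n :=
    (Negligible.const (-C)).add (Negligible.log.const_mul (-2))
  have hj : ∀ j : ℕ, Negligible fun n => C + j * ((C + 8) + clusterScale η₀ n) := fun j =>
    (Negligible.const C).add (((Negligible.const (C + 8)).add hr).const_mul j)
  have hpow : 0 < 1 / 2 - η₀ / 2 := by linarith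
  have hup := (eventually_all_finite (Set.finite_Iic K)).2 fun j _ =>
    eventually_exp_phase (hj j) s j hδ
  have hdown := (eventually_all_finite (Set.finite_Iic K)).2 fun j _ =>
    eventually_exp_phase hm s j hδ
  have hB1 : 0 < min 1 (ε / 2 / (B + 1)) := by positivity
  filter_upwards [eventually_latticeDomain_nonempty hD, eventually_phaseBTime_nonneg s,
    eventually_gt_atTop 0, hup, hdown, hm.eventually_pos,
    (((Negligible.const (-10)).add (hr.const_mul (-2)))).eventually_pos,
    ((Negligible.rpow (b := 1 / 2 - η₀ / 2) (by linarith)).const_mul (-2)).eventually_pos,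
    (tendsto_rpow_atTop hpow).eventually_ge_atTop 1,
    (tendsto_cluster_fluctuation hη hη' (2 * C + 1 / 2 * Real.log (2 ^ 2 + 1)) 2 1).eventually
      (gt_mem_nhds zero_lt_one),
    (tendsto_exp_div_sqrt s).eventually (gt_mem_nhds hB1),
    eventually_cluster_prob_le hη hη' s hC hδ]
    with n hne ht hn hup hdown hm hrn hRn hR1 hRr hp hcl Ω _ P _ X hX A hA hAcl
  obtain ⟨F, L, hF, hL, hlow⟩ :=
    hX.exists_prob_lowSites_eq (finite_latticeDomain hD.isBounded n) hne ht
  have hAD := hA.trans (domainBulk_subset D n)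
  rw [(hlow A hAD).1]
  have hAF : A ⊆ (F : Set Site) := hF ▸ hAD
  obtain ⟨hg1, hg2⟩ := hgreen n hn.le F hF
  have hp0 : 0 < Real.exp (-s) / √n := by positivity
  have hp1 : Real.exp (-s) / √n ≤ 1 := hp.le.trans (min_le_left _ _)
  have hp2 : (B + 1) * (Real.exp (-s) / √n) ≤ ε / 2 := by
    rw [mul_comm, ← le_div_iff₀ (by positivity)]
    exact hp.le.trans (min_le_right _ _)
  have hexp : Real.exp (-s) * (clusteringNumber (n - clusterScale η₀ n) A : ℝ) / √n =
      clusteringNumber (n - clusterScale η₀ n) A * (Real.exp (-s) / √n) := by ring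
  rw [hexp]
  rcases A.eq_empty_or_nonempty with rfl | hAne
  -- the clustering number of the empty set is one, which costs at most `e ^ (-s) / √n`
  · rw [clusteringNumber_empty]
    have h1 := Real.add_one_le_exp (-(Real.exp (-s) / √n))
    have h2 : Real.exp (-(Real.exp (-s) / √n)) ≤ 1 := Real.exp_le_one_iff.2 (by linarith)
    have h3 : B * (Real.exp (-s) / √n) ≥ 0 := by positivity
    simp only [Set.mem_empty_iff_false, IsEmpty.forall_iff, implies_true, Set.ofPred_true,
      probReal_univ, Nat.cast_one, one_mul]
    rw [abs_le]
    constructor <;> linarith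
  set r := clusterScale η₀ n with hr_def
  have hr0 : 0 ≤ r := Real.rpow_nonneg hn.le _
  have hfloor := Nat.lt_floor_add_one (n - r)
  have hR0 : 0 < n ^ (1 / 2 - η₀ / 2) := by linarith
  have hpos : 0 < n ^ (1 - η₀ / 2) := Real.rpow_pos_of_pos hn _
  rw [div_lt_one hR0] at hRr
  -- `n - r - 8` is a lower bound for the log-distance of two clusters
  have hcb : 2 * Real.exp (n - r - 8) ≤ 1 / 10 * Real.exp ⌊n - r⌋₊ := by
    have h1 := Real.quadratic_le_exp_of_nonneg (show (0 : ℝ) ≤ 7 by norm_num)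
    have h2 : Real.exp (n - r - 8 + 7) ≤ Real.exp ⌊n - r⌋₊ := Real.exp_le_exp.2 (by linarith)
    rw [Real.exp_add] at h2
    nlinarith [Real.exp_pos (n - r - 8)]
  have hrb : 40 * Real.exp r ≤ Real.exp ⌊n - r⌋₊ := by
    have h1 := Real.quadratic_le_exp_of_nonneg (show (0 : ℝ) ≤ 9 by norm_num)
    have h2 : Real.exp (r + 9) ≤ Real.exp ⌊n - r⌋₊ := Real.exp_le_exp.2 (by linarith)
    rw [Real.exp_add] at h2
    nlinarith [Real.exp_pos r]
  refine (hL.abs_prob_clustered_sub_exp_le ht hAF hAne (M := n + C)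
    (m := n + (-C + -2 * Real.log n)) hm hg1 (fun x hx y hy => ?_) hr0 hAcl hrb
    (c := n - r - 8) (by linarith) hcb (R := n ^ (1 / 2 - η₀ / 2)) hR1 (by linarith)
    (by linarith) (l := 1 / n ^ (1 - η₀ / 2)) (a := (n ^ (1 / 2 - η₀ / 2)) ^ 2) (by positivity)
    (by positivity) hK hp0 hp1 hδ.le hB (fun j hjK => ?_) (fun j hjK => (hdown j hjK).2)
    hcl).trans (by linarith)
  · linarith [hg2 x hx y (hA hy)]
  · have e : n + C + j * (n + C - (n - r - 8)) = n + (C + j * ((C + 8) + r)) := by ring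
    rw [e]
    exact (hup j hjK).1

end WiredWalk

end

theorem mainTheorem4 {D : Set WiredWalk.Plane} (hD : WiredWalk.IsNice D)
    {η₀ : ℝ} (hη₀ : 0 < η₀ ∧ η₀ < 1 / 2)
    {Ω : ℝ → Type*} [∀ n, MeasurableSpace (Ω n)]
    (P : ∀ n, Measure (Ω n)) [∀ n, IsProbabilityMeasure (P n)]
    (X : ∀ n : ℝ, ℝ → Ω n → WiredWalk.WiredVertex (WiredWalk.latticeDomain D n))
    (hX : ∀ n : ℝ, 0 < n → (WiredWalk.latticeDomain D n).Nonempty →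
      WiredWalk.IsWiredWalk (WiredWalk.latticeDomain D n) (1 / (2 * Real.pi)) (P n) (X n))
    (s : ℝ) :
    Tendsto
      (fun n : ℝ =>
        ⨆ A : {A : Set WiredWalk.Site // A ⊆ WiredWalk.domainBulk D n ∧
            WiredWalk.IsClustered (WiredWalk.clusterScale η₀ n)
              (n - WiredWalk.clusterScale η₀ n) A},
          |(P n).real {ω | A.1 ∩ WiredWalk.lowSites (fun u => X n u ω)
                (WiredWalk.phaseBTime s n) 0 = ∅} -
            Real.exp (-(Real.exp (-s) *
              (WiredWalk.clusteringNumber (n - WiredWalk.clusterScale η₀ n) A.1 : ℝ) /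
                √n))|)
      atTop (𝓝 0) ∧
    ∀ᶠ n : ℝ in atTop, ∀ E : Set WiredWalk.Site, E ⊆ WiredWalk.latticeDomain D n →
      (P n).real {ω | E ∩ WiredWalk.lowSites (fun u => X n u ω)
            (WiredWalk.phaseBTime s n) 0 ≠ ∅} ≤
        2 * Real.exp (-s) * ((E.ncard : ℝ) / √n) := by
  constructor
  · rw [Metric.tendsto_nhds]
    intro ε hε
    filter_upwards [WiredWalk.eventually_abs_prob_clustered_sub_le hD hη₀.1 hη₀.2 s (half_pos hε),
      WiredWalk.eventually_latticeDomain_nonempty hD, eventually_gt_atTop 0] with n h hne hn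
    rw [Real.dist_eq, sub_zero, abs_of_nonneg (Real.iSup_nonneg fun A => abs_nonneg _)]
    refine lt_of_le_of_lt (Real.iSup_le (fun A => ?_) (half_pos hε).le) (half_lt_self hε)
    exact h (P n) (X n) (hX n hn hne) A.1 A.2.1 A.2.2
  · filter_upwards [WiredWalk.eventually_prob_hit_le hD s,
      WiredWalk.eventually_latticeDomain_nonempty hD, eventually_gt_atTop 0] with n h hne hn
    exact h (P n) (X n) (hX n hn hne)
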